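/- Let $\Gamma$ be an abelian group and $\varepsilon:\Gamma\times\Gamma\to\mathbb C^*$ a commutation factor: $\varepsilon(i,j)\varepsilon(j,i)=1$, and $\varepsilon$ is multiplicative in each variable. It is called proper if $\varepsilon(i,i)=1$ for all $i$. Let $A=M_D(\mathbb C)$, $D<\infty$, with a fine $\Gamma$-grading $A=\bigoplus_\alpha A^\alpha$, i.e. $\dim A^\alpha\le 1$ for all $\alpha$. *Notation.* Formulas with degrees $|\cdot|$ are meant for homogeneous elements and are extended linearly. Put $[a,b]_\varepsilon=ab-\varepsilon(|a|,|b|)ba$ and $\mathrm{ad}_a=[a,\cdot\,]_\varepsilon$. The $\varepsilon$-center is $Z=\{a:\ [a,b]_\varepsilon=0\ \forall b\in A\}$. $\mathrm{Der}_\varepsilon(A)$ is the $\Gamma$-graded space of $\varepsilon$-derivations, $X(ab)=X(a)b+\varepsilon(|X|,|a|)aX(b)$, with bracket $[X,Y]_\varepsilon=XY-\varepsilon(|X|,|Y|)YX$ and $(Xz)(a)=\varepsilon(|X|,|z|)\,zX(a)$ for $z\in Z$. $\Omega_\varepsilon(A)=\bigoplus_{n\in\mathbb N,k\in\Gamma}\Omega^{n,k}_\varepsilon(A)$,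 where $\Omega^{n,k}_\varepsilon(A)$ is the space of $n$-linear maps $\omega:\mathrm{Der}_\varepsilon(A)^n\to A$ with $\omega(X_1,\dots,X_n)\in A^{k+\sum|X_i|}$, $\omega(X_1,\dots,X_nz)=\omega(X_1,\dots,X_n)z$ for $z\in Z$, and $\omega(\dots,X_i,X_{i+1},\dots)=-\varepsilon(|X_i|,|X_{i+1}|)\,\omega(\dots,X_{i+1},X_i,\dots)$ (and $\Omega^{0,k}_\varepsilon(A)=A^k$). For $\omega\in\Omega_\varepsilon^{p,k}(A)$, $\eta\in\Omega_\varepsilon^{q,l}(A)$ the product and differential are $$(\omega\eta)(X_1,\dots,X_{p+q})=\tfrac1{p!q!}\sum_{s\in S_{p+q}}\mathrm{sgn}(s)\prod_{i<j,\,s(i)>s(j)}\varepsilon(|X_{s(j)}|,|X_{s(i)}|)\prod_{i\le p}\varepsilon(l,|X_{s(i)}|)\;\omega(X_{s(1)},\dots,X_{s(p)})\,\eta(X_{s(p+1)},\dots,X_{s(p+q)}),$$ $$d\omega(X_1,\dots,X_{p+1})=\sum_m(-1)^{m+1}\varepsilon(k,|X_m|)\prod_{a<m}\varepsilon(|X_a|,|X_m|)\;X_m\,\omega(\dots\widehat{X_m}\dots)$$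 $$\qquad+\sum_{m<n}(-1)^{m+n}\varepsilon(|X_n|,|X_m|)\prod_{a<m}\varepsilon(|X_a|,|X_m|)\prod_{a<n}\varepsilon(|X_a|,|X_n|)\;\omega([X_m,X_n]_\varepsilon,\dots\widehat{X_m}\dots\widehat{X_n}\dots).$$ Let $\mathrm{Supp}=\{\alpha:A^\alpha\ne0\}$, let $(e_\alpha)_{\alpha\in\mathrm{Supp}}$ be a homogeneous basis, $e_\alpha e_\beta=\sigma(\alpha,\beta)e_{\alpha+\beta}$, $\varepsilon_\sigma(\alpha,\beta)=\sigma(\alpha,\beta)\sigma(\beta,\alpha)^{-1}$, and $\Gamma_{\varepsilon,\varepsilon_\sigma}=\{\alpha\in\mathrm{Supp}:\varepsilon(\alpha,\beta)=\varepsilon_\sigma(\alpha,\beta)\ \forall\beta\in\mathrm{Supp}\}$. Put $I=I_\varepsilon(A)=\bigoplus_{\alpha\notin\Gamma_{\varepsilon,\varepsilon_\sigma}}A^\alpha$. Let $I^*$ be the graded dual of $I$ over $Z$: right $Z$-linear maps $\theta:I\to Z$, $\theta(I^\alpha)\subset Z^{\alpha+|\theta|}$, with $(z\theta)(x)=z\theta(x)$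 and $\theta z=\varepsilon(|\theta|,|z|)z\theta$. Let $\Lambda_{\varepsilon,Z}(I^*)$ be the quotient of the tensor algebra of $I^*$ over $Z$ by the relations $\theta\eta+\varepsilon(|\theta|,|\eta|)\eta\theta=0$. Let $T=A\otimes_Z\Lambda_{\varepsilon,Z}(I^*)$ be the $\varepsilon$-graded tensor product, $(a\otimes\lambda)(b\otimes\mu)=\varepsilon(|\lambda|,|b|)\,ab\otimes\lambda\mu$, where $|\lambda|$ is the $\Gamma$-degree; it is $(\mathbb Z\times\Gamma)$-graded by exterior degree and total $\Gamma$-degree. An element of $T$ of exterior degree $n$ is evaluated on $I^n$ by $$(a\otimes\theta_1\wedge\dots\wedge\theta_n)(x_1,\dots,x_n)=a\sum_{s\in S_n}\mathrm{sgn}(s)\prod_{i<j,\,s(i)>s(j)}\varepsilon(|x_{s(j)}|,|x_{s(i)}|)\prod_{i<j}\varepsilon(|\theta_j|,|x_{s(i)}|)\;\theta_1(x_{s(1)})\cdots\theta_n(x_{s(n)}).$$ **Theorem.** 1. The evaluation is well defined on $T$, and there is a unique map $\mathrm{ad}_*:T\to\Omega_\varepsilon(A)$ with $\mathrm{ad}_*(u)(\mathrm{ad}_{x_1},\dots,\mathrm{ad}_{x_n})=u(x_1,\dots,x_n)$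 for all $n$ and $x_i\in I$. It is an isomorphism of $(\mathbb Z\times\Gamma)$-graded algebras. 2. The $\varepsilon$-connections on $A$ (the linear maps $\nabla:A\to\Omega^{1,\bullet}_\varepsilon(A)$ with $\nabla(A^k)\subset\Omega_\varepsilon^{1,k}(A)$ and $\nabla(ab)=\nabla(a)b+a\,db$) form an affine space modeled on $\Omega^{1,0}_\varepsilon(A)$, a one-form $\omega$ acting by $(\nabla+\omega)(a)=\nabla(a)+\omega a$. Moreover $\Omega^{1,0}_\varepsilon(A)\simeq\bigoplus_{\alpha\notin\Gamma_{\varepsilon,\varepsilon_\sigma}}A^\alpha\otimes_Z(A^\alpha)^*$ in the following sense: for $\alpha\notin\Gamma_{\varepsilon,\varepsilon_\sigma}$, restriction to $A^\alpha$ identifies the component $(I^*)^{-\alpha}$ with the space $(A^\alpha)^*$ of linear functionals $A^\alpha\to\mathbb C=\mathbb C1$, and $\mathrm{ad}_*$ maps the span in $A\otimes_ZI^*$ of the elements $a\otimes\theta$ with $a\in A^\alpha$, $\theta\in(I^*)^{-\alpha}$, $\alpha\notin\Gamma_{\varepsilon,\varepsilon_\sigma}$, bijectively onto $\Omega^{1,0}_\varepsilon(A)$.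 3. If $\varepsilon$ is proper, then $[I,I]_\varepsilon\subset I$; there is a unique linear map $d:T\to T$ of degree $(1,0)$ which, under evaluation on $I$, is given by the above formula for $d\omega$ with arguments in $I$ acting on $A$ by $x\cdot a=[x,a]_\varepsilon$ and with the bracket of $I$; it satisfies $d^2=0$ and $d(uv)=d(u)v+(-1)^pu\,d(v)$ for $u$ of exterior degree $p$; and $\mathrm{ad}_*\circ d=d\circ\mathrm{ad}_*$. So $\mathrm{ad}_*$ is an isomorphism of graded differential algebras. -/

import Mathlib

open scoped TensorProduct DirectSum

noncomputable section

/-- Commutation factors on an abelian group, over the complex numbers. -/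
structure CommFactor (Γ : Type*) [AddCommGroup Γ] where
  toFun : Γ → Γ → ℂˣ
  mul_swap : ∀ i j, toFun i j * toFun j i = 1
  map_add_right : ∀ i j k, toFun i (j + k) = toFun i j * toFun i k
  map_add_left : ∀ i j k, toFun (i + j) k = toFun i k * toFun j k

namespace CommFactor

variable {Γ : Type*} [AddCommGroup Γ]

/-- The value of a commutation factor, as a complex number. -/
def val (ε : CommFactor Γ) (i j : Γ) : ℂ := (ε.toFun i j : ℂ)

/-- A commutation factor is proper when its signature function is constantly one. -/
def IsProper (ε : CommFactor Γ) : Prop := ∀ i, ε.val i i = 1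

theorem val_mul_swap (ε : CommFactor Γ) (i j : Γ) : ε.val i j * ε.val j i = 1 := by
  unfold val; rw [← Units.val_mul, ε.mul_swap]; rfl

theorem val_add_right (ε : CommFactor Γ) (i j k : Γ) :
    ε.val i (j + k) = ε.val i j * ε.val i k := by
  unfold val; rw [ε.map_add_right]; rfl

theorem val_add_left (ε : CommFactor Γ) (i j k : Γ) :
    ε.val (i + j) k = ε.val i k * ε.val j k := by
  unfold val; rw [ε.map_add_left]; rfl

theorem val_ne_zero (ε : CommFactor Γ) (i j : Γ) : ε.val i j ≠ 0 := Units.ne_zero _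

theorem val_zero_right (ε : CommFactor Γ) (i : Γ) : ε.val i 0 = 1 := by
  have h := ε.val_add_right i 0 0
  rw [add_zero] at h
  exact (mul_eq_left₀ (ε.val_ne_zero i 0)).1 h.symm

theorem val_zero_left (ε : CommFactor Γ) (i : Γ) : ε.val 0 i = 1 := by
  have h := ε.val_add_left 0 0 i
  rw [add_zero] at h
  exact (mul_eq_left₀ (ε.val_ne_zero 0 i)).1 h.symm

theorem val_neg_right (ε : CommFactor Γ) (i j : Γ) : ε.val i j * ε.val i (-j) = 1 := by
  rw [← ε.val_add_right, add_neg_cancel, ε.val_zero_right]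

end CommFactor

namespace EpsGraded

section General

set_option linter.unusedSectionVars false

variable {Γ : Type*} [AddCommGroup Γ] [DecidableEq Γ] {A : Type*} [Ring A] [Algebra ℂ A]
variable (ε : CommFactor Γ) (𝒜 : Γ → Submodule ℂ A) [GradedAlgebra 𝒜]

/-! ### The `ε`-bracket and the `ε`-center -/

/-- The linear map which multiplies the homogeneous elements of degree `α` by `ε(α, β)`. -/
def twistLin (β : Γ) : A →ₗ[ℂ] A :=
  (DirectSum.toModule ℂ Γ A fun α => ε.val α β • (𝒜 α).subtype) ∘ₗ
    (DirectSum.decomposeLinearEquiv 𝒜).toLinearMap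

variable {𝒜} in
theorem twistLin_of_mem {α : Γ} {a : A} (ha : a ∈ 𝒜 α) (β : Γ) :
    twistLin ε 𝒜 β a = ε.val α β • a := by
  rw [twistLin, LinearMap.comp_apply, LinearEquiv.coe_coe, DirectSum.decomposeLinearEquiv_apply,
    DirectSum.decompose_of_mem 𝒜 ha, ← DirectSum.lof_eq_of ℂ, DirectSum.toModule_lof]
  rfl

/-- Two linear maps which agree on the homogeneous elements are equal. -/
theorem lin_ext {N : Type*} [AddCommGroup N] [Module ℂ N] {f g : A →ₗ[ℂ] N}
    (h : ∀ α, ∀ a ∈ 𝒜 α, f a = g a) : f = g := by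
  ext a
  induction a using DirectSum.Decomposition.inductionOn 𝒜 with
  | zero => simp
  | homogeneous m => exact h _ _ m.2
  | add a b ha hb => simp [ha, hb]

theorem twistLin_one (β : Γ) : twistLin ε 𝒜 β 1 = 1 := by
  rw [twistLin_of_mem ε SetLike.GradedOne.one_mem, ε.val_zero_left, one_smul]

theorem twistLin_mul (β : Γ) (a b : A) :
    twistLin ε 𝒜 β (a * b) = twistLin ε 𝒜 β a * twistLin ε 𝒜 β b := by
  have : (LinearMap.mul ℂ A).compr₂ (twistLin ε 𝒜 β)
      = (LinearMap.mul ℂ A).compl₁₂ (twistLin ε 𝒜 β) (twistLin ε 𝒜 β) := by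
    refine lin_ext 𝒜 fun α a ha => lin_ext 𝒜 fun α' b hb => ?_
    simp only [LinearMap.compr₂_apply, LinearMap.compl₁₂_apply, LinearMap.mul_apply']
    rw [twistLin_of_mem ε ha, twistLin_of_mem ε hb,
      twistLin_of_mem ε (SetLike.GradedMul.mul_mem ha hb), ε.val_add_left, smul_mul_smul_comm]
  exact congrArg (fun f => f a b) this

/-- The algebra automorphism which multiplies the homogeneous elements of degree `α` by
`ε(α, β)`. -/
def twist (β : Γ) : A →ₐ[ℂ] A :=
  AlgHom.ofLinearMap (twistLin ε 𝒜 β) (twistLin_one ε 𝒜 β) (twistLin_mul ε 𝒜 β)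

variable {𝒜} in
theorem twist_of_mem {α : Γ} {a : A} (ha : a ∈ 𝒜 α) (β : Γ) :
    twist ε 𝒜 β a = ε.val α β • a := twistLin_of_mem ε ha β

/-- The bilinear map with `(a, b) ↦ ε(|a|, |b|) b a` on homogeneous elements. -/
def epsFlip : A →ₗ[ℂ] A →ₗ[ℂ] A :=
  ((DirectSum.toModule ℂ Γ (A →ₗ[ℂ] A) fun β =>
      (LinearMap.lcomp ℂ A (twistLin ε 𝒜 β)) ∘ₗ (LinearMap.mul ℂ A) ∘ₗ (𝒜 β).subtype) ∘ₗ
    (DirectSum.decomposeLinearEquiv 𝒜).toLinearMap).flip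

/-- The `ε`-bracket: `[a, b] = a b - ε(|a|, |b|) b a` on homogeneous elements, extended
bilinearly. It is also the adjoint map `a ↦ ad_a`. -/
def epsBracket : A →ₗ[ℂ] A →ₗ[ℂ] A := LinearMap.mul ℂ A - epsFlip ε 𝒜

variable {𝒜} in
theorem epsBracket_of_mem_right {β : Γ} (a : A) {b : A} (hb : b ∈ 𝒜 β) :
    epsBracket ε 𝒜 a b = a * b - b * twist ε 𝒜 β a := by
  rw [epsBracket, LinearMap.sub_apply, LinearMap.sub_apply, epsFlip, LinearMap.flip_apply,
    LinearMap.comp_apply, LinearEquiv.coe_coe, DirectSum.decomposeLinearEquiv_apply,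
    DirectSum.decompose_of_mem 𝒜 hb, ← DirectSum.lof_eq_of ℂ, DirectSum.toModule_lof]
  rfl

variable {𝒜} in
theorem epsBracket_of_mem {α β : Γ} {a b : A} (ha : a ∈ 𝒜 α) (hb : b ∈ 𝒜 β) :
    epsBracket ε 𝒜 a b = a * b - ε.val α β • (b * a) := by
  rw [epsBracket_of_mem_right ε a hb, twist_of_mem ε ha, mul_smul_comm]

theorem bracket_eq_zero_iff (a : A) :
    (∀ b, epsBracket ε 𝒜 a b = 0) ↔ ∀ β, ∀ b ∈ 𝒜 β, a * b = b * twist ε 𝒜 β a := by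
  constructor
  · intro h β b hb
    have := h b
    rwa [epsBracket_of_mem_right ε a hb, sub_eq_zero] at this
  · intro h
    have : epsBracket ε 𝒜 a = 0 := lin_ext 𝒜 fun β b hb => by
      rw [epsBracket_of_mem_right ε a hb, h β b hb, sub_self, LinearMap.zero_apply]
    intro b; rw [this]; rfl

/-- The `ε`-center. -/
def center : Subalgebra ℂ A where
  carrier := {a | ∀ b, epsBracket ε 𝒜 a b = 0}
  mul_mem' {z w} hz hw := by
    refine (bracket_eq_zero_iff ε 𝒜 _).2 fun β b hb => ?_
    have hz := (bracket_eq_zero_iff ε 𝒜 z).1 hz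
    have hw' := (bracket_eq_zero_iff ε 𝒜 w).1 hw β b hb
    rw [mul_assoc, hw', ← mul_assoc, hz β b hb, mul_assoc, map_mul]
  add_mem' {z w} hz hw := by intro b; simp [hz b, hw b]
  algebraMap_mem' r := by
    refine (bracket_eq_zero_iff ε 𝒜 _).2 fun β b _ => ?_
    rw [AlgHom.commutes, Algebra.commutes]

variable {𝒜 ε} in
theorem center_comm {z : A} (hz : z ∈ center ε 𝒜) {α β : Γ} (hzα : z ∈ 𝒜 α) {b : A}
    (hb : b ∈ 𝒜 β) : z * b = ε.val α β • (b * z) := by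
  have := hz b
  rwa [epsBracket_of_mem ε hzα hb, sub_eq_zero] at this

/-! ### `ε`-derivations -/

/-- The homogeneous `ε`-derivations of degree `γ`. -/
def DerHom (γ : Γ) : Submodule ℂ (A →ₗ[ℂ] A) where
  carrier := {X | (∀ α, ∀ a ∈ 𝒜 α, X a ∈ 𝒜 (α + γ)) ∧
    ∀ α, ∀ a ∈ 𝒜 α, ∀ b, X (a * b) = X a * b + ε.val γ α • (a * X b)}
  add_mem' {X Y} hX hY := ⟨fun α a ha => add_mem (hX.1 α a ha) (hY.1 α a ha), fun α a ha b => by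
    simp only [LinearMap.add_apply, hX.2 α a ha b, hY.2 α a ha b, add_mul, mul_add, smul_add]
    abel⟩
  zero_mem' := ⟨fun α a _ => zero_mem _, fun α a _ b => by simp⟩
  smul_mem' c X hX := ⟨fun α a ha => Submodule.smul_mem _ c (hX.1 α a ha), fun α a ha b => by
    simp only [LinearMap.smul_apply, hX.2 α a ha b, smul_add, smul_mul_assoc, mul_smul_comm,
      smul_comm c]⟩

/-- The space of all `ε`-derivations: the (direct) sum of its homogeneous components. -/
def Der : Submodule ℂ (A →ₗ[ℂ] A) := ⨆ γ, DerHom ε 𝒜 γ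

theorem DerHom_le_Der (γ : Γ) : DerHom ε 𝒜 γ ≤ Der ε 𝒜 := le_iSup (DerHom ε 𝒜) γ

variable {𝒜 ε}

/-- The bracket of two homogeneous `ε`-derivations is an `ε`-derivation. -/
theorem derBracket_mem {γ δ : Γ} {X Y : A →ₗ[ℂ] A} (hX : X ∈ DerHom ε 𝒜 γ)
    (hY : Y ∈ DerHom ε 𝒜 δ) :
    X ∘ₗ Y - ε.val γ δ • (Y ∘ₗ X) ∈ DerHom ε 𝒜 (γ + δ) := by
  refine ⟨fun α a ha => ?_, fun α a ha b => ?_⟩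
  · have h1 := hX.1 _ _ (hY.1 α a ha)
    have h2 := hY.1 _ _ (hX.1 α a ha)
    rw [show α + δ + γ = α + (γ + δ) by abel] at h1
    rw [add_assoc] at h2
    exact sub_mem h1 (Submodule.smul_mem _ _ h2)
  · have e1 := hX.2 _ _ (hY.1 α a ha) b
    have e2 := hY.2 _ _ (hX.1 α a ha) b
    have e3 := ε.val_mul_swap γ δ
    simp only [LinearMap.sub_apply, LinearMap.smul_apply, LinearMap.comp_apply, hX.2 α a ha b,
      hY.2 α a ha b, map_add, map_smul, e1, e2, hX.2 α a ha (Y b), hY.2 α a ha (X b),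
      ε.val_add_left, ε.val_add_right, smul_add, smul_smul, sub_mul, mul_sub, smul_sub,
      smul_mul_assoc, mul_smul_comm]
    have e4 : ε.val γ δ * (ε.val δ α * ε.val δ γ) = ε.val δ α := by
      linear_combination ε.val δ α * e3
    rw [e4]
    match_scalars <;> ring

/-- The module structure: `X z = ε(|X|, |z|) z X` is an `ε`-derivation for `z` in the
`ε`-center. -/
theorem centerMul_mem {β γ : Γ} {X : A →ₗ[ℂ] A} (hX : X ∈ DerHom ε 𝒜 γ) {z : A}
    (hz : z ∈ center ε 𝒜) (hzβ : z ∈ 𝒜 β) :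
    ε.val γ β • (LinearMap.mulLeft ℂ z ∘ₗ X) ∈ DerHom ε 𝒜 (γ + β) := by
  refine Submodule.smul_mem _ _ ⟨fun α a ha => ?_, fun α a ha b => ?_⟩
  · have := SetLike.GradedMul.mul_mem hzβ (hX.1 α a ha)
    rwa [show β + (α + γ) = α + (γ + β) by abel] at this
  · have e := center_comm hz hzβ ha
    simp only [LinearMap.comp_apply, LinearMap.mulLeft_apply, hX.2 α a ha b, mul_add,
      mul_smul_comm]
    rw [← mul_assoc, ← mul_assoc z a, e, smul_mul_assoc, smul_smul, ε.val_add_left, mul_assoc a]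

theorem ad_mem_DerHom {γ : Γ} {x : A} (hx : x ∈ 𝒜 γ) : epsBracket ε 𝒜 x ∈ DerHom ε 𝒜 γ := by
  have hdeg : ∀ α, ∀ a ∈ 𝒜 α, epsBracket ε 𝒜 x a ∈ 𝒜 (α + γ) := fun α a ha => by
    rw [epsBracket_of_mem ε hx ha]
    refine sub_mem ?_ (Submodule.smul_mem _ _ (SetLike.GradedMul.mul_mem ha hx))
    rw [add_comm]; exact SetLike.GradedMul.mul_mem hx ha
  refine ⟨hdeg, fun α a ha b => ?_⟩
  have : (epsBracket ε 𝒜 x) ∘ₗ LinearMap.mulLeft ℂ a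
      = LinearMap.mulLeft ℂ (epsBracket ε 𝒜 x a)
        + ε.val γ α • (LinearMap.mulLeft ℂ a ∘ₗ epsBracket ε 𝒜 x) := by
    refine lin_ext 𝒜 fun β b hb => ?_
    simp only [LinearMap.comp_apply, LinearMap.mulLeft_apply, LinearMap.add_apply,
      LinearMap.smul_apply]
    rw [epsBracket_of_mem ε hx (SetLike.GradedMul.mul_mem ha hb), epsBracket_of_mem ε hx ha,
      epsBracket_of_mem ε hx hb, ε.val_add_right, mul_sub, sub_mul, smul_sub, smul_mul_assoc,
      mul_smul_comm, smul_smul]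
    simp only [mul_assoc]
    abel
  exact congrArg (fun f => f b) this

theorem ad_mem_Der (x : A) : epsBracket ε 𝒜 x ∈ Der ε 𝒜 := by
  induction x using DirectSum.Decomposition.inductionOn 𝒜 with
  | zero => simp
  | homogeneous m => exact DerHom_le_Der ε 𝒜 _ (ad_mem_DerHom m.2)
  | add a b ha hb => rw [map_add]; exact add_mem ha hb

variable (𝒜 ε)

/-- The adjoint map, with values in the space of `ε`-derivations. -/
def ad : A →ₗ[ℂ] Der ε 𝒜 := (epsBracket ε 𝒜).codRestrict (Der ε 𝒜) ad_mem_Der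

/-! ### The differential calculus based on `ε`-derivations -/

/-- The forms `Ω^{n,k}`: the `n`-linear maps on `ε`-derivations with values in the algebra which
are homogeneous of degree `k`, right linear over the `ε`-center in the last variable, and
`ε`-antisymmetric. For `n = 0` this is the homogeneous component of degree `k`. -/
def Form (n : ℕ) (k : Γ) : Submodule ℂ (MultilinearMap ℂ (fun _ : Fin n => Der ε 𝒜) A) where
  carrier := {ω |
    (∀ (d : Fin n → Γ) (X : Fin n → Der ε 𝒜), (∀ i, (X i : A →ₗ[ℂ] A) ∈ DerHom ε 𝒜 (d i)) →
      ω X ∈ 𝒜 (k + ∑ i, d i)) ∧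
    (∀ (d : Fin n → Γ) (X : Fin n → Der ε 𝒜)
      (hX : ∀ i, (X i : A →ₗ[ℂ] A) ∈ DerHom ε 𝒜 (d i)) (β : Γ) (z : A)
      (hz : z ∈ center ε 𝒜) (hzβ : z ∈ 𝒜 β) (i : Fin n), (i : ℕ) + 1 = n →
      ω (Function.update X i
        ⟨ε.val (d i) β • (LinearMap.mulLeft ℂ z ∘ₗ (X i : A →ₗ[ℂ] A)),
          DerHom_le_Der ε 𝒜 _ (centerMul_mem (hX i) hz hzβ)⟩) = ω X * z) ∧
    (∀ (d : Fin n → Γ) (X : Fin n → Der ε 𝒜), (∀ i, (X i : A →ₗ[ℂ] A) ∈ DerHom ε 𝒜 (d i)) →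
      ∀ i j : Fin n, (i : ℕ) + 1 = j →
        ω X = -(ε.val (d i) (d j) • ω (X ∘ Equiv.swap i j)))}
  add_mem' {ω η} hω hη := by
    refine ⟨fun d X hX => add_mem (hω.1 d X hX) (hη.1 d X hX),
      fun d X hX β z hz hzβ i hi => ?_, fun d X hX i j hij => ?_⟩
    · rw [add_apply, hω.2.1 d X hX β z hz hzβ i hi,
        hη.2.1 d X hX β z hz hzβ i hi, add_apply, add_mul]
    · rw [add_apply, add_apply, smul_add, neg_add,
        ← hω.2.2 d X hX i j hij, ← hη.2.2 d X hX i j hij]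
  zero_mem' := ⟨fun d X _ => zero_mem _, fun d X _ β z _ _ i _ => by simp,
    fun d X _ i j _ => by simp⟩
  smul_mem' c ω hω := by
    refine ⟨fun d X hX => Submodule.smul_mem _ c (hω.1 d X hX),
      fun d X hX β z hz hzβ i hi => ?_, fun d X hX i j hij => ?_⟩
    · rw [smul_apply, hω.2.1 d X hX β z hz hzβ i hi, smul_apply,
        smul_mul_assoc]
    · rw [smul_apply, smul_apply, smul_comm, ← smul_neg,
        ← hω.2.2 d X hX i j hij]

/-- The bigraded space of all forms; the component of index `(n, k)` is `Ω^{n,k}`. -/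
abbrev Forms : Type _ := ⨁ p : ℕ × Γ, Form ε 𝒜 p.1 p.2

/-- The product of inversions `∏_{i<j, s(i)>s(j)} ε(d(s(j)), d(s(i)))`. -/
def invFactor {n : ℕ} (d : Fin n → Γ) (s : Equiv.Perm (Fin n)) : ℂ :=
  ∏ i, ∏ j, if i < j ∧ s j < s i then ε.val (d (s j)) (d (s i)) else 1

/-- `ζ` is the product of the `p`-form `ω` and the `q`-form `η` of degree `l`. A multilinear map
is determined by its values on homogeneous `ε`-derivations, so there is at most one such `ζ`. -/
def IsFormProduct {p q : ℕ} (l : Γ) (ω : MultilinearMap ℂ (fun _ : Fin p => Der ε 𝒜) A)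
    (η : MultilinearMap ℂ (fun _ : Fin q => Der ε 𝒜) A)
    (ζ : MultilinearMap ℂ (fun _ : Fin (p + q) => Der ε 𝒜) A) : Prop :=
  ∀ (d : Fin (p + q) → Γ) (X : Fin (p + q) → Der ε 𝒜),
    (∀ i, (X i : A →ₗ[ℂ] A) ∈ DerHom ε 𝒜 (d i)) →
    ζ X = (1 / ((p.factorial : ℂ) * (q.factorial : ℂ))) •
      ∑ s : Equiv.Perm (Fin (p + q)),
        (((Equiv.Perm.sign s : ℤ) : ℂ) * invFactor ε d s *
            ∏ i : Fin p, ε.val l (d (s (Fin.castAdd q i)))) •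
          (ω (fun i => X (s (Fin.castAdd q i))) * η (fun j => X (s (Fin.natAdd p j))))

/-- The argument list `(b, X_0, …, X_p)` with `X_m` and `X_n` omitted, where `m < n`. -/
def omitTwo {V : Type*} {p : ℕ} (m n : Fin (p + 1)) (b : V) (X : Fin (p + 1) → V) : Fin p → V :=
  fun i => if (i : ℕ) = 0 then b
    else if (i : ℕ) ≤ m then X ⟨(i : ℕ) - 1, by omega⟩
    else if (i : ℕ) < n then X i.castSucc
    else X i.succ

/-- The value of the differential of the `p`-form `ω` of degree `k` at arguments
`X_0, …, X_p` of degrees `d_0, …, d_p`; `act` is the action of the arguments on the algebra and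
`br m n` is the bracket `[X_m, X_n]`. -/
def diffVal {V : Type*} [AddCommGroup V] [Module ℂ V] {p : ℕ} (k : Γ) (act : V → A → A)
    (ω : MultilinearMap ℂ (fun _ : Fin p => V) A) (d : Fin (p + 1) → Γ) (X : Fin (p + 1) → V)
    (br : Fin (p + 1) → Fin (p + 1) → V) : A :=
  (∑ m : Fin (p + 1),
    ((-1 : ℂ) ^ (m : ℕ) * (ε.val k (d m) * ∏ a, if a < m then ε.val (d a) (d m) else 1)) •
      act (X m) (ω fun i => X (m.succAbove i))) +
  ∑ m : Fin (p + 1), ∑ n : Fin (p + 1), if m < n then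
    ((-1 : ℂ) ^ ((m : ℕ) + (n : ℕ)) * (ε.val (d n) (d m) *
        (∏ a, if a < m then ε.val (d a) (d m) else 1) *
        ∏ a, if a < n then ε.val (d a) (d n) else 1)) • ω (omitTwo m n (br m n) X)
    else 0

/-- `ζ` is the differential of the `p`-form `ω` of degree `k`. -/
def IsFormDiff {p : ℕ} (k : Γ) (ω : MultilinearMap ℂ (fun _ : Fin p => Der ε 𝒜) A)
    (ζ : MultilinearMap ℂ (fun _ : Fin (p + 1) => Der ε 𝒜) A) : Prop :=
  ∀ (d : Fin (p + 1) → Γ) (X : Fin (p + 1) → Der ε 𝒜)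
    (hX : ∀ i, (X i : A →ₗ[ℂ] A) ∈ DerHom ε 𝒜 (d i)),
    ζ X = diffVal ε k (fun (Y : Der ε 𝒜) a => (Y : A →ₗ[ℂ] A) a) ω d X fun m n =>
      ⟨(X m : A →ₗ[ℂ] A) ∘ₗ (X n : A →ₗ[ℂ] A)
          - ε.val (d m) (d n) • ((X n : A →ₗ[ℂ] A) ∘ₗ (X m : A →ₗ[ℂ] A)),
        DerHom_le_Der ε 𝒜 _ (derBracket_mem (hX m) (hX n))⟩

/-- The `ε`-connections on the algebra, as a right module over itself: the linear maps `∇` of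
degree `0` from the algebra to the one-forms with `∇(a b) = ∇(a) b + a db`; for homogeneous `b`
and `X`, `(∇(a) b)(X) = ε(|b|, |X|) ∇(a)(X) b` and `(a db)(X) = ε(|b|, |X|) a X(b)`. -/
def Connections : Set (A →ₗ[ℂ] MultilinearMap ℂ (fun _ : Fin 1 => Der ε 𝒜) A) :=
  {D | (∀ k, ∀ a ∈ 𝒜 k, D a ∈ Form ε 𝒜 1 k) ∧
    ∀ (a : A) (β : Γ), ∀ b ∈ 𝒜 β, ∀ (γ : Γ) (X : Fin 1 → Der ε 𝒜),
      (X 0 : A →ₗ[ℂ] A) ∈ DerHom ε 𝒜 γ →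
      D (a * b) X = ε.val β γ • (D a X * b) + ε.val β γ • (a * (X 0 : A →ₗ[ℂ] A) b)}

/-! ### The complement of the `ε`-center of a fine graded algebra -/

/-- The support of the grading. -/
def Supp (𝒜 : Γ → Submodule ℂ A) : Set Γ := {α | 𝒜 α ≠ ⊥}

/-- A chosen family of homogeneous elements, with `e_α` nonzero for `α` in the support. For a fine
grading this is a homogeneous basis (indexed by the support). -/
def homBasis (𝒜 : Γ → Submodule ℂ A) (α : Γ) : A :=
  open Classical in if h : ∃ a ∈ 𝒜 α, a ≠ 0 then h.choose else 0

/-- The factor set of a fine grading: `e_α e_β = σ(α, β) e_{α+β}`. -/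
def factorSet (𝒜 : Γ → Submodule ℂ A) (α β : Γ) : ℂ :=
  open Classical in
  if h : ∃ c : ℂ, homBasis 𝒜 α * homBasis 𝒜 β = c • homBasis 𝒜 (α + β) then h.choose else 0

/-- The commutation factor `ε_σ(α, β) = σ(α, β) σ(β, α)⁻¹` of a fine grading, on its support. -/
def epsSigma (𝒜 : Γ → Submodule ℂ A) (α β : Γ) : ℂ := factorSet 𝒜 α β * (factorSet 𝒜 β α)⁻¹

/-- The degrees in the support at which `ε` and `ε_σ` agree. -/
def agree : Set Γ := {α | α ∈ Supp 𝒜 ∧ ∀ β ∈ Supp 𝒜, ε.val α β = epsSigma 𝒜 α β}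

/-- The sum of the homogeneous components whose degree is not in `agree`. -/
def complI : Submodule ℂ A := ⨆ α ∈ (agree ε 𝒜)ᶜ, 𝒜 α

/-- The restriction of the adjoint map to `complI`. -/
def adI : complI ε 𝒜 →ₗ[ℂ] Der ε 𝒜 := ad ε 𝒜 ∘ₗ (complI ε 𝒜).subtype

/-- The homogeneous elements of degree `γ` of the dual of `complI` over the `ε`-center: the
right-linear maps of degree `γ` with values in the `ε`-center. -/
def DualHom (γ : Γ) : Submodule ℂ (complI ε 𝒜 →ₗ[ℂ] A) where
  carrier := {θ | (∀ x, θ x ∈ center ε 𝒜) ∧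
    (∀ α, ∀ x : complI ε 𝒜, (x : A) ∈ 𝒜 α → θ x ∈ 𝒜 (α + γ)) ∧
    ∀ x : complI ε 𝒜, ∀ z ∈ center ε 𝒜, ∀ h : (x : A) * z ∈ complI ε 𝒜,
      θ ⟨(x : A) * z, h⟩ = θ x * z}
  add_mem' {θ η} hθ hη := ⟨fun x => add_mem (hθ.1 x) (hη.1 x),
    fun α x hx => add_mem (hθ.2.1 α x hx) (hη.2.1 α x hx), fun x z hz h => by
      rw [LinearMap.add_apply, hθ.2.2 x z hz h, hη.2.2 x z hz h, LinearMap.add_apply, add_mul]⟩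
  zero_mem' := ⟨fun x => zero_mem _, fun α x _ => zero_mem _, fun x z _ _ => by simp⟩
  smul_mem' c θ hθ := ⟨fun x => Subalgebra.smul_mem _ (hθ.1 x) c,
    fun α x hx => Submodule.smul_mem _ c (hθ.2.1 α x hx), fun x z hz h => by
      rw [LinearMap.smul_apply, hθ.2.2 x z hz h, LinearMap.smul_apply, smul_mul_assoc]⟩

/-- The graded dual of `complI` over the `ε`-center. -/
def Dual : Submodule ℂ (complI ε 𝒜 →ₗ[ℂ] A) := ⨆ γ, DualHom ε 𝒜 γ

theorem DualHom_le_Dual (γ : Γ) : DualHom ε 𝒜 γ ≤ Dual ε 𝒜 := le_iSup (DualHom ε 𝒜) γ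

variable {ε 𝒜} in
/-- The left action `(z θ)(x) = z θ(x)` of the `ε`-center on the dual. -/
theorem dualSmul_mem {β γ : Γ} {θ : complI ε 𝒜 →ₗ[ℂ] A} (hθ : θ ∈ DualHom ε 𝒜 γ) {z : A}
    (hz : z ∈ center ε 𝒜) (hzβ : z ∈ 𝒜 β) :
    LinearMap.mulLeft ℂ z ∘ₗ θ ∈ DualHom ε 𝒜 (β + γ) := by
  refine ⟨fun x => mul_mem hz (hθ.1 x), fun α x hx => ?_, fun x w hw h => ?_⟩
  · have := SetLike.GradedMul.mul_mem hzβ (hθ.2.1 α x hx)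
    rwa [show β + (α + γ) = α + (β + γ) by abel] at this
  · simp only [LinearMap.comp_apply, LinearMap.mulLeft_apply, hθ.2.2 x w hw h, mul_assoc]

/-! ### The `ε`-exterior algebra over the `ε`-center -/

variable {ε 𝒜} in
theorem mem_complI {α : Γ} (hα : α ∈ (agree ε 𝒜)ᶜ) {x : A} (hx : x ∈ 𝒜 α) :
    x ∈ complI ε 𝒜 := Submodule.mem_iSup_of_mem α (Submodule.mem_iSup_of_mem hα hx)

theorem complI_ext {N : Type*} [AddCommGroup N] [Module ℂ N] {f g : complI ε 𝒜 →ₗ[ℂ] N}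
    (h : ∀ α, ∀ x : complI ε 𝒜, (x : A) ∈ 𝒜 α → f x = g x) : f = g := by
  have : complI ε 𝒜 ≤ (LinearMap.eqLocus f g).map (complI ε 𝒜).subtype :=
    iSup₂_le fun α hα x hx => ⟨⟨x, mem_complI hα hx⟩, h α _ hx, rfl⟩
  ext x
  obtain ⟨y, hy, hyx⟩ := this x.2
  rw [← Subtype.ext hyx]
  exact hy

theorem twistLin_mem_complI (γ : Γ) : ∀ x ∈ complI ε 𝒜, twistLin ε 𝒜 γ x ∈ complI ε 𝒜 := by
  change complI ε 𝒜 ≤ (complI ε 𝒜).comap (twistLin ε 𝒜 γ)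
  refine iSup₂_le fun α hα x hx => ?_
  rw [Submodule.mem_comap, twistLin_of_mem ε hx]
  exact Submodule.smul_mem _ _ (mem_complI hα hx)

/-- Conjugation of linear maps by `twist`. -/
def twistMaps (γ : Γ) : (complI ε 𝒜 →ₗ[ℂ] A) →ₗ[ℂ] (complI ε 𝒜 →ₗ[ℂ] A) :=
  LinearMap.lcomp ℂ A ((twistLin ε 𝒜 (-γ)).restrict (twistLin_mem_complI ε 𝒜 (-γ))) ∘ₗ
    (twistLin ε 𝒜 γ).compRight ℂ

variable {ε 𝒜} in
theorem twistMaps_of_mem {δ : Γ} {θ : complI ε 𝒜 →ₗ[ℂ] A} (hθ : θ ∈ DualHom ε 𝒜 δ) (γ : Γ) :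
    twistMaps ε 𝒜 γ θ = ε.val δ γ • θ := by
  refine complI_ext ε 𝒜 fun α x hx => ?_
  have e : (twistLin ε 𝒜 (-γ)).restrict (twistLin_mem_complI ε 𝒜 (-γ)) x
      = ε.val α (-γ) • x := Subtype.ext (twistLin_of_mem ε hx (-γ))
  change twistLin ε 𝒜 γ (θ ((twistLin ε 𝒜 (-γ)).restrict _ x)) = ε.val δ γ • θ x
  rw [e, map_smul, map_smul, twistLin_of_mem ε (hθ.2.1 α x hx), smul_smul, ε.val_add_left]
  congr 1
  linear_combination ε.val δ γ * ε.val_neg_right α γ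

theorem twistMaps_mem_Dual (γ : Γ) : ∀ θ ∈ Dual ε 𝒜, twistMaps ε 𝒜 γ θ ∈ Dual ε 𝒜 := by
  change Dual ε 𝒜 ≤ (Dual ε 𝒜).comap (twistMaps ε 𝒜 γ)
  refine iSup_le fun δ θ hθ => ?_
  rw [Submodule.mem_comap, twistMaps_of_mem hθ]
  exact Submodule.smul_mem _ _ (DualHom_le_Dual ε 𝒜 δ hθ)

/-- The linear map which multiplies the homogeneous elements of degree `δ` of the dual by
`ε(δ, γ)`. -/
def twistDual (γ : Γ) : Dual ε 𝒜 →ₗ[ℂ] Dual ε 𝒜 :=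
  (twistMaps ε 𝒜 γ).restrict (twistMaps_mem_Dual ε 𝒜 γ)

variable {ε 𝒜} in
theorem twistDual_of_mem {δ : Γ} {θ : Dual ε 𝒜} (hθ : (θ : complI ε 𝒜 →ₗ[ℂ] A) ∈ DualHom ε 𝒜 δ)
    (γ : Γ) : twistDual ε 𝒜 γ θ = ε.val δ γ • θ := Subtype.ext (twistMaps_of_mem hθ γ)

theorem twistLin_mem_center (γ : Γ) : ∀ z ∈ center ε 𝒜, twistLin ε 𝒜 γ z ∈ center ε 𝒜 := by
  intro z hz
  refine (bracket_eq_zero_iff ε 𝒜 _).2 fun β b hb => ?_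
  have h := congrArg (twist ε 𝒜 γ) ((bracket_eq_zero_iff ε 𝒜 z).1 hz β b hb)
  rw [map_mul, map_mul, twist_of_mem ε hb, mul_smul_comm, smul_mul_assoc] at h
  have h' := smul_right_injective A (ε.val_ne_zero β γ) h
  change twist ε 𝒜 γ z * b = b * twistLin ε 𝒜 β (twistLin ε 𝒜 γ z)
  rw [h']
  have : twistLin ε 𝒜 γ ∘ₗ twistLin ε 𝒜 β = twistLin ε 𝒜 β ∘ₗ twistLin ε 𝒜 γ :=
    lin_ext 𝒜 fun α a ha => by
      simp only [LinearMap.comp_apply, twistLin_of_mem ε ha, map_smul, smul_comm (ε.val α β)]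
  exact congrArg (b * ·) (congrArg (fun f => f z) this)

/-- The restriction of `twist` to the `ε`-center. -/
def twistCenter (γ : Γ) : center ε 𝒜 →ₗ[ℂ] center ε 𝒜 :=
  (twistLin ε 𝒜 γ).restrict (p := Subalgebra.toSubmodule (center ε 𝒜))
    (q := Subalgebra.toSubmodule (center ε 𝒜)) (twistLin_mem_center ε 𝒜 γ)

/-- The inclusion of the `ε`-center in the free algebra on the `ε`-center and the dual. -/
abbrev freeZ (z : center ε 𝒜) : TensorAlgebra ℂ (center ε 𝒜 × Dual ε 𝒜) :=
  TensorAlgebra.ι ℂ (z, 0)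

/-- The inclusion of the dual in the free algebra on the `ε`-center and the dual. -/
abbrev freeD (θ : Dual ε 𝒜) : TensorAlgebra ℂ (center ε 𝒜 × Dual ε 𝒜) :=
  TensorAlgebra.ι ℂ (0, θ)

/-- The defining relations of the `ε`-exterior algebra over the `ε`-center. The first four
present the tensor algebra of the dual, as a bimodule over the `ε`-center with
`θ z = ε(|θ|, |z|) z θ`; the last one is `ε`-anticommutativity. -/
inductive ExtRel : TensorAlgebra ℂ (center ε 𝒜 × Dual ε 𝒜) →
    TensorAlgebra ℂ (center ε 𝒜 × Dual ε 𝒜) → Prop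
  | one : ExtRel (freeZ ε 𝒜 1) 1
  | mul (z w : center ε 𝒜) : ExtRel (freeZ ε 𝒜 z * freeZ ε 𝒜 w) (freeZ ε 𝒜 (z * w))
  | left {β γ : Γ} (z : center ε 𝒜) (hz : (z : A) ∈ 𝒜 β) (θ : Dual ε 𝒜)
      (hθ : (θ : complI ε 𝒜 →ₗ[ℂ] A) ∈ DualHom ε 𝒜 γ) :
      ExtRel (freeZ ε 𝒜 z * freeD ε 𝒜 θ) (freeD ε 𝒜
        ⟨LinearMap.mulLeft ℂ (z : A) ∘ₗ (θ : complI ε 𝒜 →ₗ[ℂ] A),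
          DualHom_le_Dual ε 𝒜 _ (dualSmul_mem hθ z.2 hz)⟩)
  | right {β γ : Γ} (z : center ε 𝒜) (hz : (z : A) ∈ 𝒜 β) (θ : Dual ε 𝒜)
      (hθ : (θ : complI ε 𝒜 →ₗ[ℂ] A) ∈ DualHom ε 𝒜 γ) :
      ExtRel (freeD ε 𝒜 θ * freeZ ε 𝒜 z) (ε.val γ β • freeD ε 𝒜
        ⟨LinearMap.mulLeft ℂ (z : A) ∘ₗ (θ : complI ε 𝒜 →ₗ[ℂ] A),
          DualHom_le_Dual ε 𝒜 _ (dualSmul_mem hθ z.2 hz)⟩)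
  | anticomm {γ δ : Γ} (θ η : Dual ε 𝒜)
      (hθ : (θ : complI ε 𝒜 →ₗ[ℂ] A) ∈ DualHom ε 𝒜 γ)
      (hη : (η : complI ε 𝒜 →ₗ[ℂ] A) ∈ DualHom ε 𝒜 δ) :
      ExtRel (freeD ε 𝒜 θ * freeD ε 𝒜 η + ε.val γ δ • (freeD ε 𝒜 η * freeD ε 𝒜 θ)) 0

/-- The `ε`-exterior algebra, over the `ε`-center, of the dual of `complI`. -/
abbrev ExtAlg : Type _ := RingQuot (ExtRel ε 𝒜)

/-- The structure map of the `ε`-exterior algebra on the `ε`-center. -/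
def extZ : center ε 𝒜 →ₗ[ℂ] ExtAlg ε 𝒜 :=
  (RingQuot.mkAlgHom ℂ (ExtRel ε 𝒜)).toLinearMap ∘ₗ TensorAlgebra.ι ℂ ∘ₗ LinearMap.inl ℂ _ _

/-- The generators of the `ε`-exterior algebra. -/
def extD : Dual ε 𝒜 →ₗ[ℂ] ExtAlg ε 𝒜 :=
  (RingQuot.mkAlgHom ℂ (ExtRel ε 𝒜)).toLinearMap ∘ₗ TensorAlgebra.ι ℂ ∘ₗ LinearMap.inr ℂ _ _

/-- The map `twist` on the generators of the free algebra, followed by the projection. -/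
def twistFree (γ : Γ) : TensorAlgebra ℂ (center ε 𝒜 × Dual ε 𝒜) →ₐ[ℂ] ExtAlg ε 𝒜 :=
  TensorAlgebra.lift ℂ ((extZ ε 𝒜 ∘ₗ twistCenter ε 𝒜 γ).coprod (extD ε 𝒜 ∘ₗ twistDual ε 𝒜 γ))

variable {ε 𝒜} in
theorem mk_rel {x y : TensorAlgebra ℂ (center ε 𝒜 × Dual ε 𝒜)} (h : ExtRel ε 𝒜 x y) :
    RingQuot.mkAlgHom ℂ (ExtRel ε 𝒜) x = RingQuot.mkAlgHom ℂ (ExtRel ε 𝒜) y :=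
  RingQuot.mkAlgHom_rel ℂ h

theorem twistFree_Z (γ : Γ) (z : center ε 𝒜) :
    twistFree ε 𝒜 γ (freeZ ε 𝒜 z) = extZ ε 𝒜 (twistCenter ε 𝒜 γ z) := by
  simp [twistFree, freeZ]

theorem twistFree_D (γ : Γ) (θ : Dual ε 𝒜) :
    twistFree ε 𝒜 γ (freeD ε 𝒜 θ) = extD ε 𝒜 (twistDual ε 𝒜 γ θ) := by
  simp [twistFree, freeD]

theorem mk_freeZ (z : center ε 𝒜) :
    RingQuot.mkAlgHom ℂ (ExtRel ε 𝒜) (freeZ ε 𝒜 z) = extZ ε 𝒜 z := rfl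

theorem mk_freeD (θ : Dual ε 𝒜) :
    RingQuot.mkAlgHom ℂ (ExtRel ε 𝒜) (freeD ε 𝒜 θ) = extD ε 𝒜 θ := rfl

theorem extZ_one : extZ ε 𝒜 1 = 1 := by
  have := mk_rel (ε := ε) (𝒜 := 𝒜) ExtRel.one
  rwa [map_one, mk_freeZ] at this

theorem extZ_mul (z w : center ε 𝒜) : extZ ε 𝒜 (z * w) = extZ ε 𝒜 z * extZ ε 𝒜 w := by
  have := mk_rel (ExtRel.mul z w)
  rw [map_mul, mk_freeZ, mk_freeZ, mk_freeZ] at this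
  exact this.symm

theorem extZ_extD {β γ : Γ} (z : center ε 𝒜) (hz : (z : A) ∈ 𝒜 β) (θ : Dual ε 𝒜)
    (hθ : (θ : complI ε 𝒜 →ₗ[ℂ] A) ∈ DualHom ε 𝒜 γ) :
    extZ ε 𝒜 z * extD ε 𝒜 θ = extD ε 𝒜
      ⟨LinearMap.mulLeft ℂ (z : A) ∘ₗ (θ : complI ε 𝒜 →ₗ[ℂ] A),
        DualHom_le_Dual ε 𝒜 _ (dualSmul_mem hθ z.2 hz)⟩ := by
  have := mk_rel (ExtRel.left z hz θ hθ)
  rwa [map_mul, mk_freeZ, mk_freeD, mk_freeD] at this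

theorem extD_extZ {β γ : Γ} (z : center ε 𝒜) (hz : (z : A) ∈ 𝒜 β) (θ : Dual ε 𝒜)
    (hθ : (θ : complI ε 𝒜 →ₗ[ℂ] A) ∈ DualHom ε 𝒜 γ) :
    extD ε 𝒜 θ * extZ ε 𝒜 z = ε.val γ β • extD ε 𝒜
      ⟨LinearMap.mulLeft ℂ (z : A) ∘ₗ (θ : complI ε 𝒜 →ₗ[ℂ] A),
        DualHom_le_Dual ε 𝒜 _ (dualSmul_mem hθ z.2 hz)⟩ := by
  have := mk_rel (ExtRel.right z hz θ hθ)
  rwa [map_mul, map_smul, mk_freeZ, mk_freeD, mk_freeD] at this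

theorem extD_anticomm {γ δ : Γ} (θ η : Dual ε 𝒜)
    (hθ : (θ : complI ε 𝒜 →ₗ[ℂ] A) ∈ DualHom ε 𝒜 γ)
    (hη : (η : complI ε 𝒜 →ₗ[ℂ] A) ∈ DualHom ε 𝒜 δ) :
    extD ε 𝒜 θ * extD ε 𝒜 η + ε.val γ δ • (extD ε 𝒜 η * extD ε 𝒜 θ) = 0 := by
  have := mk_rel (ExtRel.anticomm θ η hθ hη)
  rwa [map_add, map_smul, map_mul, map_mul, map_zero, mk_freeD, mk_freeD] at this

variable {ε 𝒜} in
theorem twistCenter_of_mem {β : Γ} {z : center ε 𝒜} (hz : (z : A) ∈ 𝒜 β) (γ : Γ) :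
    twistCenter ε 𝒜 γ z = ε.val β γ • z := Subtype.ext (twistLin_of_mem ε hz γ)

theorem smul_anticomm {B : Type*} [Ring B] [Algebra ℂ B] {x y : B} {a b c : ℂ}
    (h : x * y + c • (y * x) = 0) : a • x * b • y + c • (b • y * a • x) = 0 := by
  rw [smul_mul_smul_comm, smul_mul_smul_comm, smul_comm c, mul_comm b a, ← smul_add, h, smul_zero]

variable {ε 𝒜} in
theorem twistFree_rel (γ : Γ) {x y : TensorAlgebra ℂ (center ε 𝒜 × Dual ε 𝒜)}
    (h : ExtRel ε 𝒜 x y) : twistFree ε 𝒜 γ x = twistFree ε 𝒜 γ y := by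
  cases h with
  | one =>
    have : twistCenter ε 𝒜 γ 1 = 1 := Subtype.ext (twistLin_one ε 𝒜 γ)
    rw [twistFree_Z, this, map_one (twistFree ε 𝒜 γ), extZ_one]
  | mul z w =>
    have : twistCenter ε 𝒜 γ (z * w) = twistCenter ε 𝒜 γ z * twistCenter ε 𝒜 γ w :=
      Subtype.ext (twistLin_mul ε 𝒜 γ z w)
    rw [map_mul, twistFree_Z, twistFree_Z, twistFree_Z, this, extZ_mul]
  | @left β δ z hz θ hθ =>
    have e := extZ_extD ε 𝒜 z hz θ hθ
    have h3 := twistDual_of_mem (ε := ε) (𝒜 := 𝒜)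
      (θ := ⟨LinearMap.mulLeft ℂ (z : A) ∘ₗ (θ : complI ε 𝒜 →ₗ[ℂ] A),
        DualHom_le_Dual ε 𝒜 _ (dualSmul_mem hθ z.2 hz)⟩) (dualSmul_mem hθ z.2 hz) γ
    generalize (⟨_, _⟩ : Dual ε 𝒜) = ψ at e h3 ⊢
    rw [map_mul, twistFree_Z, twistFree_D, twistFree_D, h3, twistCenter_of_mem hz,
      twistDual_of_mem hθ]
    rw [map_smul, map_smul, map_smul, ε.val_add_left, ← e, smul_mul_smul_comm]
  | @right β δ z hz θ hθ =>
    have e := extD_extZ ε 𝒜 z hz θ hθ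
    have h3 := twistDual_of_mem (ε := ε) (𝒜 := 𝒜)
      (θ := ⟨LinearMap.mulLeft ℂ (z : A) ∘ₗ (θ : complI ε 𝒜 →ₗ[ℂ] A),
        DualHom_le_Dual ε 𝒜 _ (dualSmul_mem hθ z.2 hz)⟩) (dualSmul_mem hθ z.2 hz) γ
    generalize (⟨_, _⟩ : Dual ε 𝒜) = ψ at e h3 ⊢
    rw [map_mul, map_smul, twistFree_Z, twistFree_D, twistFree_D, h3, twistCenter_of_mem hz,
      twistDual_of_mem hθ]
    rw [map_smul, map_smul, map_smul, ε.val_add_left, smul_mul_smul_comm, e, smul_smul,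
      smul_smul]
    congr 1
    ring
  | anticomm θ η hθ hη =>
    have h1 := (twistFree_D ε 𝒜 γ θ).trans
      ((congrArg (extD ε 𝒜) (twistDual_of_mem hθ γ)).trans (map_smul (extD ε 𝒜) _ θ))
    have h2 := (twistFree_D ε 𝒜 γ η).trans
      ((congrArg (extD ε 𝒜) (twistDual_of_mem hη γ)).trans (map_smul (extD ε 𝒜) _ η))
    rw [map_add, map_smul, map_mul, map_mul, map_zero, h1, h2]
    exact smul_anticomm (extD_anticomm ε 𝒜 θ η hθ hη)

/-- The algebra endomorphism of the `ε`-exterior algebra which multiplies the elements of degree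
`δ` by `ε(δ, γ)`. -/
def twistExt (γ : Γ) : ExtAlg ε 𝒜 →ₐ[ℂ] ExtAlg ε 𝒜 :=
  RingQuot.liftAlgHom ℂ ⟨twistFree ε 𝒜 γ, fun _ _ h => twistFree_rel γ h⟩

theorem twistExt_Z (γ : Γ) (z : center ε 𝒜) :
    twistExt ε 𝒜 γ (extZ ε 𝒜 z) = extZ ε 𝒜 (twistCenter ε 𝒜 γ z) := by
  rw [← twistFree_Z]
  exact RingQuot.liftAlgHom_mkAlgHom_apply ℂ _ _ _

theorem twistExt_D (γ : Γ) (θ : Dual ε 𝒜) :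
    twistExt ε 𝒜 γ (extD ε 𝒜 θ) = extD ε 𝒜 (twistDual ε 𝒜 γ θ) := by
  rw [← twistFree_D]
  exact RingQuot.liftAlgHom_mkAlgHom_apply ℂ _ _ _

/-- Algebra maps out of the `ε`-exterior algebra are determined on generators. -/
theorem ext_hom {B : Type*} [Ring B] [Algebra ℂ B] {f g : ExtAlg ε 𝒜 →ₐ[ℂ] B}
    (hZ : ∀ z, f (extZ ε 𝒜 z) = g (extZ ε 𝒜 z)) (hD : ∀ θ, f (extD ε 𝒜 θ) = g (extD ε 𝒜 θ)) :
    f = g := by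
  apply RingQuot.ringQuot_ext'
  apply TensorAlgebra.hom_ext
  apply LinearMap.prod_ext
  · ext z; exact hZ z
  · ext θ; exact hD θ

theorem twistExt_zero : twistExt ε 𝒜 0 = AlgHom.id ℂ _ := by
  have h1 : twistCenter ε 𝒜 0 = LinearMap.id := by
    have : twistLin ε 𝒜 0 = LinearMap.id := lin_ext 𝒜 fun α a ha => by
      rw [twistLin_of_mem ε ha, ε.val_zero_right, one_smul, LinearMap.id_apply]
    ext z; exact congrArg (fun f => f (z : A)) this
  have h2 : ∀ θ, twistDual ε 𝒜 0 θ = θ := by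
    have : Dual ε 𝒜 ≤ LinearMap.eqLocus (twistMaps ε 𝒜 0) LinearMap.id :=
      iSup_le fun δ θ hθ => by
        rw [LinearMap.mem_eqLocus, twistMaps_of_mem hθ, ε.val_zero_right, one_smul,
          LinearMap.id_apply]
    exact fun θ => Subtype.ext (this θ.2)
  refine ext_hom ε 𝒜 (fun z => ?_) fun θ => ?_
  · rw [twistExt_Z, h1]; rfl
  · rw [twistExt_D, h2]; rfl

theorem twistExt_add (γ δ : Γ) :
    twistExt ε 𝒜 (γ + δ) = (twistExt ε 𝒜 δ).comp (twistExt ε 𝒜 γ) := by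
  have h1 : ∀ z, twistCenter ε 𝒜 (γ + δ) z = twistCenter ε 𝒜 δ (twistCenter ε 𝒜 γ z) := by
    have : twistLin ε 𝒜 (γ + δ) = twistLin ε 𝒜 δ ∘ₗ twistLin ε 𝒜 γ := lin_ext 𝒜 fun α a ha => by
      rw [LinearMap.comp_apply, twistLin_of_mem ε ha, twistLin_of_mem ε ha, map_smul,
        twistLin_of_mem ε ha, ε.val_add_right, smul_smul]
    intro z; exact Subtype.ext (congrArg (fun f => f (z : A)) this)
  have h2 : ∀ θ, twistDual ε 𝒜 (γ + δ) θ = twistDual ε 𝒜 δ (twistDual ε 𝒜 γ θ) := by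
    have : Dual ε 𝒜 ≤ LinearMap.eqLocus (twistMaps ε 𝒜 (γ + δ))
        (twistMaps ε 𝒜 δ ∘ₗ twistMaps ε 𝒜 γ) :=
      iSup_le fun α θ hθ => by
        rw [LinearMap.mem_eqLocus, LinearMap.comp_apply, twistMaps_of_mem hθ, twistMaps_of_mem hθ,
          map_smul, twistMaps_of_mem hθ, ε.val_add_right, smul_smul]
    exact fun θ => Subtype.ext (this θ.2)
  refine ext_hom ε 𝒜 (fun z => ?_) fun θ => ?_
  · rw [AlgHom.comp_apply, twistExt_Z, twistExt_Z, twistExt_Z, h1]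
  · rw [AlgHom.comp_apply, twistExt_D, twistExt_D, twistExt_D, h2]

/-! ### The `ε`-graded tensor product -/

section Skew

variable {B : Type*} [Ring B] [Algebra ℂ B] (τ : Γ → B →ₐ[ℂ] B)

/-- The map `c, l ↦ c ⊗ τ_{|c|}(l)` (for homogeneous `c`). -/
def exchange : A →ₗ[ℂ] B →ₗ[ℂ] A ⊗[ℂ] B :=
  (DirectSum.toModule ℂ Γ (B →ₗ[ℂ] A ⊗[ℂ] B) fun γ =>
      (LinearMap.lcomp ℂ (A ⊗[ℂ] B) (τ γ).toLinearMap) ∘ₗ (TensorProduct.mk ℂ A B) ∘ₗ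
        (𝒜 γ).subtype) ∘ₗ
    (DirectSum.decomposeLinearEquiv 𝒜).toLinearMap

variable {𝒜} in
theorem exchange_of_mem {γ : Γ} {c : A} (hc : c ∈ 𝒜 γ) (l : B) :
    exchange 𝒜 τ c l = c ⊗ₜ[ℂ] τ γ l := by
  rw [exchange, LinearMap.comp_apply, LinearEquiv.coe_coe, DirectSum.decomposeLinearEquiv_apply,
    DirectSum.decompose_of_mem 𝒜 hc, ← DirectSum.lof_eq_of ℂ, DirectSum.toModule_lof]
  rfl

/-- For fixed `a` and `l`, the map `c ⊗ m ↦ a c ⊗ τ_{|c|}(l) m`. The products on the right-hand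
side below are those of the ordinary tensor product of algebras. -/
def skewMulLeft (a : A) (l : B) : A ⊗[ℂ] B →ₗ[ℂ] A ⊗[ℂ] B :=
  TensorProduct.lift (LinearMap.mk₂ ℂ
    (fun c m => (a ⊗ₜ[ℂ] (1 : B)) * exchange 𝒜 τ c l * ((1 : A) ⊗ₜ[ℂ] m))
    (fun c c' m => by simp [mul_add, add_mul])
    (fun r c m => by simp)
    (fun c m m' => by simp [TensorProduct.tmul_add, mul_add])
    (fun r c m => by simp))

variable {𝒜} in
theorem skewMulLeft_of_mem {γ : Γ} {c : A} (hc : c ∈ 𝒜 γ) (a : A) (l m : B) :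
    skewMulLeft 𝒜 τ a l (c ⊗ₜ m) = (a * c) ⊗ₜ[ℂ] (τ γ l * m) := by
  simp [skewMulLeft, exchange_of_mem τ hc]

/-- Linear maps on the tensor product which agree on `c ⊗ m` with `c` homogeneous are equal. -/
theorem tensor_ext {N : Type*} [AddCommGroup N] [Module ℂ N] {f g : A ⊗[ℂ] B →ₗ[ℂ] N}
    (h : ∀ γ, ∀ c ∈ 𝒜 γ, ∀ m, f (c ⊗ₜ m) = g (c ⊗ₜ m)) : f = g := by
  apply TensorProduct.ext
  refine lin_ext 𝒜 fun γ c hc => ?_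
  ext m
  exact h γ c hc m

/-- The multiplication `(a ⊗ l) (c ⊗ m) = a c ⊗ τ_{|c|}(l) m`. -/
def skewMul : A ⊗[ℂ] B →ₗ[ℂ] A ⊗[ℂ] B →ₗ[ℂ] A ⊗[ℂ] B :=
  TensorProduct.lift (LinearMap.mk₂ ℂ (skewMulLeft 𝒜 τ)
    (fun a a' l => tensor_ext 𝒜 fun γ c hc m => by
      simp [skewMulLeft_of_mem τ hc, add_mul, TensorProduct.add_tmul])
    (fun r a l => tensor_ext 𝒜 fun γ c hc m => by
      simp [skewMulLeft_of_mem τ hc, TensorProduct.smul_tmul'])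
    (fun a l l' => tensor_ext 𝒜 fun γ c hc m => by
      simp [skewMulLeft_of_mem τ hc, add_mul, TensorProduct.tmul_add])
    (fun r a l => tensor_ext 𝒜 fun γ c hc m => by
      simp [skewMulLeft_of_mem τ hc]))

variable {𝒜} in
theorem skewMul_of_mem {γ : Γ} {c : A} (hc : c ∈ 𝒜 γ) (a : A) (l m : B) :
    skewMul 𝒜 τ (a ⊗ₜ l) (c ⊗ₜ m) = (a * c) ⊗ₜ[ℂ] (τ γ l * m) := by
  rw [← skewMulLeft_of_mem τ hc]; rfl

theorem skewMul_assoc (hτ : ∀ γ δ, τ (γ + δ) = (τ δ).comp (τ γ)) (x y z : A ⊗[ℂ] B) :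
    skewMul 𝒜 τ (skewMul 𝒜 τ x y) z = skewMul 𝒜 τ x (skewMul 𝒜 τ y z) := by
  have : (skewMul 𝒜 τ).compr₂ (skewMul 𝒜 τ)
      = ((LinearMap.llcomp ℂ _ _ _).flip (skewMul 𝒜 τ)) ∘ₗ
        (LinearMap.llcomp ℂ _ _ _) ∘ₗ (skewMul 𝒜 τ) := by
    refine tensor_ext 𝒜 fun α a ha l => tensor_ext 𝒜 fun β b hb m => tensor_ext 𝒜
      fun γ c hc n => ?_
    change skewMul 𝒜 τ (skewMul 𝒜 τ (a ⊗ₜ l) (b ⊗ₜ m)) (c ⊗ₜ n)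
      = skewMul 𝒜 τ (a ⊗ₜ l) (skewMul 𝒜 τ (b ⊗ₜ m) (c ⊗ₜ n))
    rw [skewMul_of_mem τ hb, skewMul_of_mem τ hc, skewMul_of_mem τ hc,
      skewMul_of_mem τ (SetLike.GradedMul.mul_mem hb hc), hτ, map_mul, mul_assoc, mul_assoc,
      AlgHom.comp_apply]
  exact congrArg (fun f => f x y z) this

theorem skewMul_one (x : A ⊗[ℂ] B) (hτ : τ 0 = AlgHom.id ℂ B) :
    skewMul 𝒜 τ x ((1 : A) ⊗ₜ (1 : B)) = x := by
  have : (skewMul 𝒜 τ).flip ((1 : A) ⊗ₜ (1 : B)) = LinearMap.id :=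
    tensor_ext 𝒜 fun γ c _ m => by
      rw [LinearMap.flip_apply, skewMul_of_mem τ (SetLike.GradedOne.one_mem (A := 𝒜)), hτ,
        mul_one, mul_one]; rfl
  exact congrArg (fun f => f x) this

theorem one_skewMul (x : A ⊗[ℂ] B) : skewMul 𝒜 τ ((1 : A) ⊗ₜ (1 : B)) x = x := by
  have : skewMul 𝒜 τ ((1 : A) ⊗ₜ (1 : B)) = LinearMap.id :=
    tensor_ext 𝒜 fun γ c hc m => by
      rw [skewMul_of_mem τ hc, map_one, one_mul, one_mul]; rfl
  exact congrArg (fun f => f x) this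

end Skew

/-- The `ε`-graded tensor product, over the complex numbers, of the algebra with the
`ε`-exterior algebra: the product is `(a ⊗ l) (c ⊗ m) = ε(|l|, |c|) a c ⊗ l m`. -/
def SkewTensor : Type _ := A ⊗[ℂ] ExtAlg ε 𝒜

instance : AddCommGroup (SkewTensor ε 𝒜) := inferInstanceAs (AddCommGroup (A ⊗[ℂ] ExtAlg ε 𝒜))

instance : Module ℂ (SkewTensor ε 𝒜) := inferInstanceAs (Module ℂ (A ⊗[ℂ] ExtAlg ε 𝒜))

/-- The pure tensors. -/
def stMk (a : A) (l : ExtAlg ε 𝒜) : SkewTensor ε 𝒜 := a ⊗ₜ[ℂ] l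

instance : Ring (SkewTensor ε 𝒜) :=
  { (inferInstance : AddCommGroup (SkewTensor ε 𝒜)) with
    mul := fun x y => skewMul 𝒜 (twistExt ε 𝒜) x y
    one := stMk ε 𝒜 1 1
    left_distrib := fun x y z => map_add (skewMul 𝒜 (twistExt ε 𝒜) x) y z
    right_distrib := fun x y z => LinearMap.map_add₂ (skewMul 𝒜 (twistExt ε 𝒜)) x y z
    zero_mul := fun x => LinearMap.map_zero₂ (skewMul 𝒜 (twistExt ε 𝒜)) x
    mul_zero := fun x => map_zero (skewMul 𝒜 (twistExt ε 𝒜) x)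
    mul_assoc := skewMul_assoc 𝒜 _ (twistExt_add ε 𝒜)
    one_mul := one_skewMul 𝒜 _
    mul_one := fun x => skewMul_one 𝒜 _ x (twistExt_zero ε 𝒜) }

instance : Algebra ℂ (SkewTensor ε 𝒜) :=
  Algebra.ofModule (fun r x y => LinearMap.map_smul₂ (skewMul 𝒜 (twistExt ε 𝒜)) r x y)
    (fun r x y => map_smul (skewMul 𝒜 (twistExt ε 𝒜) x) r y)

/-- The relations `a z ⊗ l = a ⊗ z l` for `z` in the `ε`-center. -/
inductive BalRel : SkewTensor ε 𝒜 → SkewTensor ε 𝒜 → Prop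
  | bal (a : A) (z : center ε 𝒜) (l : ExtAlg ε 𝒜) :
      BalRel (stMk ε 𝒜 (a * z) l) (stMk ε 𝒜 a (extZ ε 𝒜 z * l))

/-- The algebra `A ⊗_Z Λ_{ε,Z}(I^*)`: the `ε`-graded tensor product over the `ε`-center of the
algebra with the `ε`-exterior algebra of the dual of `complI`. (By `ε`-commutativity, the span of
the elements `a z ⊗ l - a ⊗ z l` is already a two-sided ideal.) -/
abbrev Omega : Type _ := RingQuot (BalRel ε 𝒜)

/-- The pure tensor `a ⊗ l`. -/
def tmulZ (a : A) (l : ExtAlg ε 𝒜) : Omega ε 𝒜 :=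
  RingQuot.mkAlgHom ℂ (BalRel ε 𝒜) (stMk ε 𝒜 a l)

/-- The element `a ⊗ θ_1 ∧ … ∧ θ_n`. -/
def monomial {n : ℕ} (a : A) (θ : Fin n → Dual ε 𝒜) : Omega ε 𝒜 :=
  tmulZ ε 𝒜 a (List.ofFn fun i => extD ε 𝒜 (θ i)).prod

/-- The homogeneous component of bidegree `(n, k)`, spanned by the elements `a ⊗ θ_1 ∧ … ∧ θ_n`
with homogeneous `a` and `θ_i` of total degree `k`. -/
def OmegaHom (n : ℕ) (k : Γ) : Submodule ℂ (Omega ε 𝒜) :=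
  Submodule.span ℂ {u | ∃ (α : Γ) (a : A) (g : Fin n → Γ) (θ : Fin n → Dual ε 𝒜),
    a ∈ 𝒜 α ∧ (∀ i, (θ i : complI ε 𝒜 →ₗ[ℂ] A) ∈ DualHom ε 𝒜 (g i)) ∧ α + ∑ i, g i = k ∧
      u = monomial ε 𝒜 a θ}

/-! ### The adjoint push-forward -/

/-- `ev n u` is the multilinear map on `complI` defined by the part of `u` of exterior degree `n`:
on homogeneous elements, `(a ⊗ θ_1 ∧ … ∧ θ_n)(x_1, …, x_n)` is
`a ∑_s sign(s) ∏_{i<j, s(i)>s(j)} ε(|x_{s(j)}|, |x_{s(i)}|) ∏_{i<j} ε(|θ_j|, |x_{s(i)}|)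
θ_1(x_{s(1)}) ⋯ θ_n(x_{s(n)})`. -/
structure IsEvaluation
    (ev : ∀ n : ℕ, Omega ε 𝒜 →ₗ[ℂ] MultilinearMap ℂ (fun _ : Fin n => complI ε 𝒜) A) : Prop where
  same : ∀ (n : ℕ) (a : A) (g : Fin n → Γ) (θ : Fin n → Dual ε 𝒜),
    (∀ i, (θ i : complI ε 𝒜 →ₗ[ℂ] A) ∈ DualHom ε 𝒜 (g i)) →
    ∀ (d : Fin n → Γ) (x : Fin n → complI ε 𝒜), (∀ i, (x i : A) ∈ 𝒜 (d i)) →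
      ev n (monomial ε 𝒜 a θ) x =
        a * ∑ s : Equiv.Perm (Fin n),
          (((Equiv.Perm.sign s : ℤ) : ℂ) * invFactor ε d s *
              ∏ i, ∏ j, if i < j then ε.val (g j) (d (s i)) else 1) •
            (List.ofFn fun i => (θ i : complI ε 𝒜 →ₗ[ℂ] A) (x (s i))).prod
  other : ∀ (m n : ℕ) (a : A) (θ : Fin n → Dual ε 𝒜), m ≠ n → ev m (monomial ε 𝒜 a θ) = 0

/-- The `n`-form part of an element of the space of all forms. -/
def formPart (n : ℕ) : Forms ε 𝒜 →ₗ[ℂ] MultilinearMap ℂ (fun _ : Fin n => Der ε 𝒜) A :=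
  DirectSum.toModule ℂ (ℕ × Γ) _ fun p =>
    if h : p.1 = n then h ▸ (Form ε 𝒜 p.1 p.2).subtype else 0

/-- `φ` is the push-forward by the adjoint map:
`φ(u)(ad_{x_1}, …, ad_{x_n}) = u(x_1, …, x_n)` for all `n` and all `x_i` in `complI`. -/
def IsAdPush
    (ev : ∀ n : ℕ, Omega ε 𝒜 →ₗ[ℂ] MultilinearMap ℂ (fun _ : Fin n => complI ε 𝒜) A)
    (φ : Omega ε 𝒜 → Forms ε 𝒜) : Prop :=
  ∀ (u : Omega ε 𝒜) (n : ℕ) (x : Fin n → complI ε 𝒜),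
    formPart ε 𝒜 n (φ u) (fun i => adI ε 𝒜 (x i)) = ev n u x

/-- `D` is the differential of `A ⊗_Z Λ_{ε,Z}(I^*)` defined by the adjoint action of the elements
of `complI` on the algebra and by the bracket of `complI`, assumed to be stable by it. -/
def IsOmegaDiff
    (ev : ∀ n : ℕ, Omega ε 𝒜 →ₗ[ℂ] MultilinearMap ℂ (fun _ : Fin n => complI ε 𝒜) A)
    (hI : ∀ x ∈ complI ε 𝒜, ∀ y ∈ complI ε 𝒜, epsBracket ε 𝒜 x y ∈ complI ε 𝒜)
    (D : Omega ε 𝒜 →ₗ[ℂ] Omega ε 𝒜) : Prop :=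
  ∀ (p : ℕ) (k : Γ), ∀ u ∈ OmegaHom ε 𝒜 p k,
    D u ∈ OmegaHom ε 𝒜 (p + 1) k ∧
    ∀ (d : Fin (p + 1) → Γ) (x : Fin (p + 1) → complI ε 𝒜), (∀ i, (x i : A) ∈ 𝒜 (d i)) →
      ev (p + 1) (D u) x =
        diffVal ε k (fun (y : complI ε 𝒜) a => epsBracket ε 𝒜 y a) (ev p u) d x fun m n =>
          ⟨epsBracket ε 𝒜 (x m) (x n), hI _ (x m).2 _ (x n).2⟩

end General

end EpsGraded

end

/-! ### Universal property of T and skew derivations. -/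

noncomputable section

namespace EpsGraded

section Generators

set_option linter.unusedSectionVars false

variable {Γ : Type*} [AddCommGroup Γ] [DecidableEq Γ] {A : Type*} [Ring A] [Algebra ℂ A]
variable (ε : CommFactor Γ) (𝒜 : Γ → Submodule ℂ A) [GradedAlgebra 𝒜]

/-! ### Generators, relations and the universal property -/

/-! Since a matrix algebra is simple, a fine grading on it is a division grading: every nonzero
homogeneous element is invertible (`isFineDivision_matrix`). Everything else uses only this, the
one-dimensionality of the components and the finiteness of the support. The basis element e_α is
ε-central exactly when α lies in `agree` (`agree_iff`), so Z is the sum of the A^α over the subgroup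
`agree`, and A = Z ⊕ I. Averaging over the support shows that every ε-derivation is inner
(`exists_ad`). Hence ad restricts to a bijection from I onto the ε-derivations (`adI_bijective`),
and forms on derivations are the same as forms on I.

It remains to identify T with the ε-alternating forms on I. The universal property of T
(`omegaLift`), applied to triangular matrices, yields skew derivations with prescribed values on
generators (`exists_skewDer`). In this way one gets contractions i_x, and evaluation is iterated
contraction: u(x_1, …, x_n) = i_{x_n} ⋯ i_{x_1} u. Let θ^α be the element of degree -α of the dual
with value 1 at e_α. The Euler operator u ↦ Σ_α i_{e_α}(u) θ^α is a scalar in each exterior degree,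
nonzero in positive degree unless A is trivial (`euler_of_mem`). Therefore an element of positive
exterior degree is determined by its contractions (`contr_ext`), and a compatible family w(x) is the
family of contractions of an element (`contr_integ`). The first fact gives injectivity of
evaluation, the second surjectivity (`exists_evalOmega`). The product formula is the Leibniz rule
for i_x, read off on permutations sorted by the position of the first argument (`evalOmega_mul`).

Two connections differ by left multiplication by a one-form, namely the difference of their values
at 1, and a ↦ da is a connection. One-forms of degree zero are read off from the elements of
bidegree (1, 0).

The differential is obtained by the same calculus. Lie derivatives L_x are skew derivations, and d
is the operator with i_x d + d i_x = L_x, built degree by degree by integrating L_x u - d(i_x u)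
(`diffAux_spec`). That d² = 0 and the Leibniz rule follow by comparing contractions, by induction on
the exterior degree; the explicit formula is Cartan's formula unrolled at the first argument
(`evalOmega_diff`). Compatibility with the push-forward is the identity ad_{[x,y]} = [ad_x, ad_y].
Properness serves only to make I stable under the bracket (`bracket_mem_complI`). -/

theorem stMk_mul {γ : Γ} {c : A} (hc : c ∈ 𝒜 γ) (a : A) (l m : ExtAlg ε 𝒜) :
    stMk ε 𝒜 a l * stMk ε 𝒜 c m = stMk ε 𝒜 (a * c) (twistExt ε 𝒜 γ l * m) :=
  skewMul_of_mem (twistExt ε 𝒜) hc a l m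

/-- The inclusion of the algebra in `Omega`. -/
def omegaInc : A →ₐ[ℂ] Omega ε 𝒜 :=
  (RingQuot.mkAlgHom ℂ (BalRel ε 𝒜)).comp <| AlgHom.ofLinearMap
    ((TensorProduct.mk ℂ A (ExtAlg ε 𝒜)).flip 1 : A →ₗ[ℂ] SkewTensor ε 𝒜) rfl fun a b => by
      have : (LinearMap.mul ℂ A).compr₂
            ((TensorProduct.mk ℂ A (ExtAlg ε 𝒜)).flip 1 : A →ₗ[ℂ] SkewTensor ε 𝒜)
          = (LinearMap.mul ℂ (SkewTensor ε 𝒜)).compl₁₂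
            ((TensorProduct.mk ℂ A (ExtAlg ε 𝒜)).flip 1 : A →ₗ[ℂ] SkewTensor ε 𝒜)
            ((TensorProduct.mk ℂ A (ExtAlg ε 𝒜)).flip 1 : A →ₗ[ℂ] SkewTensor ε 𝒜) := by
        ext a : 1
        refine lin_ext 𝒜 fun β b hb => ?_
        have := stMk_mul ε 𝒜 hb a 1 1
        rw [map_one, one_mul] at this
        exact this.symm
      exact congrArg (fun f => f a b) this

/-- The inclusion of the `ε`-exterior algebra in `Omega`. -/
def omegaExt : ExtAlg ε 𝒜 →ₐ[ℂ] Omega ε 𝒜 :=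
  (RingQuot.mkAlgHom ℂ (BalRel ε 𝒜)).comp <| AlgHom.ofLinearMap
    (TensorProduct.mk ℂ A (ExtAlg ε 𝒜) 1 : ExtAlg ε 𝒜 →ₗ[ℂ] SkewTensor ε 𝒜) rfl fun l m => by
      have := stMk_mul ε 𝒜 (SetLike.GradedOne.one_mem (A := 𝒜)) 1 l m
      rw [twistExt_zero, mul_one] at this
      exact this.symm

/-- The generators of degree one of `Omega`. -/
def omegaGen : Dual ε 𝒜 →ₗ[ℂ] Omega ε 𝒜 := (omegaExt ε 𝒜).toLinearMap ∘ₗ extD ε 𝒜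

theorem tmulZ_eq (a : A) (l : ExtAlg ε 𝒜) :
    tmulZ ε 𝒜 a l = omegaInc ε 𝒜 a * omegaExt ε 𝒜 l := by
  have := stMk_mul ε 𝒜 (SetLike.GradedOne.one_mem (A := 𝒜)) a 1 l
  rw [map_one, mul_one, one_mul] at this
  rw [tmulZ, ← this, map_mul]
  rfl

theorem omegaExt_Z (z : center ε 𝒜) : omegaExt ε 𝒜 (extZ ε 𝒜 z) = omegaInc ε 𝒜 z := by
  have := RingQuot.mkAlgHom_rel ℂ (BalRel.bal (ε := ε) (𝒜 := 𝒜) 1 z 1)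
  rw [one_mul, mul_one] at this
  exact this.symm

theorem omegaExt_D (θ : Dual ε 𝒜) : omegaExt ε 𝒜 (extD ε 𝒜 θ) = omegaGen ε 𝒜 θ := rfl

variable {𝒜} in
theorem omegaExt_mul_inc {α : Γ} {a : A} (ha : a ∈ 𝒜 α) (l : ExtAlg ε 𝒜) :
    omegaExt ε 𝒜 l * omegaInc ε 𝒜 a = omegaInc ε 𝒜 a * omegaExt ε 𝒜 (twistExt ε 𝒜 α l) := by
  rw [← tmulZ_eq]
  have := stMk_mul ε 𝒜 ha 1 l 1
  rw [one_mul, mul_one] at this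
  rw [tmulZ, ← this, map_mul]
  rfl

variable {ε 𝒜}

theorem omegaGen_mul_inc {α γ : Γ} {a : A} (ha : a ∈ 𝒜 α) {θ : Dual ε 𝒜}
    (hθ : θ.1 ∈ DualHom ε 𝒜 γ) :
    omegaGen ε 𝒜 θ * omegaInc ε 𝒜 a = ε.val γ α • (omegaInc ε 𝒜 a * omegaGen ε 𝒜 θ) := by
  rw [← omegaExt_D, omegaExt_mul_inc ε ha, twistExt_D, twistDual_of_mem hθ, map_smul, map_smul,
    mul_smul_comm]

/-- The product `z θ`, as an element of the dual. -/
def dualSmul {β γ : Γ} {z : A} (hz : z ∈ center ε 𝒜) (hzβ : z ∈ 𝒜 β) {θ : Dual ε 𝒜}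
    (hθ : θ.1 ∈ DualHom ε 𝒜 γ) : Dual ε 𝒜 :=
  ⟨LinearMap.mulLeft ℂ z ∘ₗ θ.1, DualHom_le_Dual ε 𝒜 _ (dualSmul_mem hθ hz hzβ)⟩

theorem omegaInc_mul_gen {β γ : Γ} {z : A} (hz : z ∈ center ε 𝒜) (hzβ : z ∈ 𝒜 β)
    {θ : Dual ε 𝒜} (hθ : θ.1 ∈ DualHom ε 𝒜 γ) :
    omegaInc ε 𝒜 z * omegaGen ε 𝒜 θ = omegaGen ε 𝒜 (dualSmul hz hzβ hθ) := by
  rw [← omegaExt_Z ε 𝒜 ⟨z, hz⟩, ← omegaExt_D, ← map_mul, extZ_extD ε 𝒜 ⟨z, hz⟩ hzβ θ hθ]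
  rfl

theorem omegaGen_anticomm {γ δ : Γ} {θ η : Dual ε 𝒜} (hθ : θ.1 ∈ DualHom ε 𝒜 γ)
    (hη : η.1 ∈ DualHom ε 𝒜 δ) :
    omegaGen ε 𝒜 θ * omegaGen ε 𝒜 η
      = -(ε.val γ δ • (omegaGen ε 𝒜 η * omegaGen ε 𝒜 θ)) := by
  have := congrArg (omegaExt ε 𝒜) (extD_anticomm ε 𝒜 θ η hθ hη)
  rw [map_add, map_smul, map_mul, map_mul, map_zero] at this
  exact eq_neg_of_add_eq_zero_left this

variable (ε 𝒜) in
theorem extAlg_adjoin : Algebra.adjoin ℂ (Set.range (extZ ε 𝒜) ∪ Set.range (extD ε 𝒜)) = ⊤ := by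
  refine eq_top_iff.2 fun l _ => ?_
  obtain ⟨t, rfl⟩ := RingQuot.mkAlgHom_surjective ℂ (ExtRel ε 𝒜) l
  induction t using TensorAlgebra.induction with
  | algebraMap r => rw [AlgHom.commutes]; exact Subalgebra.algebraMap_mem _ r
  | ι x =>
    have : x = (x.1, 0) + (0, x.2) := by simp
    rw [this, map_add, map_add]
    exact add_mem (Algebra.subset_adjoin (Or.inl ⟨x.1, rfl⟩))
      (Algebra.subset_adjoin (Or.inr ⟨x.2, rfl⟩))
  | mul a b ha hb => rw [map_mul]; exact mul_mem (ha trivial) (hb trivial)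
  | add a b ha hb => rw [map_add]; exact add_mem (ha trivial) (hb trivial)

theorem dual_induction {p : Dual ε 𝒜 → Prop} (h0 : p 0) (hadd : ∀ θ η, p θ → p η → p (θ + η))
    (hom : ∀ γ (θ : Dual ε 𝒜), θ.1 ∈ DualHom ε 𝒜 γ → p θ) (θ : Dual ε 𝒜) : p θ := by
  obtain ⟨θ, hθ⟩ := θ
  refine Submodule.iSup_induction' (DualHom ε 𝒜) (motive := fun θ h => p ⟨θ, h⟩)
    (fun γ θ h => hom γ ⟨θ, _⟩ h) h0 (fun x y hx hy h1 h2 => hadd _ _ h1 h2) hθ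

/-- A subalgebra of `Omega` which contains the homogeneous generators is everything. -/
theorem omega_subalgebra (S : Subalgebra ℂ (Omega ε 𝒜))
    (hA : ∀ α, ∀ a ∈ 𝒜 α, omegaInc ε 𝒜 a ∈ S)
    (hD : ∀ γ (θ : Dual ε 𝒜), θ.1 ∈ DualHom ε 𝒜 γ → omegaGen ε 𝒜 θ ∈ S) (u : Omega ε 𝒜) :
    u ∈ S := by
  have hA' : ∀ a, omegaInc ε 𝒜 a ∈ S := fun a => by
    induction a using DirectSum.Decomposition.inductionOn 𝒜 with
    | zero => rw [map_zero]; exact zero_mem _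
    | homogeneous m => exact hA _ _ m.2
    | add a b ha hb => rw [map_add]; exact add_mem ha hb
  have hD' : ∀ θ, omegaGen ε 𝒜 θ ∈ S := fun θ => by
    induction θ using dual_induction with
    | h0 => rw [map_zero]; exact zero_mem _
    | hadd θ η h1 h2 => rw [map_add]; exact add_mem h1 h2
    | hom γ θ h => exact hD γ θ h
  have hE : ∀ l, omegaExt ε 𝒜 l ∈ S := fun l => by
    have : (⊤ : Subalgebra ℂ (ExtAlg ε 𝒜)) ≤ S.comap (omegaExt ε 𝒜) := by
      rw [← extAlg_adjoin, Algebra.adjoin_le_iff]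
      rintro _ (⟨z, rfl⟩ | ⟨θ, rfl⟩)
      · change omegaExt ε 𝒜 _ ∈ S
        rw [omegaExt_Z]; exact hA' _
      · exact hD' θ
    exact this (Algebra.mem_top (x := l))
  obtain ⟨t, rfl⟩ := RingQuot.mkAlgHom_surjective ℂ (BalRel ε 𝒜) u
  refine TensorProduct.induction_on (motive := fun t : A ⊗[ℂ] ExtAlg ε 𝒜 =>
    RingQuot.mkAlgHom ℂ (BalRel ε 𝒜) (t : SkewTensor ε 𝒜) ∈ S) t ?_ ?_ ?_
  · exact (map_zero (RingQuot.mkAlgHom ℂ (BalRel ε 𝒜))).symm ▸ zero_mem S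
  · intro a l
    have := tmulZ_eq ε 𝒜 a l
    change tmulZ ε 𝒜 a l ∈ S
    rw [this]
    exact mul_mem (hA' a) (hE l)
  · intro x y hx hy
    exact (map_add (RingQuot.mkAlgHom ℂ (BalRel ε 𝒜)) (x : SkewTensor ε 𝒜) y).symm ▸ add_mem hx hy

section Lift

variable {B : Type*} [Ring B] [Algebra ℂ B] (f : A →ₐ[ℂ] B) (h : Dual ε 𝒜 →ₗ[ℂ] B)

variable (ε 𝒜) in
/-- The relations between the values of an algebra map out of `Omega` on the generators. -/
structure LiftRel : Prop where
  exch : ∀ {γ : Γ} {θ : Dual ε 𝒜}, θ.1 ∈ DualHom ε 𝒜 γ → ∀ {α : Γ} {a : A}, a ∈ 𝒜 α →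
    h θ * f a = ε.val γ α • (f a * h θ)
  bal : ∀ {β : Γ} {z : A} (hz : z ∈ center ε 𝒜) (hzβ : z ∈ 𝒜 β) {γ : Γ} {θ : Dual ε 𝒜}
    (hθ : θ.1 ∈ DualHom ε 𝒜 γ), f z * h θ = h (dualSmul hz hzβ hθ)
  anticomm : ∀ {γ : Γ} {θ : Dual ε 𝒜}, θ.1 ∈ DualHom ε 𝒜 γ → ∀ {δ : Γ} {η : Dual ε 𝒜},
    η.1 ∈ DualHom ε 𝒜 δ → h θ * h η = -(ε.val γ δ • (h η * h θ))

variable {f h} (H : LiftRel ε 𝒜 f h)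
include H

/-- The restriction to the `ε`-exterior algebra of an algebra map given on generators. -/
def extLift : ExtAlg ε 𝒜 →ₐ[ℂ] B :=
  RingQuot.liftAlgHom ℂ ⟨TensorAlgebra.lift ℂ
      ((f.toLinearMap ∘ₗ (center ε 𝒜).val.toLinearMap).coprod h), fun x y hxy => by
    cases hxy with
    | one => simp
    | mul z w => simp
    | left z hz θ hθ =>
      have := H.bal z.2 hz hθ
      simpa [dualSmul] using this
    -- Right multiplication by Z needs no hypothesis of its own: `exch` for a central element moves
    -- it to the left, where `bal` applies.
    | right z hz θ hθ =>
      have h1 := H.bal z.2 hz hθ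
      have h2 := H.exch hθ hz
      rw [h1] at h2
      simpa [dualSmul] using h2
    | anticomm θ η hθ hη =>
      have := eq_neg_iff_add_eq_zero.1 (H.anticomm hθ hη)
      simpa using this⟩

theorem extLift_Z (z : center ε 𝒜) : extLift H (extZ ε 𝒜 z) = f z := by
  refine (RingQuot.liftAlgHom_mkAlgHom_apply ℂ _ _ _).trans ?_
  simp

theorem extLift_D (θ : Dual ε 𝒜) : extLift H (extD ε 𝒜 θ) = h θ := by
  refine (RingQuot.liftAlgHom_mkAlgHom_apply ℂ _ _ _).trans ?_
  simp

/-- The rule `exch` for single generators propagates to the whole exterior algebra. This is what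
makes `skewLift` multiplicative, since the product of `SkewTensor` moves l past c by means of
`twistExt`. -/
theorem extLift_mul {γ : Γ} {c : A} (hc : c ∈ 𝒜 γ) (l : ExtAlg ε 𝒜) :
    extLift H l * f c = f c * extLift H (twistExt ε 𝒜 γ l) := by
  have hl : l ∈ Algebra.adjoin ℂ (Set.range (extZ ε 𝒜) ∪ Set.range (extD ε 𝒜)) := by
    rw [extAlg_adjoin]; trivial
  induction hl using Algebra.adjoin_induction with
  | mem x hx =>
    obtain ⟨z, rfl⟩ | ⟨θ, rfl⟩ := hx
    -- For a generator from Z the exchange rule is the definition of the ε-center.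
    · rw [twistExt_Z, extLift_Z, extLift_Z, ← map_mul, ← map_mul,
        (bracket_eq_zero_iff ε 𝒜 z.1).1 z.2 γ c hc]
      rfl
    · rw [twistExt_D, extLift_D, extLift_D]
      induction θ using dual_induction with
      | h0 => simp
      | hadd θ η h1 h2 => rw [map_add, map_add, map_add, add_mul, h1, h2, mul_add]
      | hom δ θ hθ => rw [twistDual_of_mem hθ, map_smul, H.exch hθ hc, mul_smul_comm]
  | algebraMap r => rw [AlgHom.commutes, AlgHom.commutes, AlgHom.commutes, Algebra.commutes]
  | add x y _ _ hx hy => rw [map_add, map_add, map_add, add_mul, hx, hy, mul_add]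
  | mul x y _ _ hx hy => rw [map_mul, map_mul, map_mul, mul_assoc, hy, ← mul_assoc, hx, mul_assoc]

/-- The algebra map on the `ε`-graded tensor product given on generators. -/
def skewLift : SkewTensor ε 𝒜 →ₐ[ℂ] B :=
  AlgHom.ofLinearMap
    (TensorProduct.lift ((LinearMap.mul ℂ B).compl₁₂ f.toLinearMap (extLift H).toLinearMap) :
      A ⊗[ℂ] ExtAlg ε 𝒜 →ₗ[ℂ] B)
    (by
      refine (TensorProduct.lift.tmul _ _).trans ?_
      simp) fun x y => by
    set F : SkewTensor ε 𝒜 →ₗ[ℂ] B :=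
      (TensorProduct.lift ((LinearMap.mul ℂ B).compl₁₂ f.toLinearMap (extLift H).toLinearMap) :
        A ⊗[ℂ] ExtAlg ε 𝒜 →ₗ[ℂ] B) with hF
    have hFm : ∀ a l, F (stMk ε 𝒜 a l) = f a * extLift H l := fun a l => TensorProduct.lift.tmul _ _
    have : (LinearMap.mul ℂ (SkewTensor ε 𝒜)).compr₂ F = (LinearMap.mul ℂ B).compl₁₂ F F := by
      refine tensor_ext 𝒜 fun α a ha l => tensor_ext 𝒜 fun β b hb m => ?_
      have e := stMk_mul ε 𝒜 hb a l m
      change F (stMk ε 𝒜 a l * stMk ε 𝒜 b m) = F (stMk ε 𝒜 a l) * F (stMk ε 𝒜 b m)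
      rw [e, hFm, hFm, hFm, map_mul, map_mul, mul_assoc, ← mul_assoc (f b), ← extLift_mul H hb]
      simp only [mul_assoc]
    exact congrArg (fun k => k x y) this

theorem skewLift_mk (a : A) (l : ExtAlg ε 𝒜) : skewLift H (stMk ε 𝒜 a l) = f a * extLift H l :=
  TensorProduct.lift.tmul (f' := (LinearMap.mul ℂ B).compl₁₂ f.toLinearMap (extLift H).toLinearMap)
    a l

/-- The algebra map on `Omega` given on generators. -/
def omegaLift : Omega ε 𝒜 →ₐ[ℂ] B :=
  RingQuot.liftAlgHom ℂ ⟨skewLift H, fun x y hxy => by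
    cases hxy with
    | bal a z l =>
      rw [skewLift_mk, skewLift_mk, map_mul, map_mul, extLift_Z, mul_assoc]⟩

theorem omegaLift_inc (a : A) : omegaLift H (omegaInc ε 𝒜 a) = f a := by
  refine (RingQuot.liftAlgHom_mkAlgHom_apply ℂ _ _ _).trans ?_
  refine (skewLift_mk H a 1).trans ?_
  rw [map_one, mul_one]

theorem omegaLift_gen (θ : Dual ε 𝒜) : omegaLift H (omegaGen ε 𝒜 θ) = h θ := by
  refine (RingQuot.liftAlgHom_mkAlgHom_apply ℂ _ _ _).trans ?_
  refine (skewLift_mk H 1 _).trans ?_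
  rw [map_one, one_mul, extLift_D]

end Lift

/-! ### Skew derivations -/

section SkewDer

variable (s t : Omega ε 𝒜 →ₐ[ℂ] Omega ε 𝒜)

/-- `(s, t)`-derivations of `Omega`. -/
def IsSkewDer (δ : Omega ε 𝒜 →ₗ[ℂ] Omega ε 𝒜) : Prop :=
  ∀ u v, δ (u * v) = s u * δ v + δ u * t v

variable {s t}

/-- A skew derivation which vanishes on the generators is zero. -/
theorem IsSkewDer.eq_zero {δ : Omega ε 𝒜 →ₗ[ℂ] Omega ε 𝒜} (hδ : IsSkewDer s t δ)
    (hA : ∀ α, ∀ a ∈ 𝒜 α, δ (omegaInc ε 𝒜 a) = 0)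
    (hD : ∀ γ (θ : Dual ε 𝒜), θ.1 ∈ DualHom ε 𝒜 γ → δ (omegaGen ε 𝒜 θ) = 0) : δ = 0 := by
  have h1 : δ 1 = 0 := by
    have := hδ 1 1
    rw [mul_one, map_one s, map_one t, one_mul, mul_one] at this
    exact left_eq_add.1 this
  ext u
  exact omega_subalgebra
    { (LinearMap.ker δ) with
      mul_mem' := fun {a b} ha hb => by
        change δ (a * b) = 0
        rw [hδ, show δ a = 0 from ha, show δ b = 0 from hb, mul_zero, zero_mul, add_zero]
      algebraMap_mem' := fun r => by
        change δ (algebraMap ℂ _ r) = 0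
        rw [Algebra.algebraMap_eq_smul_one, map_smul, h1, smul_zero] } hA hD u

variable (δA : A →ₗ[ℂ] Omega ε 𝒜) (δD : Dual ε 𝒜 →ₗ[ℂ] Omega ε 𝒜)

/-- Existence of skew derivations with given values on the generators. -/
theorem exists_skewDer
    (hA : ∀ a b, δA (a * b) = s (omegaInc ε 𝒜 a) * δA b + δA a * t (omegaInc ε 𝒜 b))
    (exch : ∀ {γ : Γ} {θ : Dual ε 𝒜}, θ.1 ∈ DualHom ε 𝒜 γ → ∀ {α : Γ} {a : A}, a ∈ 𝒜 α →
      s (omegaGen ε 𝒜 θ) * δA a + δD θ * t (omegaInc ε 𝒜 a)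
        = ε.val γ α • (s (omegaInc ε 𝒜 a) * δD θ + δA a * t (omegaGen ε 𝒜 θ)))
    (bal : ∀ {β : Γ} {z : A} (hz : z ∈ center ε 𝒜) (hzβ : z ∈ 𝒜 β) {γ : Γ} {θ : Dual ε 𝒜}
      (hθ : θ.1 ∈ DualHom ε 𝒜 γ),
      s (omegaInc ε 𝒜 z) * δD θ + δA z * t (omegaGen ε 𝒜 θ) = δD (dualSmul hz hzβ hθ))
    (anticomm : ∀ {γ : Γ} {θ : Dual ε 𝒜}, θ.1 ∈ DualHom ε 𝒜 γ → ∀ {δ : Γ} {η : Dual ε 𝒜},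
      η.1 ∈ DualHom ε 𝒜 δ →
      s (omegaGen ε 𝒜 θ) * δD η + δD θ * t (omegaGen ε 𝒜 η)
        = -(ε.val γ δ • (s (omegaGen ε 𝒜 η) * δD θ + δD η * t (omegaGen ε 𝒜 θ)))) :
    ∃ δ : Omega ε 𝒜 →ₗ[ℂ] Omega ε 𝒜, IsSkewDer s t δ ∧
      (∀ a, δ (omegaInc ε 𝒜 a) = δA a) ∧ ∀ θ, δ (omegaGen ε 𝒜 θ) = δD θ := by
  have h1 : δA 1 = 0 := by
    have := hA 1 1
    rw [mul_one, map_one (omegaInc ε 𝒜), map_one s, map_one t, one_mul, mul_one] at this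
    exact left_eq_add.1 this
  -- A linear map δ is an (s, t)-derivation exactly when u ↦ (s u, δ u; 0, t u) is multiplicative
  -- into 2 × 2 upper triangular matrices. So δ is sought as the corner entry of an algebra map, and
  -- the hypotheses say that the corner entries respect the relations of T.
  let f : A →ₐ[ℂ] Matrix (Fin 2) (Fin 2) (Omega ε 𝒜) := AlgHom.ofLinearMap
    { toFun := fun a => !![s (omegaInc ε 𝒜 a), δA a; 0, t (omegaInc ε 𝒜 a)]
      map_add' := fun a b => by simp
      map_smul' := fun r a => by simp }
    (by simp [h1, Matrix.one_fin_two]) fun a b => by simp [hA]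
  let h : Dual ε 𝒜 →ₗ[ℂ] Matrix (Fin 2) (Fin 2) (Omega ε 𝒜) :=
    { toFun := fun θ => !![s (omegaGen ε 𝒜 θ), δD θ; 0, t (omegaGen ε 𝒜 θ)]
      map_add' := fun a b => by simp
      map_smul' := fun r a => by simp }
  have hf : ∀ a, f a = !![s (omegaInc ε 𝒜 a), δA a; 0, t (omegaInc ε 𝒜 a)] := fun _ => rfl
  have hh : ∀ a, h a = !![s (omegaGen ε 𝒜 a), δD a; 0, t (omegaGen ε 𝒜 a)] := fun _ => rfl
  have H : LiftRel ε 𝒜 f h := by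
    refine ⟨fun {γ θ} hθ {α a} ha => ?_, fun {β z} hz hzβ {γ θ} hθ => ?_,
      fun {γ θ} hθ {δ η} hη => ?_⟩
    · have e := omegaGen_mul_inc ha hθ
      have e1 := congrArg s e
      have e2 := congrArg t e
      rw [map_mul, map_smul, map_mul] at e1 e2
      simp [hf, hh, e1, e2, exch hθ ha]
    · have e := omegaInc_mul_gen hz hzβ hθ
      have e1 := congrArg s e
      have e2 := congrArg t e
      rw [map_mul] at e1 e2
      simp [hf, hh, e1, e2, bal hz hzβ hθ]
    · have e := omegaGen_anticomm hθ hη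
      have e1 := congrArg s e
      have e2 := congrArg t e
      rw [map_mul, map_neg, map_smul, map_mul] at e1 e2
      simp [hh, e1, e2, anticomm hθ hη]
  -- The other three entries are as intended on generators, hence everywhere; the corner entry of a
  -- product is then the skew Leibniz rule.
  have key : ∀ u, omegaLift H u 0 0 = s u ∧ omegaLift H u 1 1 = t u ∧ omegaLift H u 1 0 = 0 := by
    refine omega_subalgebra
      { carrier := {u | omegaLift H u 0 0 = s u ∧ omegaLift H u 1 1 = t u ∧ omegaLift H u 1 0 = 0}
        mul_mem' := ?_
        add_mem' := ?_
        algebraMap_mem' := ?_ } (fun α a _ => ?_) fun γ θ _ => ?_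
    · rintro a b ⟨h1, h2, h3⟩ ⟨h4, h5, h6⟩
      simp [Matrix.mul_apply, h1, h2, h3, h4, h5, h6]
    · rintro a b ⟨h1, h2, h3⟩ ⟨h4, h5, h6⟩
      simp [h1, h2, h3, h4, h5, h6]
    · intro r
      simp [AlgHom.commutes, Matrix.algebraMap_matrix_apply]
    · change omegaLift H (omegaInc ε 𝒜 a) 0 0 = _ ∧ _
      simp [omegaLift_inc, hf]
    · change omegaLift H (omegaGen ε 𝒜 θ) 0 0 = _ ∧ _
      simp [omegaLift_gen, hh]
  refine ⟨Matrix.entryLinearMap ℂ (Omega ε 𝒜) 0 1 ∘ₗ (omegaLift H).toLinearMap, fun u v => ?_,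
    fun a => ?_, fun θ => ?_⟩
  · simp [Matrix.mul_apply, (key u).1, (key v).2.1]
  · simp [omegaLift_inc, hf]
  · simp [omegaLift_gen, hh]

end SkewDer

end Generators

end EpsGraded

end

/-! ### The bigrading of T and the automorphisms it defines. -/

noncomputable section

namespace EpsGraded

section Grading

set_option linter.unusedSectionVars false

variable {Γ : Type*} [AddCommGroup Γ] [DecidableEq Γ] {A : Type*} [Ring A] [Algebra ℂ A]
variable {ε : CommFactor Γ} {𝒜 : Γ → Submodule ℂ A} [GradedAlgebra 𝒜]

/-! ### The bigrading -/

theorem monomial_eq {n : ℕ} (a : A) (θ : Fin n → Dual ε 𝒜) :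
    monomial ε 𝒜 a θ = omegaInc ε 𝒜 a * (List.ofFn fun i => omegaGen ε 𝒜 (θ i)).prod := by
  rw [monomial, tmulZ_eq, map_list_prod, List.map_ofFn]
  rfl

theorem monomial_zero (a : A) (θ : Fin 0 → Dual ε 𝒜) : monomial ε 𝒜 a θ = omegaInc ε 𝒜 a := by
  rw [monomial_eq, List.ofFn_zero, List.prod_nil, mul_one]

theorem monomial_succ {n : ℕ} (a : A) (θ : Fin (n + 1) → Dual ε 𝒜) :
    monomial ε 𝒜 a θ
      = monomial ε 𝒜 a (fun i => θ i.castSucc) * omegaGen ε 𝒜 (θ (Fin.last n)) := by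
  rw [monomial_eq, monomial_eq, List.ofFn_succ', List.concat_eq_append, List.prod_append,
    List.prod_singleton, mul_assoc]

theorem monomial_mem {n : ℕ} {α : Γ} {a : A} (ha : a ∈ 𝒜 α) {g : Fin n → Γ}
    {θ : Fin n → Dual ε 𝒜} (hθ : ∀ i, (θ i).1 ∈ DualHom ε 𝒜 (g i)) :
    monomial ε 𝒜 a θ ∈ OmegaHom ε 𝒜 n (α + ∑ i, g i) :=
  Submodule.subset_span ⟨α, a, g, θ, ha, hθ, rfl, rfl⟩

theorem omegaInc_mem {k : Γ} {a : A} (ha : a ∈ 𝒜 k) : omegaInc ε 𝒜 a ∈ OmegaHom ε 𝒜 0 k := by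
  have := monomial_mem ha (ε := ε) (g := ![]) (θ := ![]) (fun i => i.elim0)
  rwa [monomial_zero, Fin.sum_univ_zero, add_zero] at this

theorem mul_omegaGen_mem {n : ℕ} {k γ : Γ} {u : Omega ε 𝒜} (hu : u ∈ OmegaHom ε 𝒜 n k)
    {θ : Dual ε 𝒜} (hθ : θ.1 ∈ DualHom ε 𝒜 γ) :
    u * omegaGen ε 𝒜 θ ∈ OmegaHom ε 𝒜 (n + 1) (k + γ) := by
  induction hu using Submodule.span_induction with
  | mem u h =>
    obtain ⟨α, a, g, η, ha, hη, rfl, rfl⟩ := h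
    have := monomial_mem (ε := ε) ha (g := Fin.snoc g γ) (θ := Fin.snoc η θ) (n := n + 1)
      (fun i => by
        induction i using Fin.lastCases with
        | last => simpa using hθ
        | cast i => simpa using hη i)
    rw [monomial_succ, Fin.sum_univ_castSucc] at this
    simpa [add_assoc] using this
  | zero => rw [zero_mul]; exact zero_mem _
  | add x y _ _ hx hy => rw [add_mul]; exact add_mem hx hy
  | smul c x _ hx => rw [smul_mul_assoc]; exact Submodule.smul_mem _ c hx

/-- Induction on the homogeneous components of `Omega`. -/
theorem omegaHom_le (Q : ℕ → Γ → Submodule ℂ (Omega ε 𝒜))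
    (h0 : ∀ k, ∀ a ∈ 𝒜 k, omegaInc ε 𝒜 a ∈ Q 0 k)
    (hs : ∀ n k, ∀ u ∈ OmegaHom ε 𝒜 n k, u ∈ Q n k → ∀ γ (θ : Dual ε 𝒜),
      θ.1 ∈ DualHom ε 𝒜 γ → u * omegaGen ε 𝒜 θ ∈ Q (n + 1) (k + γ)) (n : ℕ) (k : Γ) :
    OmegaHom ε 𝒜 n k ≤ Q n k := by
  refine Submodule.span_le.2 ?_
  rintro _ ⟨α, a, g, θ, ha, hθ, rfl, rfl⟩
  change _ ∈ Q _ _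
  induction n with
  | zero => rw [monomial_zero, Fin.sum_univ_zero, add_zero]; exact h0 _ _ ha
  | succ n ih =>
    rw [monomial_succ, Fin.sum_univ_castSucc, ← add_assoc]
    exact hs _ _ _ (monomial_mem ha fun i => hθ i.castSucc) (ih _ _ fun i => hθ i.castSucc) _ _
      (hθ (Fin.last n))

theorem omegaHom_zero {k : Γ} {u : Omega ε 𝒜} (hu : u ∈ OmegaHom ε 𝒜 0 k) :
    ∃ a ∈ 𝒜 k, u = omegaInc ε 𝒜 a := by
  -- Only exterior degree zero matters, so the inductive predicate is taken to be everything in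
  -- positive degree.
  have := omegaHom_le (ε := ε) (𝒜 := 𝒜)
    (fun n k => if n = 0 then (𝒜 k).map (omegaInc ε 𝒜).toLinearMap else ⊤)
    (fun k a ha => ⟨a, ha, rfl⟩) (fun n k u _ _ γ θ _ => by simp) 0 k hu
  obtain ⟨a, ha, h⟩ := this
  exact ⟨a, ha, h.symm⟩

theorem mul_omegaInc_mem {n : ℕ} {k α : Γ} {u : Omega ε 𝒜} (hu : u ∈ OmegaHom ε 𝒜 n k) {a : A}
    (ha : a ∈ 𝒜 α) : u * omegaInc ε 𝒜 a ∈ OmegaHom ε 𝒜 n (k + α) := by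
  refine omegaHom_le (fun n k => (OmegaHom ε 𝒜 n (k + α)).comap
    (LinearMap.mulRight ℂ (omegaInc ε 𝒜 a))) (fun k b hb => ?_) (fun n k u _ hu γ θ hθ => ?_) n k hu
  · rw [Submodule.mem_comap, LinearMap.mulRight_apply, ← map_mul]
    exact omegaInc_mem (SetLike.GradedMul.mul_mem hb ha)
  · rw [Submodule.mem_comap, LinearMap.mulRight_apply] at hu ⊢
    rw [mul_assoc, omegaGen_mul_inc ha hθ, mul_smul_comm, ← mul_assoc, add_right_comm]
    exact Submodule.smul_mem _ _ (mul_omegaGen_mem hu hθ)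

theorem omegaHom_mul {p q : ℕ} {k l : Γ} {u v : Omega ε 𝒜} (hu : u ∈ OmegaHom ε 𝒜 p k)
    (hv : v ∈ OmegaHom ε 𝒜 q l) : u * v ∈ OmegaHom ε 𝒜 (p + q) (k + l) := by
  refine omegaHom_le (fun q l => (OmegaHom ε 𝒜 (p + q) (k + l)).comap (LinearMap.mulLeft ℂ u))
    (fun l b hb => ?_) (fun q l v _ hv γ θ hθ => ?_) q l hv
  · rw [Submodule.mem_comap, LinearMap.mulLeft_apply]
    exact mul_omegaInc_mem hu hb
  · rw [Submodule.mem_comap, LinearMap.mulLeft_apply] at hv ⊢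
    rw [← mul_assoc, ← add_assoc k]
    exact mul_omegaGen_mem hv hθ

theorem one_mem_omegaHom : (1 : Omega ε 𝒜) ∈ OmegaHom ε 𝒜 0 0 := by
  rw [← map_one (omegaInc ε 𝒜)]
  exact omegaInc_mem SetLike.GradedOne.one_mem

theorem omegaGen_mem {γ : Γ} {θ : Dual ε 𝒜} (hθ : θ.1 ∈ DualHom ε 𝒜 γ) :
    omegaGen ε 𝒜 θ ∈ OmegaHom ε 𝒜 1 γ := by
  have := mul_omegaGen_mem one_mem_omegaHom hθ
  rwa [one_mul, zero_add, zero_add] at this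

/-- The sum of the components is closed under products and contains the generators. That the sum is
direct is not visible from the presentation; it is obtained later, in `coeLinearMap_bijective`, by
comparison with forms. -/
theorem omega_span (u : Omega ε 𝒜) : u ∈ ⨆ p : ℕ × Γ, OmegaHom ε 𝒜 p.1 p.2 := by
  have hle : ∀ n k, OmegaHom ε 𝒜 n k ≤ ⨆ p : ℕ × Γ, OmegaHom ε 𝒜 p.1 p.2 := fun n k =>
    le_iSup (fun p : ℕ × Γ => OmegaHom ε 𝒜 p.1 p.2) (n, k)
  refine omega_subalgebra (ε := ε) (𝒜 := 𝒜)
    { (⨆ p : ℕ × Γ, OmegaHom ε 𝒜 p.1 p.2) with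
      mul_mem' := fun {a b} ha hb => ?_
      algebraMap_mem' := fun r => ?_ } (fun α a ha => hle 0 α (omegaInc_mem ha))
    (fun γ θ hθ => hle 1 γ (omegaGen_mem hθ)) u
  · change a * b ∈ ⨆ p : ℕ × Γ, OmegaHom ε 𝒜 p.1 p.2
    induction ha using Submodule.iSup_induction' with
    | mem i x hx =>
      induction hb using Submodule.iSup_induction' with
      | mem j y hy => exact hle _ _ (omegaHom_mul hx hy)
      | zero => rw [mul_zero]; exact zero_mem _
      | add x y _ _ hx hy => rw [mul_add]; exact add_mem hx hy
    | zero => rw [zero_mul]; exact zero_mem _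
    | add x y _ _ hx hy => rw [add_mul]; exact add_mem hx hy
  · change algebraMap ℂ _ r ∈ ⨆ p : ℕ × Γ, OmegaHom ε 𝒜 p.1 p.2
    rw [Algebra.algebraMap_eq_smul_one]
    exact Submodule.smul_mem _ _ (hle 0 0 one_mem_omegaHom)

/-- Linear maps which agree on the homogeneous components of `Omega` are equal. -/
theorem omega_lin_ext {N : Type*} [AddCommGroup N] [Module ℂ N] {f g : Omega ε 𝒜 →ₗ[ℂ] N}
    (h : ∀ n k, ∀ u ∈ OmegaHom ε 𝒜 n k, f u = g u) : f = g := by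
  have : (⨆ p : ℕ × Γ, OmegaHom ε 𝒜 p.1 p.2) ≤ LinearMap.eqLocus f g :=
    iSup_le fun p u hu => h p.1 p.2 u hu
  ext u
  exact this (omega_span u)

/-! ### Automorphisms attached to the grading -/

variable (ε 𝒜)

theorem liftRel_twist (γ : Γ) : LiftRel ε 𝒜 ((omegaInc ε 𝒜).comp (twist ε 𝒜 γ))
    (omegaGen ε 𝒜 ∘ₗ twistDual ε 𝒜 γ) := by
  refine ⟨fun {δ θ} hθ {α a} ha => ?_, fun {β z} hz hzβ {δ θ} hθ => ?_,
    fun {δ θ} hθ {δ' η} hη => ?_⟩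
  · simp only [LinearMap.comp_apply, AlgHom.comp_apply, twist_of_mem ε ha, twistDual_of_mem hθ,
      map_smul, smul_mul_smul_comm, omegaGen_mul_inc ha hθ, smul_smul]
    congr 1; ring
  · simp only [LinearMap.comp_apply, AlgHom.comp_apply, twist_of_mem ε hzβ, twistDual_of_mem hθ,
      map_smul, smul_mul_smul_comm, omegaInc_mul_gen hz hzβ hθ,
      twistDual_of_mem (θ := dualSmul hz hzβ hθ) (dualSmul_mem hθ hz hzβ), ε.val_add_left]
  · simp only [LinearMap.comp_apply, twistDual_of_mem hθ, twistDual_of_mem hη, map_smul,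
      smul_mul_smul_comm, omegaGen_anticomm hθ hη, smul_smul, smul_neg]
    congr 2; ring

/-- The automorphism of `Omega` which multiplies the elements of degree `k` by `ε(k, γ)`. -/
def omegaTwist (γ : Γ) : Omega ε 𝒜 →ₐ[ℂ] Omega ε 𝒜 := omegaLift (liftRel_twist ε 𝒜 γ)

theorem liftRel_sign : LiftRel ε 𝒜 (omegaInc ε 𝒜) (-omegaGen ε 𝒜) := by
  refine ⟨fun {δ θ} hθ {α a} ha => ?_, fun {β z} hz hzβ {δ θ} hθ => ?_,
    fun {δ θ} hθ {δ' η} hη => ?_⟩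
  · simp [omegaGen_mul_inc ha hθ]
  · simp [omegaInc_mul_gen hz hzβ hθ]
  · simp [omegaGen_anticomm hθ hη]

/-- The automorphism of `Omega` which multiplies the elements of exterior degree `n` by
`(-1) ^ n`. -/
def omegaSign : Omega ε 𝒜 →ₐ[ℂ] Omega ε 𝒜 := omegaLift (liftRel_sign ε 𝒜)

theorem liftRel_proj : LiftRel ε 𝒜 (AlgHom.id ℂ A) 0 := by
  refine ⟨fun {δ θ} hθ {α a} ha => ?_, fun {β z} hz hzβ {δ θ} hθ => ?_,
    fun {δ θ} hθ {δ' η} hη => ?_⟩ <;> simp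

/-- The projection of `Omega` to its part of exterior degree zero. -/
def omegaProj : Omega ε 𝒜 →ₐ[ℂ] A := omegaLift (liftRel_proj ε 𝒜)

variable {ε 𝒜}

theorem omegaTwist_inc {α : Γ} {a : A} (ha : a ∈ 𝒜 α) (γ : Γ) :
    omegaTwist ε 𝒜 γ (omegaInc ε 𝒜 a) = ε.val α γ • omegaInc ε 𝒜 a := by
  rw [omegaTwist, omegaLift_inc, AlgHom.comp_apply, twist_of_mem ε ha, map_smul]

theorem omegaTwist_gen {δ : Γ} {θ : Dual ε 𝒜} (hθ : θ.1 ∈ DualHom ε 𝒜 δ) (γ : Γ) :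
    omegaTwist ε 𝒜 γ (omegaGen ε 𝒜 θ) = ε.val δ γ • omegaGen ε 𝒜 θ := by
  rw [omegaTwist, omegaLift_gen, LinearMap.comp_apply, twistDual_of_mem hθ, map_smul]

theorem omegaSign_inc (a : A) : omegaSign ε 𝒜 (omegaInc ε 𝒜 a) = omegaInc ε 𝒜 a :=
  omegaLift_inc _ a

theorem omegaSign_gen (θ : Dual ε 𝒜) : omegaSign ε 𝒜 (omegaGen ε 𝒜 θ) = -omegaGen ε 𝒜 θ :=
  omegaLift_gen _ θ

theorem omegaProj_inc (a : A) : omegaProj ε 𝒜 (omegaInc ε 𝒜 a) = a := omegaLift_inc _ a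

theorem omegaProj_gen (θ : Dual ε 𝒜) : omegaProj ε 𝒜 (omegaGen ε 𝒜 θ) = 0 := omegaLift_gen _ θ

theorem omegaTwist_of_mem {n : ℕ} {k : Γ} {u : Omega ε 𝒜} (hu : u ∈ OmegaHom ε 𝒜 n k) (γ : Γ) :
    omegaTwist ε 𝒜 γ u = ε.val k γ • u := by
  refine omegaHom_le (fun n k => LinearMap.eqLocus (omegaTwist ε 𝒜 γ).toLinearMap
    (ε.val k γ • LinearMap.id)) (fun k a ha => by
      change omegaTwist ε 𝒜 γ _ = ε.val k γ • _
      rw [omegaTwist_inc ha]; rfl)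
    (fun n k u _ hu δ θ hθ => ?_) n k hu
  change omegaTwist ε 𝒜 γ u = ε.val k γ • u at hu
  change omegaTwist ε 𝒜 γ (u * _) = ε.val (k + δ) γ • (u * _)
  rw [map_mul, hu, omegaTwist_gen hθ, smul_mul_smul_comm, ε.val_add_left]

theorem omegaSign_of_mem {n : ℕ} {k : Γ} {u : Omega ε 𝒜} (hu : u ∈ OmegaHom ε 𝒜 n k) :
    omegaSign ε 𝒜 u = (-1 : ℂ) ^ n • u := by
  refine omegaHom_le (fun n k => LinearMap.eqLocus (omegaSign ε 𝒜).toLinearMap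
    ((-1 : ℂ) ^ n • LinearMap.id)) (fun k a ha => ?_)
    (fun n k u _ hu δ θ hθ => ?_) n k hu
  · change omegaSign ε 𝒜 _ = (-1 : ℂ) ^ 0 • _
    rw [omegaSign_inc, pow_zero, one_smul]
    rfl
  · change omegaSign ε 𝒜 u = (-1 : ℂ) ^ n • u at hu
    change omegaSign ε 𝒜 (u * _) = (-1 : ℂ) ^ (n + 1) • (u * _)
    rw [map_mul, hu, omegaSign_gen, mul_neg, smul_mul_assoc, pow_succ, mul_smul, neg_one_smul,
      smul_neg]

theorem omegaProj_of_mem {n : ℕ} {k : Γ} {u : Omega ε 𝒜} (hu : u ∈ OmegaHom ε 𝒜 (n + 1) k) :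
    omegaProj ε 𝒜 u = 0 := by
  refine omegaHom_le (fun n k => if n = 0 then ⊤ else LinearMap.ker (omegaProj ε 𝒜).toLinearMap)
    (fun k a ha => by simp) (fun n k u _ hu δ θ hθ => ?_) (n + 1) k hu
  simp [omegaProj_gen]

/-- The exchange rule between generators and arbitrary elements. -/
theorem omegaGen_mul_sign {γ : Γ} {θ : Dual ε 𝒜} (hθ : θ.1 ∈ DualHom ε 𝒜 γ) (u : Omega ε 𝒜) :
    omegaGen ε 𝒜 θ * omegaSign ε 𝒜 u = omegaTwist ε 𝒜 (-γ) u * omegaGen ε 𝒜 θ := by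
  -- The twist is by -γ because ε(γ, δ) = ε(δ, γ)⁻¹ = ε(δ, -γ).
  have sw : ∀ δ, ε.val γ δ = ε.val δ (-γ) := fun δ => by
    have h1 := ε.val_neg_right δ γ
    have h2 := ε.val_mul_swap δ γ
    exact mul_left_cancel₀ (ε.val_ne_zero δ γ) (h2.trans h1.symm)
  refine omega_subalgebra
    { carrier := {u | omegaGen ε 𝒜 θ * omegaSign ε 𝒜 u = omegaTwist ε 𝒜 (-γ) u * omegaGen ε 𝒜 θ}
      mul_mem' := fun {a b} ha hb => by
        change _ * _ = _ * _ at ha hb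
        change _ * _ = _ * _
        rw [map_mul, map_mul, ← mul_assoc, ha, mul_assoc, hb, mul_assoc]
      add_mem' := fun {a b} ha hb => by
        change _ * _ = _ * _ at ha hb
        change _ * _ = _ * _
        rw [map_add, map_add, mul_add, ha, hb, add_mul]
      algebraMap_mem' := fun r => by
        change _ * _ = _ * _
        rw [AlgHom.commutes, AlgHom.commutes, Algebra.commutes] }
    (fun α a ha => ?_) (fun δ η hη => ?_) u
  · change _ * _ = _ * _
    rw [omegaSign_inc, omegaTwist_inc ha, omegaGen_mul_inc ha hθ, sw, smul_mul_assoc]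
  · change _ * _ = _ * _
    rw [omegaSign_gen, omegaTwist_gen hη, mul_neg, omegaGen_anticomm hθ hη, sw, neg_neg,
      smul_mul_assoc]

end Grading

end EpsGraded

end

/-! ### Graded division algebras: ε-center, dual basis, inner derivations. -/

noncomputable section

namespace EpsGraded

section FineDivision

set_option linter.unusedSectionVars false

variable {Γ : Type*} [AddCommGroup Γ] [DecidableEq Γ] {A : Type*} [Ring A] [Algebra ℂ A]
variable {ε : CommFactor Γ} {𝒜 : Γ → Submodule ℂ A} [GradedAlgebra 𝒜]

/-! ### Fine graded division algebras -/

/-- Fine gradings of finite support whose nonzero homogeneous elements are invertible. -/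
structure IsFineDivision (𝒜 : Γ → Submodule ℂ A) : Prop where
  finite : (Supp 𝒜).Finite
  dim : ∀ α, ∀ a ∈ 𝒜 α, a ≠ 0 → ∀ b ∈ 𝒜 α, ∃ c : ℂ, b = c • a
  inv : ∀ α, ∀ a ∈ 𝒜 α, a ≠ 0 → ∃ b ∈ 𝒜 (-α), a * b = 1 ∧ b * a = 1

theorem mem_supp_of_ne {α : Γ} {a : A} (ha : a ∈ 𝒜 α) (h : a ≠ 0) : α ∈ Supp 𝒜 :=
  (Submodule.ne_bot_iff _).2 ⟨a, ha, h⟩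

theorem homBasis_mem (α : Γ) : homBasis 𝒜 α ∈ 𝒜 α := by
  unfold homBasis
  split_ifs with h
  · exact h.choose_spec.1
  · exact zero_mem _

theorem homBasis_ne_zero {α : Γ} (hα : α ∈ Supp 𝒜) : homBasis 𝒜 α ≠ 0 := by
  have h : ∃ a ∈ 𝒜 α, a ≠ 0 := (Submodule.ne_bot_iff _).1 hα
  unfold homBasis
  rw [dif_pos h]
  exact h.choose_spec.2

variable (𝒜) in
/-- The inverse of the chosen homogeneous element of degree `α`. -/
def homInv (α : Γ) : A := Ring.inverse (homBasis 𝒜 α)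

namespace IsFineDivision

variable (H : IsFineDivision 𝒜)
include H

theorem eq_smul {α : Γ} {a : A} (ha : a ∈ 𝒜 α) : ∃ c : ℂ, a = c • homBasis 𝒜 α := by
  by_cases h : a = 0
  · exact ⟨0, by rw [h, zero_smul]⟩
  · exact H.dim α _ (homBasis_mem α) (homBasis_ne_zero (mem_supp_of_ne ha h)) a ha

theorem isUnit {α : Γ} {a : A} (ha : a ∈ 𝒜 α) (h : a ≠ 0) : IsUnit a := by
  obtain ⟨b, _, h1, h2⟩ := H.inv α a ha h
  exact ⟨⟨a, b, h1, h2⟩, rfl⟩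

theorem homogeneous_mul_ne_zero {α β : Γ} {a b : A} (ha : a ∈ 𝒜 α) (ha' : a ≠ 0) (_ : b ∈ 𝒜 β)
    (hb' : b ≠ 0) : a * b ≠ 0 := fun h => by
  have := (H.isUnit ha ha').mul_right_eq_zero.1 h
  exact hb' this

theorem mul_homInv {α : Γ} (hα : α ∈ Supp 𝒜) : homBasis 𝒜 α * homInv 𝒜 α = 1 :=
  Ring.mul_inverse_cancel _ (H.isUnit (homBasis_mem α) (homBasis_ne_zero hα))

theorem homInv_mul {α : Γ} (hα : α ∈ Supp 𝒜) : homInv 𝒜 α * homBasis 𝒜 α = 1 :=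
  Ring.inverse_mul_cancel _ (H.isUnit (homBasis_mem α) (homBasis_ne_zero hα))

theorem homInv_mem (α : Γ) : homInv 𝒜 α ∈ 𝒜 (-α) := by
  by_cases h : homBasis 𝒜 α = 0
  -- A zero basis element has `Ring.inverse` equal to zero, except that in the trivial ring zero is
  -- a unit.
  · rcases subsingleton_or_nontrivial A with hA | hA
    · rw [Subsingleton.elim (homInv 𝒜 α) 0]; exact zero_mem _
    · rw [homInv, h, Ring.inverse_zero]; exact zero_mem _
  · obtain ⟨b, hb, h1, h2⟩ := H.inv α _ (homBasis_mem α) h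
    have h3 := H.homInv_mul (mem_supp_of_ne (homBasis_mem α) h)
    have : homInv 𝒜 α = b := by
      rw [← mul_one (homInv 𝒜 α), ← h1, ← mul_assoc, h3, one_mul]
    rwa [this]

theorem supp_add {α β : Γ} (hα : α ∈ Supp 𝒜) (hβ : β ∈ Supp 𝒜) : α + β ∈ Supp 𝒜 :=
  mem_supp_of_ne (SetLike.GradedMul.mul_mem (homBasis_mem α) (homBasis_mem β))
    (H.homogeneous_mul_ne_zero (homBasis_mem α) (homBasis_ne_zero hα) (homBasis_mem β) (homBasis_ne_zero hβ))

theorem supp_neg {α : Γ} (hα : α ∈ Supp 𝒜) : -α ∈ Supp 𝒜 := by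
  refine mem_supp_of_ne (H.homInv_mem α) fun h => homBasis_ne_zero hα ?_
  rw [← mul_one (homBasis 𝒜 α), ← H.homInv_mul hα, h, zero_mul, mul_zero]

theorem supp_sub {α β : Γ} (hα : α ∈ Supp 𝒜) (hβ : β ∈ Supp 𝒜) : α - β ∈ Supp 𝒜 := by
  rw [sub_eq_add_neg]; exact H.supp_add hα (H.supp_neg hβ)

theorem factorSet_spec {α β : Γ} :
    homBasis 𝒜 α * homBasis 𝒜 β = factorSet 𝒜 α β • homBasis 𝒜 (α + β) := by
  have h := H.eq_smul (SetLike.GradedMul.mul_mem (homBasis_mem (𝒜 := 𝒜) α)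
    (homBasis_mem (𝒜 := 𝒜) β))
  unfold factorSet
  rw [dif_pos h]
  exact h.choose_spec

/-- Both products are multiples of the same e_{α+β}, and σ(β, α) is nonzero because nonzero
homogeneous elements are invertible; so ε_σ is the commutation factor of the basis itself. -/
theorem epsSigma_spec {α β : Γ} (hα : α ∈ Supp 𝒜) (hβ : β ∈ Supp 𝒜) :
    homBasis 𝒜 α * homBasis 𝒜 β = epsSigma 𝒜 α β • (homBasis 𝒜 β * homBasis 𝒜 α) := by
  have h1 := H.factorSet_spec (α := α) (β := β)
  have h2 := H.factorSet_spec (α := β) (β := α)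
  have h3 : factorSet 𝒜 β α ≠ 0 := fun h => by
    rw [h, zero_smul] at h2
    exact H.homogeneous_mul_ne_zero (homBasis_mem β) (homBasis_ne_zero hβ) (homBasis_mem α)
      (homBasis_ne_zero hα) h2
  rw [h1, h2, add_comm β α, smul_smul, epsSigma, inv_mul_cancel_right₀ h3]

/-- Commutation of the basis elements is governed by ε_σ and ε-centrality by ε. This turns the
combinatorial set `agree` into the set of degrees of Z. -/
theorem agree_iff {α : Γ} (hα : α ∈ Supp 𝒜) :
    α ∈ agree ε 𝒜 ↔ homBasis 𝒜 α ∈ center ε 𝒜 := by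
  constructor
  · intro h
    refine (bracket_eq_zero_iff ε 𝒜 _).2 fun β b hb => ?_
    obtain ⟨c, rfl⟩ := H.eq_smul hb
    by_cases hβ : β ∈ Supp 𝒜
    · rw [twist_of_mem ε (homBasis_mem α), mul_smul_comm, H.epsSigma_spec hα hβ, ← h.2 β hβ,
        smul_mul_assoc, mul_smul_comm, smul_comm]
    · rw [show 𝒜 β = ⊥ from not_not.1 hβ] at hb
      rw [(Submodule.mem_bot ℂ).1 hb, mul_zero, zero_mul]
  · intro h
    refine ⟨hα, fun β hβ => ?_⟩
    have h1 := center_comm h (homBasis_mem α) (homBasis_mem (𝒜 := 𝒜) β)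
    rw [H.epsSigma_spec hα hβ] at h1
    exact (smul_left_injective ℂ (H.homogeneous_mul_ne_zero (homBasis_mem β) (homBasis_ne_zero hβ)
      (homBasis_mem α) (homBasis_ne_zero hα)) h1).symm

theorem mem_center_of_agree {α : Γ} (hα : α ∈ agree ε 𝒜) {a : A} (ha : a ∈ 𝒜 α) :
    a ∈ center ε 𝒜 := by
  obtain ⟨c, rfl⟩ := H.eq_smul ha
  exact Subalgebra.smul_mem _ ((H.agree_iff hα.1).1 hα) c

theorem agree_of_mem_center {α : Γ} {a : A} (ha : a ∈ 𝒜 α) (h : a ≠ 0)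
    (hc : a ∈ center ε 𝒜) : α ∈ agree ε 𝒜 := by
  have hα := mem_supp_of_ne ha h
  obtain ⟨c, rfl⟩ := H.eq_smul ha
  refine (H.agree_iff hα).2 ?_
  have hc0 : c ≠ 0 := fun h0 => h (by rw [h0, zero_smul])
  have := Subalgebra.smul_mem _ hc c⁻¹
  rwa [smul_smul, inv_mul_cancel₀ hc0, one_smul] at this

theorem agree_add {α β : Γ} (hα : α ∈ agree ε 𝒜) (hβ : β ∈ agree ε 𝒜) :
    α + β ∈ agree ε 𝒜 :=
  H.agree_of_mem_center (SetLike.GradedMul.mul_mem (homBasis_mem α) (homBasis_mem β))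
    (H.homogeneous_mul_ne_zero (homBasis_mem α) (homBasis_ne_zero hα.1) (homBasis_mem β)
      (homBasis_ne_zero hβ.1))
    (mul_mem (H.mem_center_of_agree hα (homBasis_mem α))
      (H.mem_center_of_agree hβ (homBasis_mem β)))

/-- The inverse of an ε-central homogeneous element is ε-central: multiply the commutation relation
of e_α with e_β by e_α⁻¹ on both sides. The inverse is a nonzero multiple of the basis element of
degree -α, so the relation passes to the latter. -/
theorem agree_neg {α : Γ} (hα : α ∈ agree ε 𝒜) : -α ∈ agree ε 𝒜 := by
  classical
  refine ⟨H.supp_neg hα.1, fun β hβ => ?_⟩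
  have h1 := hα.2 β hβ
  have e1 := H.epsSigma_spec hα.1 hβ
  have hne := homBasis_ne_zero (H.supp_neg hα.1)
  have hz : homInv 𝒜 α * homBasis 𝒜 β = ε.val (-α) β • (homBasis 𝒜 β * homInv 𝒜 α) := by
    have h2 : ε.val (-α) β * ε.val α β = 1 := by
      rw [← ε.val_add_left, neg_add_cancel, ε.val_zero_left]
    rw [← h1] at e1
    have e2 := congrArg (fun x => ε.val (-α) β • (homInv 𝒜 α * x * homInv 𝒜 α)) e1
    simp only [← mul_assoc, H.homInv_mul hα.1, one_mul, mul_smul_comm, smul_mul_assoc, smul_smul,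
      h2, one_smul] at e2
    rw [mul_assoc (homInv 𝒜 α * _), H.mul_homInv hα.1, mul_one] at e2
    exact e2.symm
  obtain ⟨c, hc⟩ := H.eq_smul (H.homInv_mem α)
  have hc0 : c ≠ 0 := fun h0 => by
    rw [h0, zero_smul] at hc
    have := H.homInv_mul hα.1
    rw [hc, zero_mul] at this
    exact homBasis_ne_zero hα.1 (by rw [← one_mul (homBasis 𝒜 α), ← this, zero_mul])
  rw [hc, smul_mul_assoc, mul_smul_comm, smul_comm] at hz
  have hz := smul_right_injective A hc0 hz
  rw [H.epsSigma_spec (H.supp_neg hα.1) hβ] at hz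
  exact (smul_left_injective ℂ (H.homogeneous_mul_ne_zero (homBasis_mem β) (homBasis_ne_zero hβ)
      (homBasis_mem _) hne) hz).symm

theorem agree_sub {α β : Γ} (hα : α ∈ agree ε 𝒜) (hβ : β ∈ agree ε 𝒜) :
    α - β ∈ agree ε 𝒜 := by
  rw [sub_eq_add_neg]; exact H.agree_add hα (H.agree_neg hβ)

end IsFineDivision

/-! ### The projection to the `ε`-center -/

variable (ε 𝒜) in
/-- The projection to the sum of the homogeneous components whose degree is in `agree`. -/
def projZ : A →ₗ[ℂ] A :=
  open Classical in
  (DirectSum.toModule ℂ Γ A fun α => if α ∈ agree ε 𝒜 then (𝒜 α).subtype else 0) ∘ₗ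
    (DirectSum.decomposeLinearEquiv 𝒜).toLinearMap

theorem projZ_of_mem {α : Γ} {a : A} (ha : a ∈ 𝒜 α) :
    projZ ε 𝒜 a = open Classical in if α ∈ agree ε 𝒜 then a else 0 := by
  rw [projZ, LinearMap.comp_apply, LinearEquiv.coe_coe, DirectSum.decomposeLinearEquiv_apply,
    DirectSum.decompose_of_mem 𝒜 ha, ← DirectSum.lof_eq_of ℂ, DirectSum.toModule_lof]
  split_ifs <;> rfl

theorem projZ_of_agree {α : Γ} {a : A} (ha : a ∈ 𝒜 α) (hα : α ∈ agree ε 𝒜) :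
    projZ ε 𝒜 a = a := by rw [projZ_of_mem ha, if_pos hα]

theorem projZ_of_not_agree {α : Γ} {a : A} (ha : a ∈ 𝒜 α) (hα : α ∉ agree ε 𝒜) :
    projZ ε 𝒜 a = 0 := by rw [projZ_of_mem ha, if_neg hα]

theorem projZ_mem {α : Γ} {a : A} (ha : a ∈ 𝒜 α) : projZ ε 𝒜 a ∈ 𝒜 α := by
  rw [projZ_of_mem ha]
  split_ifs
  exacts [ha, zero_mem _]

theorem projZ_complI {x : A} (hx : x ∈ complI ε 𝒜) : projZ ε 𝒜 x = 0 := by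
  have : complI ε 𝒜 ≤ LinearMap.ker (projZ ε 𝒜) :=
    iSup₂_le fun α hα x hx => projZ_of_not_agree hx hα
  exact this hx

theorem twistLin_decompose (β γ : Γ) (a : A) :
    (DirectSum.decompose 𝒜 (twistLin ε 𝒜 β a) γ : A)
      = ε.val γ β • (DirectSum.decompose 𝒜 a γ : A) := by
  induction a using DirectSum.Decomposition.inductionOn 𝒜 with
  | zero => simp
  | @homogeneous i m =>
    rw [twistLin_of_mem ε m.2, DirectSum.decompose_smul, DirectSum.smul_apply,
      DirectSum.decompose_coe, DirectSum.of_apply]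
    split_ifs with h
    · subst h; rfl
    · simp
  | add a b ha hb => simp [ha, hb]

/-- The `ε`-center is spanned by its homogeneous elements. -/
theorem decompose_mem_center {z : A} (hz : z ∈ center ε 𝒜) (γ : Γ) :
    (DirectSum.decompose 𝒜 z γ : A) ∈ center ε 𝒜 := by
  refine (bracket_eq_zero_iff ε 𝒜 _).2 fun β b hb => ?_
  have h := (bracket_eq_zero_iff ε 𝒜 z).1 hz β b hb
  -- The two sides of z b = b · twist(z) are compared in degree γ + β.
  have h1 := DirectSum.coe_decompose_mul_add_of_right_mem 𝒜 hb (a := z) (i := γ)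
  have h2 := DirectSum.coe_decompose_mul_add_of_left_mem 𝒜 hb (b := twist ε 𝒜 β z) (j := γ)
  rw [← h1, h, add_comm, h2]
  change b * (DirectSum.decompose 𝒜 (twistLin ε 𝒜 β z) γ : A) = b * twist ε 𝒜 β _
  rw [twistLin_decompose, twist_of_mem ε (SetLike.coe_mem _)]

theorem center_induction {p : ∀ z : A, z ∈ center ε 𝒜 → Prop} (h0 : p 0 (zero_mem _))
    (hadd : ∀ z w hz hw, p z hz → p w hw → p (z + w) (add_mem hz hw))
    (hom : ∀ β z hz, z ∈ 𝒜 β → p z hz) {z : A} (hz : z ∈ center ε 𝒜) : p z hz := by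
  classical
  suffices h : ∃ h, p z h from h.2
  rw [← DirectSum.sum_support_decompose 𝒜 z]
  refine Finset.sum_induction _ (fun z => ∃ h, p z h)
    (fun a b ⟨h1, h2⟩ ⟨h3, h4⟩ => ⟨_, hadd a b h1 h3 h2 h4⟩) ⟨_, h0⟩ fun i _ =>
    ⟨_, hom i _ (decompose_mem_center hz i) (SetLike.coe_mem _)⟩

namespace IsFineDivision

variable (H : IsFineDivision 𝒜)
include H

theorem projZ_mem_center (a : A) : projZ ε 𝒜 a ∈ center ε 𝒜 := by
  induction a using DirectSum.Decomposition.inductionOn 𝒜 with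
  | zero => rw [map_zero]; exact zero_mem _
  | @homogeneous i m =>
    rw [projZ_of_mem m.2]
    split_ifs with h
    · exact H.mem_center_of_agree h m.2
    · exact zero_mem _
  | add a b ha hb => rw [map_add]; exact add_mem ha hb

theorem projZ_center {z : A} (hz : z ∈ center ε 𝒜) : projZ ε 𝒜 z = z := by
  induction hz using center_induction with
  | h0 => rw [map_zero]
  | hadd z w hz hw h1 h2 => rw [map_add, h1, h2]
  | hom β z hz hβ =>
    by_cases h : z = 0
    · rw [h, map_zero]
    · exact projZ_of_agree hβ (H.agree_of_mem_center hβ h hz)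

/-- As `agree` is a subgroup, multiplication by a central homogeneous element preserves both `agree`
and its complement. This right Z-linearity is what puts `dualBasis` into the dual over Z. -/
theorem projZ_mul (a : A) {z : A} (hz : z ∈ center ε 𝒜) :
    projZ ε 𝒜 (a * z) = projZ ε 𝒜 a * z := by
  induction hz using center_induction with
  | h0 => simp
  | hadd z w _ _ h1 h2 => rw [mul_add, map_add, h1, h2, mul_add]
  | hom β z hz hβ =>
    by_cases h : z = 0
    · simp [h]
    have hβ' := H.agree_of_mem_center hβ h hz
    induction a using DirectSum.Decomposition.inductionOn 𝒜 with
    | zero => simp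
    | @homogeneous i m =>
      by_cases hi : i ∈ agree ε 𝒜
      · rw [projZ_of_agree m.2 hi,
          projZ_of_agree (SetLike.GradedMul.mul_mem m.2 hβ) (H.agree_add hi hβ')]
      · rw [projZ_of_not_agree m.2 hi, zero_mul,
          projZ_of_not_agree (SetLike.GradedMul.mul_mem m.2 hβ) fun h' => hi ?_]
        have := H.agree_sub h' hβ'
        rwa [add_sub_cancel_right] at this
    | add a b ha hb => rw [add_mul, map_add, ha, hb, map_add, add_mul]

theorem complI_center {x : A} (hx : x ∈ complI ε 𝒜) (hz : x ∈ center ε 𝒜) : x = 0 := by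
  rw [← H.projZ_center hz, projZ_complI hx]

/-- The complement of the `ε`-center is a submodule over it. -/
theorem complI_mul {x : A} (hx : x ∈ complI ε 𝒜) {z : A} (hz : z ∈ center ε 𝒜) :
    x * z ∈ complI ε 𝒜 := by
  induction hz using center_induction with
  | h0 => rw [mul_zero]; exact zero_mem _
  | hadd z w _ _ h1 h2 => rw [mul_add]; exact add_mem h1 h2
  | hom β z hz hβ =>
    by_cases h : z = 0
    · rw [h, mul_zero]; exact zero_mem _
    have hβ' := H.agree_of_mem_center hβ h hz
    have : complI ε 𝒜 ≤ (complI ε 𝒜).comap (LinearMap.mulRight ℂ z) := by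
      refine iSup₂_le fun α hα x hx => mem_complI (α := α + β) (fun h' => hα ?_)
        (SetLike.GradedMul.mul_mem hx hβ)
      have := H.agree_sub h' hβ'
      rwa [add_sub_cancel_right] at this
    exact this hx

/-! ### The basis of the complement and the dual basis -/

variable (ε) in
/-- The degrees in the support which are not in `agree`. -/
def nonAgree : Finset Γ :=
  (H.finite.subset (Set.sdiff_subset (t := agree ε 𝒜))).toFinset

theorem mem_nonAgree {α : Γ} : α ∈ H.nonAgree ε ↔ α ∈ Supp 𝒜 ∧ α ∉ agree ε 𝒜 := by
  simp [nonAgree]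

/-- No Z-basis of I is chosen: sums run over all degrees of I. Only the coset of β modulo `agree`
contributes, and each of its members contributes the same C, whence the factor |`agree`|. -/
theorem sum_nonAgree {N : Type*} [AddCommGroup N] [Module ℂ N] {β : Γ} (hβ : β ∈ H.nonAgree ε)
    (F : Γ → N) (C : N) (h1 : ∀ α ∈ H.nonAgree ε, β - α ∈ agree ε 𝒜 → F α = C)
    (h2 : ∀ α ∈ H.nonAgree ε, β - α ∉ agree ε 𝒜 → F α = 0) :
    ∑ α ∈ H.nonAgree ε, F α = ((agree ε 𝒜).ncard : ℂ) • C := by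
  classical
  have hfin : (agree ε 𝒜).Finite := H.finite.subset fun α h => h.1
  have : ∑ α ∈ H.nonAgree ε, F α
      = ∑ α ∈ (H.nonAgree ε).filter (fun α => β - α ∈ agree ε 𝒜), C := by
    rw [Finset.sum_filter]
    refine Finset.sum_congr rfl fun α hα => ?_
    split_ifs with h
    exacts [h1 α hα h, h2 α hα h]
  rw [this, Finset.sum_const, Set.ncard_eq_toFinset_card _ hfin, ← Nat.cast_smul_eq_nsmul ℂ]
  congr 2
  refine Finset.card_bij (fun α _ => β - α) (fun α hα => ?_) (fun a _ b _ h => ?_)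
    (fun ζ hζ => ?_)
  · simpa using (Finset.mem_filter.1 hα).2
  · exact sub_right_injective h
  · have hζ' : ζ ∈ agree ε 𝒜 := by simpa using hζ
    have hβ' := H.mem_nonAgree.1 hβ
    refine ⟨β - ζ, Finset.mem_filter.2 ⟨H.mem_nonAgree.2 ⟨H.supp_sub hβ'.1 hζ'.1, fun h => ?_⟩, ?_⟩,
      sub_sub_cancel _ _⟩
    · have := H.agree_add h hζ'
      rw [sub_add_cancel] at this
      exact hβ'.2 this
    · rwa [sub_sub_cancel]

theorem agree_ncard_ne_zero [Nontrivial A] : ((agree ε 𝒜).ncard : ℂ) ≠ 0 := by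
  have hfin : (agree ε 𝒜).Finite := H.finite.subset fun α h => h.1
  have : (agree ε 𝒜).Nonempty := ⟨0, H.agree_of_mem_center SetLike.GradedOne.one_mem one_ne_zero
    (one_mem _)⟩
  rw [Nat.cast_ne_zero]
  exact (Set.ncard_pos hfin).2 this |>.ne'

end IsFineDivision

variable (ε 𝒜) in
/-- The chosen homogeneous basis of `complI`, extended by zero. -/
def basisI (α : Γ) : complI ε 𝒜 :=
  open Classical in if h : α ∉ agree ε 𝒜 then ⟨homBasis 𝒜 α, mem_complI h (homBasis_mem α)⟩ else 0

theorem basisI_coe {α : Γ} (h : α ∉ agree ε 𝒜) : (basisI ε 𝒜 α : A) = homBasis 𝒜 α := by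
  rw [basisI, dif_pos h]

theorem basisI_mem (α : Γ) : (basisI ε 𝒜 α : A) ∈ 𝒜 α := by
  by_cases h : α ∈ agree ε 𝒜
  · rw [basisI, dif_neg (not_not.2 h)]
    exact zero_mem (𝒜 α)
  · rw [basisI_coe h]
    exact homBasis_mem α

namespace IsFineDivision

variable (H : IsFineDivision 𝒜)
include H

theorem complI_cases {α : Γ} (x : complI ε 𝒜) (hx : (x : A) ∈ 𝒜 α) :
    x = 0 ∨ α ∈ H.nonAgree ε ∧ ∃ c : ℂ, x = c • basisI ε 𝒜 α := by
  by_cases h : x = 0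
  · exact Or.inl h
  have h' : (x : A) ≠ 0 := fun h0 => h (Subtype.ext h0)
  have hα : α ∉ agree ε 𝒜 := fun hα => h' (H.complI_center x.2 (H.mem_center_of_agree hα hx))
  obtain ⟨c, hc⟩ := H.eq_smul hx
  refine Or.inr ⟨H.mem_nonAgree.2 ⟨mem_supp_of_ne hx h', hα⟩, c, Subtype.ext ?_⟩
  rw [hc, Submodule.coe_smul, basisI_coe hα]

theorem complI_ext_basis {N : Type*} [AddCommGroup N] [Module ℂ N] {f g : complI ε 𝒜 →ₗ[ℂ] N}
    (h : ∀ α ∈ H.nonAgree ε, f (basisI ε 𝒜 α) = g (basisI ε 𝒜 α)) : f = g := by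
  refine complI_ext ε 𝒜 fun α x hx => ?_
  obtain rfl | ⟨hα, c, rfl⟩ := H.complI_cases x hx
  · simp
  · rw [map_smul, map_smul, h α hα]

/-- The elements e_α with α in `nonAgree` form a basis of I. Contractions and Lie derivatives,
constructed for one homogeneous x at a time, are assembled through this into families linear in x.
-/
theorem exists_linearMap {N : Type*} [AddCommGroup N] [Module ℂ N] (F : Γ → N) :
    ∃ f : complI ε 𝒜 →ₗ[ℂ] N, ∀ α ∈ H.nonAgree ε, f (basisI ε 𝒜 α) = F α := by
  have hind : iSupIndep fun i : H.nonAgree ε => 𝒜 i :=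
    (DirectSum.Decomposition.isInternal 𝒜).submodule_iSupIndep.comp Subtype.val_injective
  have hli : LinearIndependent ℂ fun i : H.nonAgree ε => basisI ε 𝒜 i := by
    refine LinearIndependent.of_comp (complI ε 𝒜).subtype (hind.linearIndependent _
      (fun i => basisI_mem i.1) fun i => ?_)
    have hi := H.mem_nonAgree.1 i.2
    change (basisI ε 𝒜 i : A) ≠ 0
    rw [basisI_coe hi.2]
    exact homBasis_ne_zero hi.1
  have hsp : ⊤ ≤ Submodule.span ℂ (Set.range fun i : H.nonAgree ε => basisI ε 𝒜 i) := by
    -- The quotient map by the span kills every e_α, hence is zero.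
    have : (Submodule.span ℂ (Set.range fun i : H.nonAgree ε => basisI ε 𝒜 i)).mkQ = 0 :=
      H.complI_ext_basis fun α hα => (Submodule.Quotient.mk_eq_zero _).2
        (Submodule.subset_span ⟨⟨α, hα⟩, rfl⟩)
    rw [← Submodule.ker_mkQ (Submodule.span ℂ _), this, LinearMap.ker_zero]
  refine ⟨(Module.Basis.mk hli hsp).constr ℂ fun i => F i, fun α hα => ?_⟩
  have := (Module.Basis.mk hli hsp).constr_basis ℂ (fun i => F i) ⟨α, hα⟩
  rwa [Module.Basis.mk_apply] at this

variable (ε) in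
/-- The element of degree `-α` of the dual with value one at the basis element of degree `α`. -/
def dualBasis (α : Γ) : Dual ε 𝒜 :=
  ⟨projZ ε 𝒜 ∘ₗ LinearMap.mulLeft ℂ (homInv 𝒜 α) ∘ₗ (complI ε 𝒜).subtype,
    DualHom_le_Dual ε 𝒜 (-α) ⟨fun x => H.projZ_mem_center _, fun β x hx => by
      have := SetLike.GradedMul.mul_mem (H.homInv_mem α) hx
      rw [add_comm] at this
      exact projZ_mem this, fun x z hz h => by
      change projZ ε 𝒜 (homInv 𝒜 α * (x.1 * z)) = projZ ε 𝒜 (homInv 𝒜 α * x.1) * z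
      rw [← mul_assoc, H.projZ_mul _ hz]⟩⟩

theorem dualBasis_apply (α : Γ) (x : complI ε 𝒜) :
    (H.dualBasis ε α).1 x = projZ ε 𝒜 (homInv 𝒜 α * x) := rfl

theorem dualBasis_mem (α : Γ) : (H.dualBasis ε α).1 ∈ DualHom ε 𝒜 (-α) :=
  ⟨fun x => H.projZ_mem_center _, fun β x hx => by
      have := SetLike.GradedMul.mul_mem (H.homInv_mem α) hx
      rw [add_comm] at this
      exact projZ_mem this, fun x z hz h => by
      change projZ ε 𝒜 (homInv 𝒜 α * (x.1 * z)) = projZ ε 𝒜 (homInv 𝒜 α * x.1) * z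
      rw [← mul_assoc, H.projZ_mul _ hz]⟩

/-- Since e_β = e_α (e_α⁻¹ e_β), for β - α in `agree` the element e_β is the multiple of e_α by the
central element θ^α(e_β). Outside the coset of α the projection to Z makes θ^α vanish. So the θ^α
behave like a dual basis in which each coset is counted |`agree`| times. -/
theorem dualBasis_agree {α β : Γ} (hα : α ∈ H.nonAgree ε) (hβ : β ∈ H.nonAgree ε)
    (h : β - α ∈ agree ε 𝒜) :
    (H.dualBasis ε α).1 (basisI ε 𝒜 β) ∈ center ε 𝒜 ∧
      (basisI ε 𝒜 α : A) * (H.dualBasis ε α).1 (basisI ε 𝒜 β) = basisI ε 𝒜 β := by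
  have hα := H.mem_nonAgree.1 hα
  have hβ := H.mem_nonAgree.1 hβ
  refine ⟨H.projZ_mem_center _, ?_⟩
  have := SetLike.GradedMul.mul_mem (H.homInv_mem α) (homBasis_mem (𝒜 := 𝒜) β)
  rw [neg_add_eq_sub] at this
  rw [H.dualBasis_apply, basisI_coe hα.2, basisI_coe hβ.2, projZ_of_agree this h, ← mul_assoc,
    H.mul_homInv hα.1, one_mul]

theorem dualBasis_not_agree {α β : Γ} (h : β - α ∉ agree ε 𝒜) :
    (H.dualBasis ε α).1 (basisI ε 𝒜 β) = 0 := by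
  have := SetLike.GradedMul.mul_mem (H.homInv_mem α) (basisI_mem (ε := ε) (𝒜 := 𝒜) β)
  rw [neg_add_eq_sub] at this
  rw [H.dualBasis_apply, projZ_of_not_agree this h]

/-- The expansion of a right linear map in the dual basis. -/
theorem sum_dualBasis {w : complI ε 𝒜 →ₗ[ℂ] Omega ε 𝒜}
    (hw : ∀ {α γ : Γ} {x y : complI ε 𝒜} {z : A}, (x : A) ∈ 𝒜 α → z ∈ center ε 𝒜 → z ∈ 𝒜 γ →
      (y : A) = x * z → w y = w x * omegaInc ε 𝒜 z) {β : Γ} (hβ : β ∈ H.nonAgree ε) :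
    ∑ α ∈ H.nonAgree ε, w (basisI ε 𝒜 α) *
        omegaInc ε 𝒜 ((H.dualBasis ε α).1 (basisI ε 𝒜 β))
      = ((agree ε 𝒜).ncard : ℂ) • w (basisI ε 𝒜 β) := by
  refine H.sum_nonAgree hβ _ _ (fun α hα h => ?_) fun α hα h => ?_
  · obtain ⟨h1, h2⟩ := H.dualBasis_agree hα hβ h
    exact (hw (basisI_mem α) h1 ((H.dualBasis_mem α).2.1 β _ (basisI_mem β)) h2.symm).symm
  · rw [H.dualBasis_not_agree h, map_zero, mul_zero]

/-- At e_β, each α in the coset of β contributes θ(e_α) θ^α(e_β) = θ(e_α θ^α(e_β)) = θ(e_β) by right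
Z-linearity, and all other α contribute zero. -/
theorem sum_gen_dualBasis (θ : Dual ε 𝒜) :
    ∑ α ∈ H.nonAgree ε, omegaInc ε 𝒜 (θ.1 (basisI ε 𝒜 α)) * omegaGen ε 𝒜 (H.dualBasis ε α)
      = ((agree ε 𝒜).ncard : ℂ) • omegaGen ε 𝒜 θ := by
  induction θ using dual_induction with
  | h0 => simp
  | hadd θ η h1 h2 => simp [add_mul, Finset.sum_add_distrib, h1, h2]
  | hom γ θ hθ =>
    rw [Finset.sum_congr rfl fun α _ => omegaInc_mul_gen (hθ.1 _) (hθ.2.1 α _ (basisI_mem α))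
      (H.dualBasis_mem α), ← map_sum, ← map_smul]
    congr 1
    refine Subtype.ext (H.complI_ext_basis fun β hβ => ?_)
    rw [Submodule.coe_sum, LinearMap.sum_apply]
    refine H.sum_nonAgree hβ _ _ (fun α hα h => ?_) fun α hα h => ?_
    · obtain ⟨h1, h2⟩ := H.dualBasis_agree hα hβ h
      have h3 := hθ.2.2 (basisI ε 𝒜 α) _ h1 (H.complI_mul (Subtype.coe_prop _) h1)
      refine Eq.trans ?_ (h3.symm.trans (congrArg θ.1 (Subtype.ext h2)))
      rfl
    · change _ * (H.dualBasis ε α).1 _ = 0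
      rw [H.dualBasis_not_agree h, mul_zero]

/-! ### All `ε`-derivations are inner -/

/-- Averaging over the finite group of degrees S. Put y = Σ_β X(e_β) e_β⁻¹. The Leibniz rule for e_α
e_β gives X(e_{α+β}) e_{α+β}⁻¹ e_α = X(e_α) + ε(γ, α) e_α X(e_β) e_β⁻¹. Translation by α permutes S,
so summing over β yields y e_α = |S| X(e_α) + ε(γ, α) e_α y, that is, [y, e_α] = |S| X(e_α). The
required element is y / |S|. -/
theorem exists_ad [Nontrivial A] {γ : Γ} {X : A →ₗ[ℂ] A} (hX : X ∈ DerHom ε 𝒜 γ) :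
    ∃ x ∈ 𝒜 γ, epsBracket ε 𝒜 x = X := by
  set S : Finset Γ := H.finite.toFinset with hS
  have hS0 : (S.card : ℂ) ≠ 0 := by
    rw [Nat.cast_ne_zero, Finset.card_ne_zero]
    exact ⟨0, (Set.Finite.mem_toFinset _).2
      (mem_supp_of_ne SetLike.GradedOne.one_mem one_ne_zero)⟩
  set y : A := ∑ β ∈ S, X (homBasis 𝒜 β) * homInv 𝒜 β with hy
  have hym : y ∈ 𝒜 γ := sum_mem fun β _ => by
    have := SetLike.GradedMul.mul_mem (hX.1 β _ (homBasis_mem β)) (H.homInv_mem β)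
    rwa [add_neg_cancel_comm] at this
  have key : ∀ α ∈ Supp 𝒜, epsBracket ε 𝒜 y (homBasis 𝒜 α) = (S.card : ℂ) • X (homBasis 𝒜 α) := by
    intro α hα
    have h1 : ∀ β ∈ S, X (homBasis 𝒜 (α + β)) * homInv 𝒜 (α + β) * homBasis 𝒜 α
        = X (homBasis 𝒜 α) + ε.val γ α • (homBasis 𝒜 α * (X (homBasis 𝒜 β) * homInv 𝒜 β)) := by
      intro β hβ
      have hβ := (Set.Finite.mem_toFinset _).1 hβ
      have e1 := hX.2 α _ (homBasis_mem α) (homBasis 𝒜 β)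
      rw [H.factorSet_spec, map_smul] at e1
      have e2 : homBasis 𝒜 α = factorSet 𝒜 α β • (homBasis 𝒜 (α + β) * homInv 𝒜 β) := by
        rw [← smul_mul_assoc, ← H.factorSet_spec, mul_assoc, H.mul_homInv hβ, mul_one]
      -- Only the left side is rewritten, so that e_{α+β}⁻¹ cancels there while the occurrences of
      -- e_α on the right stay.
      conv_lhs => rw [e2]
      rw [mul_smul_comm, mul_assoc, ← mul_assoc (homInv 𝒜 (α + β)),
        H.homInv_mul (H.supp_add hα hβ), one_mul, ← smul_mul_assoc, e1, add_mul, mul_assoc,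
        H.mul_homInv hβ, mul_one, smul_mul_assoc, mul_assoc]
    have h2 := Finset.sum_congr rfl h1
    rw [← Finset.sum_mul, Finset.sum_add_distrib, Finset.sum_const, ← Finset.smul_sum,
      ← Finset.mul_sum, ← hy, ← Nat.cast_smul_eq_nsmul ℂ] at h2
    have h3 : ∑ β ∈ S, X (homBasis 𝒜 (α + β)) * homInv 𝒜 (α + β) = y := by
      refine Finset.sum_bij (fun β _ => α + β) (fun β hβ => ?_) (fun a _ b _ h => ?_)
        (fun β hβ => ?_) (fun β _ => rfl)
      · exact (Set.Finite.mem_toFinset _).2 (H.supp_add hα ((Set.Finite.mem_toFinset _).1 hβ))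
      · exact add_left_cancel h
      · exact ⟨β - α, (Set.Finite.mem_toFinset _).2
          (H.supp_sub ((Set.Finite.mem_toFinset _).1 hβ) hα), add_sub_cancel _ _⟩
    rw [h3] at h2
    rw [epsBracket_of_mem ε hym (homBasis_mem α), h2, add_sub_cancel_right]
  refine ⟨(S.card : ℂ)⁻¹ • y, Submodule.smul_mem _ _ hym, lin_ext 𝒜 fun α a ha => ?_⟩
  by_cases h : a = 0
  · rw [h, map_zero, map_zero]
  have hα := mem_supp_of_ne ha h
  obtain ⟨c, rfl⟩ := H.eq_smul ha
  rw [map_smul, map_smul, map_smul, LinearMap.smul_apply, key α hα, smul_smul _ (S.card : ℂ),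
    inv_mul_cancel₀ hS0, one_smul]

theorem exists_adI {γ : Γ} {X : Der ε 𝒜} (hX : X.1 ∈ DerHom ε 𝒜 γ) :
    ∃ x : complI ε 𝒜, (x : A) ∈ 𝒜 γ ∧ adI ε 𝒜 x = X := by
  rcases subsingleton_or_nontrivial A with hA | hA
  · exact ⟨0, zero_mem _, Subtype.ext (LinearMap.ext fun a => Subsingleton.elim _ _)⟩
  obtain ⟨x, hx, h⟩ := H.exists_ad hX
  by_cases hγ : γ ∈ agree ε 𝒜
  -- In a degree of Z the element x is central, so X = ad_x = 0 and 0 represents it in I.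
  · refine ⟨0, zero_mem _, Subtype.ext ?_⟩
    rw [map_zero, ← h]
    ext b
    exact (H.mem_center_of_agree hγ hx b).symm
  · exact ⟨⟨x, mem_complI hγ hx⟩, hx, Subtype.ext h⟩

/-- The kernel of ad is Z, which meets I only in 0; surjectivity is innerness of the homogeneous
derivations together with their spanning. -/
theorem adI_bijective : Function.Bijective (adI ε 𝒜) := by
  constructor
  · refine (injective_iff_map_eq_zero _).2 fun x hx => Subtype.ext (H.complI_center x.2 fun b => ?_)
    exact congrArg (fun f : Der ε 𝒜 => f.1 b) hx
  · have : Der ε 𝒜 ≤ (LinearMap.range (adI ε 𝒜)).map (Der ε 𝒜).subtype :=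
      iSup_le fun γ X hX => by
        obtain ⟨x, _, h⟩ := H.exists_adI (X := ⟨X, DerHom_le_Der ε 𝒜 γ hX⟩) hX
        exact ⟨_, ⟨x, rfl⟩, congrArg Subtype.val h⟩
    intro X
    obtain ⟨_, ⟨x, rfl⟩, h⟩ := this X.2
    exact ⟨x, Subtype.ext h⟩

variable (ε) in
/-- The adjoint map as an isomorphism from `complI` to the space of `ε`-derivations. -/
def adEquiv : complI ε 𝒜 ≃ₗ[ℂ] Der ε 𝒜 := LinearEquiv.ofBijective (adI ε 𝒜) H.adI_bijective

theorem adEquiv_apply (x : complI ε 𝒜) : H.adEquiv ε x = adI ε 𝒜 x := rfl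

theorem adEquiv_symm_mem {γ : Γ} {X : Der ε 𝒜} (hX : X.1 ∈ DerHom ε 𝒜 γ) :
    (((H.adEquiv ε).symm X : complI ε 𝒜) : A) ∈ 𝒜 γ := by
  obtain ⟨x, hx, rfl⟩ := H.exists_adI hX
  rw [← H.adEquiv_apply, LinearEquiv.symm_apply_apply]
  exact hx

end IsFineDivision

theorem adI_mem {γ : Γ} {x : complI ε 𝒜} (hx : (x : A) ∈ 𝒜 γ) :
    (adI ε 𝒜 x).1 ∈ DerHom ε 𝒜 γ := ad_mem_DerHom hx

end FineDivision

end EpsGraded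

end

/-! ### Contractions, the Euler operator and integration of contractions. -/

noncomputable section

namespace EpsGraded

section Contraction

set_option linter.unusedSectionVars false

variable {Γ : Type*} [AddCommGroup Γ] [DecidableEq Γ] {A : Type*} [Ring A] [Algebra ℂ A]
variable {ε : CommFactor Γ} {𝒜 : Γ → Submodule ℂ A} [GradedAlgebra 𝒜]

/-! ### Contractions -/

/-- The interior product: i_x(u v) = (-1)^p u i_x(v) + ε(|v|, |x|) i_x(u) v, with i_x zero on A and
i_x θ = θ(x). It respects the relations of T because θ(x) is central and θ is homogeneous. -/
theorem exists_contr {α : Γ} (x : complI ε 𝒜) (hx : (x : A) ∈ 𝒜 α) :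
    ∃ δ : Omega ε 𝒜 →ₗ[ℂ] Omega ε 𝒜, IsSkewDer (omegaSign ε 𝒜) (omegaTwist ε 𝒜 α) δ ∧
      (∀ a, δ (omegaInc ε 𝒜 a) = 0) ∧
      ∀ θ, δ (omegaGen ε 𝒜 θ) = omegaInc ε 𝒜 (θ.1 x) := by
  let δD : Dual ε 𝒜 →ₗ[ℂ] Omega ε 𝒜 :=
    (omegaInc ε 𝒜).toLinearMap ∘ₗ LinearMap.applyₗ x ∘ₗ (Dual ε 𝒜).subtype
  have hδD : ∀ θ, δD θ = omegaInc ε 𝒜 (θ.1 x) := fun _ => rfl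
  refine exists_skewDer 0 δD (fun a b => by simp) (fun {γ θ} hθ {β a} ha => ?_)
    (fun {β z} hz hzβ {γ θ} hθ => ?_) (fun {γ θ} hθ {δ η} hη => ?_)
  · rw [LinearMap.zero_apply, mul_zero, zero_add, zero_mul, add_zero, omegaSign_inc,
      omegaTwist_inc ha, hδD, mul_smul_comm, ← map_mul, ← map_mul,
      center_comm (hθ.1 x) (hθ.2.1 α x hx) ha, map_smul, smul_smul, ε.val_add_left]
    congr 1
    linear_combination ε.val γ β * ε.val_mul_swap β α
  · rw [LinearMap.zero_apply, zero_mul, add_zero, omegaSign_inc, hδD, hδD, ← map_mul]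
    rfl
  · rw [hδD, hδD, omegaSign_gen, omegaSign_gen, omegaTwist_gen hη, omegaTwist_gen hθ, neg_mul,
      neg_mul, omegaGen_mul_inc (hη.2.1 α x hx) hθ, omegaGen_mul_inc (hθ.2.1 α x hx) hη,
      mul_smul_comm, mul_smul_comm, ε.val_add_right, ε.val_add_right]
    match_scalars
    · ring
    · linear_combination -ε.val δ α * ε.val_mul_swap γ δ

namespace IsFineDivision

variable (H : IsFineDivision 𝒜)

variable (ε) in
/-- The contractions of `Omega` by elements of `complI`. -/
def contr : complI ε 𝒜 →ₗ[ℂ] Omega ε 𝒜 →ₗ[ℂ] Omega ε 𝒜 :=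
  (H.exists_linearMap fun α => (exists_contr (basisI ε 𝒜 α) (basisI_mem α)).choose).choose

theorem contr_basis {α : Γ} (hα : α ∈ H.nonAgree ε) :
    H.contr ε (basisI ε 𝒜 α) = (exists_contr (basisI ε 𝒜 α) (basisI_mem α)).choose :=
  (H.exists_linearMap fun α =>
    (exists_contr (basisI ε 𝒜 α) (basisI_mem α)).choose).choose_spec α hα

theorem contr_skewDer {α : Γ} {x : complI ε 𝒜} (hx : (x : A) ∈ 𝒜 α) :
    IsSkewDer (omegaSign ε 𝒜) (omegaTwist ε 𝒜 α) (H.contr ε x) := by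
  obtain rfl | ⟨hα, c, rfl⟩ := H.complI_cases x hx
  · intro u v; simp
  · intro u v
    have := (exists_contr (basisI ε 𝒜 α) (basisI_mem α)).choose_spec.1 u v
    rw [← H.contr_basis hα] at this
    rw [map_smul, LinearMap.smul_apply, this, smul_add, LinearMap.smul_apply, LinearMap.smul_apply,
      mul_smul_comm, smul_mul_assoc]

theorem contr_mul {α : Γ} {x : complI ε 𝒜} (hx : (x : A) ∈ 𝒜 α) (u v : Omega ε 𝒜) :
    H.contr ε x (u * v)
      = omegaSign ε 𝒜 u * H.contr ε x v + H.contr ε x u * omegaTwist ε 𝒜 α v :=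
  H.contr_skewDer hx u v

theorem contr_inc (x : complI ε 𝒜) (a : A) : H.contr ε x (omegaInc ε 𝒜 a) = 0 := by
  have : (H.contr ε).flip (omegaInc ε 𝒜 a) = 0 := H.complI_ext_basis fun α hα => by
    rw [LinearMap.flip_apply, H.contr_basis hα]
    exact (exists_contr (basisI ε 𝒜 α) (basisI_mem α)).choose_spec.2.1 a
  exact congrArg (fun f => f x) this

theorem contr_gen (x : complI ε 𝒜) (θ : Dual ε 𝒜) :
    H.contr ε x (omegaGen ε 𝒜 θ) = omegaInc ε 𝒜 (θ.1 x) := by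
  have : (H.contr ε).flip (omegaGen ε 𝒜 θ) = (omegaInc ε 𝒜).toLinearMap ∘ₗ θ.1 :=
    H.complI_ext_basis fun α hα => by
      rw [LinearMap.flip_apply, H.contr_basis hα]
      exact (exists_contr (basisI ε 𝒜 α) (basisI_mem α)).choose_spec.2.2 θ
  exact congrArg (fun f => f x) this

theorem contr_zero_mem {k : Γ} {u : Omega ε 𝒜} (hu : u ∈ OmegaHom ε 𝒜 0 k) (x : complI ε 𝒜) :
    H.contr ε x u = 0 := by
  obtain ⟨a, _, rfl⟩ := omegaHom_zero hu
  exact H.contr_inc x a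

theorem contr_mul_gen {n : ℕ} {k α γ : Γ} {u : Omega ε 𝒜} (hu : u ∈ OmegaHom ε 𝒜 n k)
    {x : complI ε 𝒜} (hx : (x : A) ∈ 𝒜 α) {θ : Dual ε 𝒜} (hθ : θ.1 ∈ DualHom ε 𝒜 γ) :
    H.contr ε x (u * omegaGen ε 𝒜 θ) = (-1 : ℂ) ^ n • (u * omegaInc ε 𝒜 (θ.1 x))
      + ε.val γ α • (H.contr ε x u * omegaGen ε 𝒜 θ) := by
  rw [H.contr_mul hx, omegaSign_of_mem hu, H.contr_gen, omegaTwist_gen hθ, smul_mul_assoc,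
    mul_smul_comm]

theorem contr_mem {n : ℕ} {k α : Γ} {u : Omega ε 𝒜} (hu : u ∈ OmegaHom ε 𝒜 (n + 1) k)
    {x : complI ε 𝒜} (hx : (x : A) ∈ 𝒜 α) : H.contr ε x u ∈ OmegaHom ε 𝒜 n (k + α) := by
  have := omegaHom_le (fun n k =>
    (if n = 0 then ⊥ else OmegaHom ε 𝒜 (n - 1) (k + α)).comap (H.contr ε x))
    (fun k a _ => ?_) (fun n k u hu' hu γ θ hθ => ?_) (n + 1) k hu
  · simpa using this
  · rw [Submodule.mem_comap, H.contr_inc]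
    exact zero_mem _
  · rw [Submodule.mem_comap] at hu ⊢
    rw [if_neg n.succ_ne_zero, H.contr_mul_gen hu' hx hθ, Nat.succ_sub_one]
    refine add_mem (Submodule.smul_mem _ _ ?_) (Submodule.smul_mem _ _ ?_)
    · have := mul_omegaInc_mem hu' (hθ.2.1 α x hx)
      rwa [show k + (α + γ) = k + γ + α by abel] at this
    · cases n with
      | zero => rw [if_pos rfl, Submodule.mem_bot] at hu; rw [hu, zero_mul]; exact zero_mem _
      | succ n =>
        rw [if_neg n.succ_ne_zero, Nat.succ_sub_one] at hu
        have := mul_omegaGen_mem hu hθ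
        rwa [add_right_comm] at this

theorem contr_sign (x : complI ε 𝒜) (u : Omega ε 𝒜) :
    H.contr ε x (omegaSign ε 𝒜 u) = -omegaSign ε 𝒜 (H.contr ε x u) := by
  have : (H.contr ε).compl₂ (omegaSign ε 𝒜).toLinearMap
      = -(H.contr ε).compr₂ (omegaSign ε 𝒜).toLinearMap := by
    refine complI_ext ε 𝒜 fun α x hx => omega_lin_ext fun n k u hu => ?_
    change H.contr ε x (omegaSign ε 𝒜 u) = -omegaSign ε 𝒜 (H.contr ε x u)
    cases n with
    | zero =>
      rw [omegaSign_of_mem hu, map_smul, H.contr_zero_mem hu, smul_zero, map_zero, neg_zero]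
    | succ n =>
      rw [omegaSign_of_mem hu, map_smul, omegaSign_of_mem (H.contr_mem hu hx), pow_succ,
        mul_neg_one, neg_smul]
  exact congrArg (fun f => f x u) this

theorem contr_twist {α : Γ} {x : complI ε 𝒜} (hx : (x : A) ∈ 𝒜 α) (β : Γ) (u : Omega ε 𝒜) :
    H.contr ε x (omegaTwist ε 𝒜 β u) = ε.val β α • omegaTwist ε 𝒜 β (H.contr ε x u) := by
  have : H.contr ε x ∘ₗ (omegaTwist ε 𝒜 β).toLinearMap
      = ε.val β α • ((omegaTwist ε 𝒜 β).toLinearMap ∘ₗ H.contr ε x) := by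
    refine omega_lin_ext fun n k u hu => ?_
    change H.contr ε x (omegaTwist ε 𝒜 β u) = ε.val β α • omegaTwist ε 𝒜 β (H.contr ε x u)
    cases n with
    | zero =>
      rw [omegaTwist_of_mem hu, map_smul, H.contr_zero_mem hu, smul_zero, map_zero, smul_zero]
    | succ n =>
      rw [omegaTwist_of_mem hu, map_smul, omegaTwist_of_mem (H.contr_mem hu hx), smul_smul,
        ε.val_add_left]
      congr 1
      linear_combination -ε.val k β * ε.val_mul_swap α β
  exact congrArg (fun f => f u) this

end IsFineDivision

theorem omegaTwist_comm (α β : Γ) (u : Omega ε 𝒜) :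
    omegaTwist ε 𝒜 α (omegaTwist ε 𝒜 β u) = omegaTwist ε 𝒜 β (omegaTwist ε 𝒜 α u) := by
  have : (omegaTwist ε 𝒜 α).toLinearMap ∘ₗ (omegaTwist ε 𝒜 β).toLinearMap
      = (omegaTwist ε 𝒜 β).toLinearMap ∘ₗ (omegaTwist ε 𝒜 α).toLinearMap :=
    omega_lin_ext fun n k u hu => by
      change omegaTwist ε 𝒜 α (omegaTwist ε 𝒜 β u) = omegaTwist ε 𝒜 β (omegaTwist ε 𝒜 α u)
      rw [omegaTwist_of_mem hu, omegaTwist_of_mem hu, map_smul, map_smul, omegaTwist_of_mem hu,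
        omegaTwist_of_mem hu, smul_comm]
  exact congrArg (fun f => f u) this

theorem omegaTwist_add (α β : Γ) (u : Omega ε 𝒜) :
    omegaTwist ε 𝒜 (α + β) u = omegaTwist ε 𝒜 α (omegaTwist ε 𝒜 β u) := by
  have : (omegaTwist ε 𝒜 (α + β)).toLinearMap
      = (omegaTwist ε 𝒜 α).toLinearMap ∘ₗ (omegaTwist ε 𝒜 β).toLinearMap :=
    omega_lin_ext fun n k u hu => by
      change omegaTwist ε 𝒜 (α + β) u = omegaTwist ε 𝒜 α (omegaTwist ε 𝒜 β u)
      rw [omegaTwist_of_mem hu, omegaTwist_of_mem hu, map_smul, omegaTwist_of_mem hu,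
        ε.val_add_right, smul_smul, mul_comm]
  exact congrArg (fun f => f u) this

theorem omegaSign_sign (u : Omega ε 𝒜) : omegaSign ε 𝒜 (omegaSign ε 𝒜 u) = u := by
  have : (omegaSign ε 𝒜).toLinearMap ∘ₗ (omegaSign ε 𝒜).toLinearMap = LinearMap.id :=
    omega_lin_ext fun n k u hu => by
      change omegaSign ε 𝒜 (omegaSign ε 𝒜 u) = u
      rw [omegaSign_of_mem hu, map_smul, omegaSign_of_mem hu, smul_smul, ← mul_pow, neg_one_mul,
        neg_neg, one_pow, one_smul]
  exact congrArg (fun f => f u) this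

/-- Elements of the `ε`-center `ε`-commute with everything. -/
theorem mul_omegaInc_center {β : Γ} {z : A} (hz : z ∈ center ε 𝒜) (hzβ : z ∈ 𝒜 β)
    (u : Omega ε 𝒜) : u * omegaInc ε 𝒜 z = omegaInc ε 𝒜 z * omegaTwist ε 𝒜 β u := by
  refine omega_subalgebra
    { carrier := {u | u * omegaInc ε 𝒜 z = omegaInc ε 𝒜 z * omegaTwist ε 𝒜 β u}
      mul_mem' := fun {a b} ha hb => by
        change _ * _ = _ * _ at ha hb
        change _ * _ = _ * _
        rw [map_mul, mul_assoc, hb, ← mul_assoc, ha, mul_assoc]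
      add_mem' := fun {a b} ha hb => by
        change _ * _ = _ * _ at ha hb
        change _ * _ = _ * _
        rw [map_add, add_mul, ha, hb, mul_add]
      algebraMap_mem' := fun r => by
        change _ * _ = _ * _
        rw [AlgHom.commutes, Algebra.commutes] }
    (fun α a ha => ?_) (fun δ η hη => ?_) u
  · change _ * _ = _ * _
    rw [omegaTwist_inc ha, mul_smul_comm, ← map_mul, ← map_mul, center_comm hz hzβ ha, map_smul,
      smul_smul, ε.val_mul_swap, one_smul]
  · change _ * _ = _ * _
    rw [omegaTwist_gen hη, mul_smul_comm, omegaGen_mul_inc hzβ hη]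

namespace IsFineDivision

variable (H : IsFineDivision 𝒜)

/-- Contractions `ε`-anticommute. -/
theorem contr_contr {α β : Γ} {x y : complI ε 𝒜} (hx : (x : A) ∈ 𝒜 α) (hy : (y : A) ∈ 𝒜 β)
    (u : Omega ε 𝒜) :
    H.contr ε x (H.contr ε y u) = -(ε.val β α • H.contr ε y (H.contr ε x u)) := by
  have h : H.contr ε x ∘ₗ H.contr ε y + ε.val β α • (H.contr ε y ∘ₗ H.contr ε x) = 0 := by
    -- In the ε-anticommutator of two contractions the mixed terms of the Leibniz rule cancel,
    -- leaving a skew derivation for the identity and the product of the two twists. It vanishes on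
    -- generators.
    refine IsSkewDer.eq_zero (s := AlgHom.id ℂ _)
      (t := (omegaTwist ε 𝒜 α).comp (omegaTwist ε 𝒜 β)) (fun u v => ?_) (fun γ a _ => ?_)
      (fun γ θ _ => ?_)
    · simp only [LinearMap.add_apply, LinearMap.smul_apply, LinearMap.comp_apply, H.contr_mul hx,
        H.contr_mul hy, map_add, H.contr_sign, H.contr_twist hx, H.contr_twist hy, omegaSign_sign,
        AlgHom.id_apply, AlgHom.comp_apply, omegaTwist_comm β α, smul_add, mul_add, add_mul,
        mul_smul_comm, smul_mul_assoc, smul_smul, neg_mul, smul_neg, ε.val_mul_swap, one_smul]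
      abel
    · simp [H.contr_inc]
    · simp [H.contr_inc, H.contr_gen]
  exact eq_neg_of_add_eq_zero_left (congrArg (fun f => f u) h)

/-- The difference of the two sides is again a skew derivation, because central elements can be
moved past twist(v) at the cost of a further twist. On generators it vanishes by the right
Z-linearity of θ. -/
theorem contr_mul_center {α β : Γ} {x y : complI ε 𝒜} {z : A} (hx : (x : A) ∈ 𝒜 α)
    (hz : z ∈ center ε 𝒜) (hzβ : z ∈ 𝒜 β) (h : (y : A) = x * z) (u : Omega ε 𝒜) :
    H.contr ε y u = H.contr ε x u * omegaInc ε 𝒜 z := by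
  have hy : (y : A) ∈ 𝒜 (α + β) := h ▸ SetLike.GradedMul.mul_mem hx hzβ
  have h : H.contr ε y - LinearMap.mulRight ℂ (omegaInc ε 𝒜 z) ∘ₗ H.contr ε x = 0 := by
    refine IsSkewDer.eq_zero (s := omegaSign ε 𝒜) (t := omegaTwist ε 𝒜 (α + β)) (fun u v => ?_)
      (fun γ a _ => ?_) (fun γ θ hθ => ?_)
    · simp only [LinearMap.sub_apply, LinearMap.comp_apply, LinearMap.mulRight_apply,
        H.contr_mul hx, H.contr_mul hy, add_mul, mul_assoc, mul_sub, sub_mul,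
        mul_omegaInc_center hz hzβ (omegaTwist ε 𝒜 α v)]
      rw [add_comm α β, omegaTwist_add]
      abel
    · simp [H.contr_inc]
    · have : θ.1 y = θ.1 x * z := by
        rw [← hθ.2.2 x z hz (h ▸ y.2)]
        exact congrArg θ.1 (Subtype.ext h)
      simp [H.contr_gen, this]
  exact sub_eq_zero.1 (congrArg (fun f => f u) h)

/-! ### The Euler operator -/

variable (ε) in
/-- The Euler operator, which is, up to scalars depending on the exterior degree, the identity. -/
def euler : Omega ε 𝒜 →ₗ[ℂ] Omega ε 𝒜 :=
  ∑ α ∈ H.nonAgree ε, LinearMap.mulRight ℂ (omegaGen ε 𝒜 (H.dualBasis ε α)) ∘ₗ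
    H.contr ε (basisI ε 𝒜 α)

theorem euler_apply (u : Omega ε 𝒜) :
    H.euler ε u = ∑ α ∈ H.nonAgree ε,
      H.contr ε (basisI ε 𝒜 α) u * omegaGen ε 𝒜 (H.dualBasis ε α) := by
  simp [euler, LinearMap.sum_apply]

/-- In the term i_{e_α}(u) · twist_α(v) · θ^α the generator θ^α has degree -α. Moving it to the left
of v undoes the twist and leaves only the sign automorphism, so the rule no longer depends on α. -/
theorem euler_mul (u v : Omega ε 𝒜) :
    H.euler ε (u * v) = omegaSign ε 𝒜 u * H.euler ε v + H.euler ε u * omegaSign ε 𝒜 v := by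
  simp only [H.euler_apply, Finset.mul_sum, Finset.sum_mul, ← Finset.sum_add_distrib]
  refine Finset.sum_congr rfl fun α _ => ?_
  have := omegaGen_mul_sign (H.dualBasis_mem (ε := ε) α) v
  rw [neg_neg] at this
  rw [H.contr_mul (basisI_mem α), add_mul, mul_assoc, mul_assoc, ← this, mul_assoc]

/-- The operator kills A and multiplies generators by c = |`agree`|. With the sign automorphism on
both sides, multiplication by one more generator changes the eigenvalue λ_n into (-1)^n c - λ_n,
which produces (-1)^{n+1} n c. -/
theorem euler_of_mem {n : ℕ} {k : Γ} {u : Omega ε 𝒜} (hu : u ∈ OmegaHom ε 𝒜 n k) :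
    H.euler ε u = ((-1) ^ (n + 1) * n * (agree ε 𝒜).ncard : ℂ) • u := by
  refine omegaHom_le (fun n k => LinearMap.eqLocus (H.euler ε)
    (((-1) ^ (n + 1) * n * (agree ε 𝒜).ncard : ℂ) • LinearMap.id)) (fun k a ha => ?_)
    (fun n k u hu' hu γ θ hθ => ?_) n k hu
  · change H.euler ε _ = (_ : ℂ) • omegaInc ε 𝒜 a
    rw [H.euler_apply, Finset.sum_eq_zero fun α _ => by rw [H.contr_inc, zero_mul]]
    simp
  · change H.euler ε u = (_ : ℂ) • u at hu
    change H.euler ε _ = (_ : ℂ) • (u * _)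
    have h1 : H.euler ε (omegaGen ε 𝒜 θ) = ((agree ε 𝒜).ncard : ℂ) • omegaGen ε 𝒜 θ := by
      rw [← H.sum_gen_dualBasis, H.euler_apply]
      exact Finset.sum_congr rfl fun α _ => by rw [H.contr_gen]
    rw [H.euler_mul, hu, h1, omegaSign_gen, omegaSign_of_mem hu', smul_mul_smul_comm, mul_neg,
      smul_mul_assoc, ← neg_smul, ← add_smul]
    congr 1
    push_cast
    ring

/-- An element of positive exterior degree is determined by its contractions. -/
theorem eq_zero_of_contr {n : ℕ} {k : Γ} {u : Omega ε 𝒜} (hu : u ∈ OmegaHom ε 𝒜 (n + 1) k)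
    (h : ∀ α, ∀ x : complI ε 𝒜, (x : A) ∈ 𝒜 α → H.contr ε x u = 0) : u = 0 := by
  -- For trivial A the set `agree` is empty and the eigenvalue is zero, so this case is separate.
  rcases subsingleton_or_nontrivial A with hA | hA
  · have : (1 : Omega ε 𝒜) = 0 := by
      rw [← map_one (omegaInc ε 𝒜), Subsingleton.elim (1 : A) 0, map_zero]
    rw [← mul_one u, this, mul_zero]
  have h1 := H.euler_of_mem hu
  rw [H.euler_apply, Finset.sum_eq_zero fun α _ => by rw [h α _ (basisI_mem α), zero_mul]] at h1
  refine (smul_eq_zero.1 h1.symm).resolve_left ?_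
  refine mul_ne_zero (mul_ne_zero (pow_ne_zero _ (neg_ne_zero.2 one_ne_zero)) ?_) H.agree_ncard_ne_zero
  exact_mod_cast n.succ_ne_zero

theorem contr_ext {n : ℕ} {k : Γ} {u v : Omega ε 𝒜} (hu : u ∈ OmegaHom ε 𝒜 (n + 1) k)
    (hv : v ∈ OmegaHom ε 𝒜 (n + 1) k)
    (h : ∀ α, ∀ x : complI ε 𝒜, (x : A) ∈ 𝒜 α → H.contr ε x u = H.contr ε x v) : u = v :=
  sub_eq_zero.1 (H.eq_zero_of_contr (sub_mem hu hv) fun α x hx => by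
    rw [map_sub, h α x hx, sub_self])

variable (ε) in
/-- The element with given contractions. -/
def integ (n : ℕ) (w : complI ε 𝒜 →ₗ[ℂ] Omega ε 𝒜) : Omega ε 𝒜 :=
  ((-1) ^ n / ((n + 1) * (agree ε 𝒜).ncard) : ℂ) •
    ∑ α ∈ H.nonAgree ε, w (basisI ε 𝒜 α) * omegaGen ε 𝒜 (H.dualBasis ε α)

theorem integ_mem {n : ℕ} {k : Γ} {w : complI ε 𝒜 →ₗ[ℂ] Omega ε 𝒜}
    (hw : ∀ {α} {x : complI ε 𝒜}, (x : A) ∈ 𝒜 α → w x ∈ OmegaHom ε 𝒜 n (k + α)) :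
    H.integ ε n w ∈ OmegaHom ε 𝒜 (n + 1) k :=
  Submodule.smul_mem _ _ (sum_mem fun α _ => by
    have := mul_omegaGen_mem (hw (basisI_mem α)) (H.dualBasis_mem (ε := ε) α)
    rwa [add_neg_cancel_right] at this)

/-- Compatible families of elements are families of contractions. -/
theorem contr_integ {n : ℕ} {k : Γ} {w : complI ε 𝒜 →ₗ[ℂ] Omega ε 𝒜}
    (hw : ∀ {α} {x : complI ε 𝒜}, (x : A) ∈ 𝒜 α → w x ∈ OmegaHom ε 𝒜 n (k + α))
    (hz : ∀ {α γ : Γ} {x y : complI ε 𝒜} {z : A}, (x : A) ∈ 𝒜 α → z ∈ center ε 𝒜 → z ∈ 𝒜 γ →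
      (y : A) = x * z → w y = w x * omegaInc ε 𝒜 z)
    (hanti : ∀ {α β : Γ} {x y : complI ε 𝒜}, (x : A) ∈ 𝒜 α → (y : A) ∈ 𝒜 β →
      H.contr ε y (w x) = -(ε.val α β • H.contr ε x (w y))) (x : complI ε 𝒜) :
    H.contr ε x (H.integ ε n w) = w x := by
  rcases subsingleton_or_nontrivial A with hA | hA
  · rw [Subsingleton.elim x 0, map_zero, map_zero, LinearMap.zero_apply]
  have hc := H.agree_ncard_ne_zero (ε := ε)
  have : (H.contr ε).flip (H.integ ε n w) = w := H.complI_ext_basis fun β hβ => by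
    -- Contracting Σ_α w(e_α) θ^α by e_β gives two sums. The one where θ^α is hit is (-1)^n c w(e_β)
    -- by Z-linearity of w. In the other, `hanti` exchanges e_α and e_β and turns it into minus the
    -- Euler operator at w(e_β). Together they give (-1)^n (n + 1) c w(e_β), which the scalar in
    -- `integ` normalizes.
    rw [LinearMap.flip_apply, integ, map_smul, map_sum, Finset.sum_congr rfl fun α _ =>
      H.contr_mul_gen (hw (basisI_mem α)) (basisI_mem β) (H.dualBasis_mem α),
      Finset.sum_add_distrib, ← Finset.smul_sum, H.sum_dualBasis hz hβ]
    have h1 : ∀ α, ε.val (-α) β •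
        (H.contr ε (basisI ε 𝒜 β) (w (basisI ε 𝒜 α)) * omegaGen ε 𝒜 (H.dualBasis ε α))
        = -(H.contr ε (basisI ε 𝒜 α) (w (basisI ε 𝒜 β)) * omegaGen ε 𝒜 (H.dualBasis ε α)) := by
      intro α
      rw [hanti (basisI_mem α) (basisI_mem β), neg_mul, smul_neg, smul_mul_assoc, smul_smul,
        ← ε.val_add_left, neg_add_cancel, ε.val_zero_left, one_smul]
    rw [Finset.sum_congr rfl fun α _ => h1 α, Finset.sum_neg_distrib, ← H.euler_apply,
      H.euler_of_mem (hw (basisI_mem β)), smul_smul, ← sub_eq_add_neg, ← sub_smul, smul_smul]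
    have h3 : ((n : ℂ) + 1) ≠ 0 := by exact_mod_cast n.succ_ne_zero
    have h4 : ((-1 : ℂ) ^ n) * (-1) ^ n = 1 := by rw [← mul_pow]; simp
    have h5 : ((-1 : ℂ) ^ n / ((n + 1) * (agree ε 𝒜).ncard)) *
        ((-1) ^ n * (agree ε 𝒜).ncard - (-1) ^ (n + 1) * n * (agree ε 𝒜).ncard) = 1 := by
      rw [div_mul_eq_mul_div, div_eq_one_iff_eq (mul_ne_zero h3 hc), pow_succ]
      linear_combination ((agree ε 𝒜).ncard : ℂ) * (n + 1) * h4
    rw [h5, one_smul]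
  exact congrArg (fun f => f x) this

/-! ### The evaluation -/

variable (ε) in
/-- The evaluation of elements of `Omega` on `complI`. -/
def evalOmega : ∀ n : ℕ, Omega ε 𝒜 →ₗ[ℂ] MultilinearMap ℂ (fun _ : Fin n => complI ε 𝒜) A
  | 0 => (MultilinearMap.constLinearEquivOfIsEmpty ℂ ℂ (fun _ : Fin 0 => complI ε 𝒜) A).toLinearMap
      ∘ₗ (omegaProj ε 𝒜).toLinearMap
  | n + 1 => (multilinearCurryLeftEquiv ℂ (fun _ : Fin (n + 1) => complI ε 𝒜) A).symm.toLinearMap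
      ∘ₗ (evalOmega n).compRight ℂ ∘ₗ (H.contr ε).flip

theorem evalOmega_zero (u : Omega ε 𝒜) (x : Fin 0 → complI ε 𝒜) :
    H.evalOmega ε 0 u x = omegaProj ε 𝒜 u := rfl

theorem evalOmega_succ {n : ℕ} (u : Omega ε 𝒜) (x : Fin (n + 1) → complI ε 𝒜) :
    H.evalOmega ε (n + 1) u x = H.evalOmega ε n (H.contr ε (x 0) u) (Fin.tail x) := rfl

theorem evalOmega_cons {n : ℕ} (u : Omega ε 𝒜) (x : complI ε 𝒜) (y : Fin n → complI ε 𝒜) :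
    H.evalOmega ε (n + 1) u (Fin.cons x y) = H.evalOmega ε n (H.contr ε x u) y := by
  rw [evalOmega_succ, Fin.cons_zero, Fin.tail_cons]

end IsFineDivision

end Contraction

end EpsGraded

end

/-! ### Iterated contraction as a sum over permutations. -/

noncomputable section

namespace EpsGraded

section Permutations

/-! ### Permutations and position of the least value -/

/-- The permutation with value `0` at `m` and the values of `t`, shifted by one, elsewhere. -/
def permCons {n : ℕ} (m : Fin (n + 1)) (t : Equiv.Perm (Fin n)) : Equiv.Perm (Fin (n + 1)) :=
  Equiv.Perm.decomposeFin.symm (0, t) * m.cycleRange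

theorem permCons_self {n : ℕ} (m : Fin (n + 1)) (t : Equiv.Perm (Fin n)) :
    permCons m t m = 0 := by
  simp [permCons]

theorem permCons_succAbove {n : ℕ} (m : Fin (n + 1)) (t : Equiv.Perm (Fin n)) (i : Fin n) :
    permCons m t (m.succAbove i) = (t i).succ := by
  simp [permCons]

theorem sign_permCons {n : ℕ} (m : Fin (n + 1)) (t : Equiv.Perm (Fin n)) :
    (((permCons m t).sign : ℤ) : ℂ) = (-1) ^ (m : ℕ) * ((t.sign : ℤ) : ℂ) := by
  simp [permCons, mul_comm]

theorem permCons_bijective (n : ℕ) :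
    Function.Bijective fun r : Fin (n + 1) × Equiv.Perm (Fin n) => permCons r.1 r.2 := by
  refine (Fintype.bijective_iff_injective_and_card _).2 ⟨?_, ?_⟩
  · rintro ⟨m, t⟩ ⟨m', t'⟩ h
    replace h : permCons m t = permCons m' t' := h
    have h1 : m = m' := by
      apply (permCons m' t').injective
      rw [permCons_self, ← h, permCons_self]
    subst h1
    have h2 : t = t' := by
      ext i : 1
      apply Fin.succ_injective
      rw [← permCons_succAbove m, h, permCons_succAbove]
    rw [h2]
  · rw [Fintype.card_prod, Fintype.card_perm, Fintype.card_perm, Fintype.card_fin,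
      Fintype.card_fin, Nat.factorial_succ]

/-- Sorting permutations by the position m of the value 0 mirrors the recursion in `evalOmega`,
which contracts with the argument of index 0 first. -/
theorem sum_perm_succ {n : ℕ} {M : Type*} [AddCommMonoid M]
    (f : Equiv.Perm (Fin (n + 1)) → M) :
    ∑ s, f s = ∑ m, ∑ t, f (permCons m t) := by
  rw [← (permCons_bijective n).sum_comp f, Fintype.sum_prod_type]

/-- Exactly m positions precede m. Written as a product over positions, the sign can be compared
with the commutation factors one position at a time. -/
theorem prod_neg_one_lt {n : ℕ} (m : Fin (n + 1)) :
    (∏ i : Fin n, if i.castSucc < m then (-1 : ℂ) else 1) = (-1) ^ (m : ℕ) := by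
  induction n with
  | zero => simp [Fin.fin_one_eq_zero m]
  | succ n ih =>
    rw [Fin.prod_univ_succ]
    induction m using Fin.cases with
    | zero => simp
    | succ m =>
      simp only [← Fin.succ_castSucc, Fin.succ_lt_succ_iff, ih m, Fin.val_succ, pow_succ']
      simp

/-- Bringing the factor at j to the front crosses only the earlier factors, each crossing costing
c_i. -/
theorem prod_ofFn_move {B : Type*} [Ring B] [Algebra ℂ B] {n : ℕ} (j : Fin (n + 1))
    (f : Fin (n + 1) → B) (c : Fin n → ℂ)
    (h : ∀ i : Fin n, i.castSucc < j → f (j.succAbove i) * f j = c i • (f j * f (j.succAbove i))) :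
    (List.ofFn f).prod = (∏ i : Fin n, if i.castSucc < j then c i else 1) •
      (f j * (List.ofFn fun i => f (j.succAbove i)).prod) := by
  induction n with
  | zero =>
    obtain rfl := Fin.fin_one_eq_zero j
    simp
  | succ n ih =>
    induction j using Fin.cases with
    | zero => simp
    | succ j =>
      rw [List.ofFn_succ, List.prod_cons, ih j (fun i => f i.succ) (fun i => c i.succ) fun i hi => by
        have := h i.succ (by rwa [← Fin.succ_castSucc, Fin.succ_lt_succ_iff])
        rwa [Fin.succ_succAbove_succ] at this, List.ofFn_succ, List.prod_cons, Fin.prod_univ_succ]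
      have h0 := h 0 (by simp)
      rw [Fin.succ_succAbove_zero] at h0
      simp only [Fin.succ_succAbove_zero, Fin.succ_succAbove_succ, ← Fin.succ_castSucc,
        Fin.succ_lt_succ_iff, mul_smul_comm]
      rw [← mul_assoc, h0, smul_mul_assoc, smul_smul, ← mul_assoc, mul_comm]
      simp [mul_assoc]

end Permutations

section Evaluation

set_option linter.unusedSectionVars false

variable {Γ : Type*} [AddCommGroup Γ] [DecidableEq Γ] {A : Type*} [Ring A] [Algebra ℂ A]
variable {ε : CommFactor Γ} {𝒜 : Γ → Submodule ℂ A} [GradedAlgebra 𝒜]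

/-- Position m carries the least value, so it forms an inversion with every earlier position and
with no later one; the other inversions are those of t. -/
theorem invFactor_permCons {n : ℕ} (d : Fin (n + 1) → Γ) (m : Fin (n + 1))
    (t : Equiv.Perm (Fin n)) :
    invFactor ε d (permCons m t)
      = (∏ i : Fin n, if i.castSucc < m then ε.val (d 0) (d (t i).succ) else 1)
        * invFactor ε (fun i => d i.succ) t := by
  unfold invFactor
  rw [Fin.prod_univ_succAbove _ m]
  simp only [Fin.prod_univ_succAbove _ m, permCons_self, permCons_succAbove, Fin.not_lt_zero,
    and_false, if_false, Finset.prod_const_one, one_mul, Fin.succ_pos, and_true,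
    Fin.succAbove_lt_succAbove_iff, Fin.succ_lt_succ_iff, Finset.prod_mul_distrib,
    Fin.succAbove_lt_iff_castSucc_lt]

theorem sign_mul_invFactor_permCons {n : ℕ} (d : Fin (n + 1) → Γ) (m : Fin (n + 1))
    (t : Equiv.Perm (Fin n)) :
    (((permCons m t).sign : ℤ) : ℂ) * invFactor ε d (permCons m t)
      = (∏ i : Fin n, if i.castSucc < m then -ε.val (d 0) (d (t i).succ) else 1)
        * (((t.sign : ℤ) : ℂ) * invFactor ε (fun i => d i.succ) t) := by
  have : (∏ i : Fin n, if i.castSucc < m then -ε.val (d 0) (d (t i).succ) else 1)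
      = (-1) ^ (m : ℕ) * ∏ i : Fin n, if i.castSucc < m then ε.val (d 0) (d (t i).succ) else 1 := by
    rw [← prod_neg_one_lt, ← Finset.prod_mul_distrib]
    refine Finset.prod_congr rfl fun i _ => ?_
    split_ifs <;> ring
  rw [this, sign_permCons, invFactor_permCons]
  ring

namespace IsFineDivision

variable (H : IsFineDivision 𝒜)

/-- Moving an argument of the evaluation to the first place. -/
theorem evalOmega_move {n : ℕ} (m : Fin (n + 1)) (u : Omega ε 𝒜) (d : Fin (n + 1) → Γ)
    (x : Fin (n + 1) → complI ε 𝒜) (hx : ∀ i, (x i : A) ∈ 𝒜 (d i)) :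
    H.evalOmega ε (n + 1) u x
      = (∏ i : Fin n, if i.castSucc < m then -ε.val (d (m.succAbove i)) (d m) else 1) •
        H.evalOmega ε n (H.contr ε (x m) u) fun i => x (m.succAbove i) := by
  induction n generalizing u with
  | zero =>
    rw [Fin.fin_one_eq_zero m, Finset.univ_eq_empty, Finset.prod_empty, one_smul]
    rfl
  | succ n ih =>
    induction m using Fin.cases with
    | zero => simp [H.evalOmega_succ u x]; rfl
    | succ m =>
      rw [H.evalOmega_succ, ih m _ (fun i => d i.succ) (Fin.tail x) fun i => hx i.succ,
        Fin.prod_univ_succ, H.evalOmega_succ]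
      simp only [Fin.tail, Fin.succ_succAbove_zero, Fin.succ_succAbove_succ, ← Fin.succ_castSucc,
        Fin.succ_lt_succ_iff, Fin.castSucc_zero, Fin.succ_pos, if_true]
      rw [H.contr_contr (hx m.succ) (hx 0), map_neg, map_smul, neg_apply,
        smul_apply, ← neg_smul, smul_smul, mul_comm]
      congr 2
      funext i
      simp only [Fin.tail, Fin.succ_succAbove_succ]

/-- The contraction hits one factor j. Each factor before j contributes -1 through the sign
automorphism, each factor after j is twisted by the degree of x. -/
theorem contr_prod {n : ℕ} {α : Γ} {x : complI ε 𝒜} (hx : (x : A) ∈ 𝒜 α) (g : Fin n → Γ)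
    (θ : Fin n → Dual ε 𝒜) (hθ : ∀ i, (θ i).1 ∈ DualHom ε 𝒜 (g i)) :
    H.contr ε x (List.ofFn fun i => omegaGen ε 𝒜 (θ i)).prod
      = ∑ j : Fin n, (-1 : ℂ) ^ (j : ℕ) • (List.ofFn fun i => if i < j then omegaGen ε 𝒜 (θ i)
        else if i = j then omegaInc ε 𝒜 ((θ i).1 x)
        else ε.val (g i) α • omegaGen ε 𝒜 (θ i)).prod := by
  induction n with
  | zero => simpa using H.contr_inc x 1
  | succ n ih =>
    rw [List.ofFn_succ, List.prod_cons, H.contr_mul hx, omegaSign_gen, H.contr_gen,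
      ih (fun i => g i.succ) (fun i => θ i.succ) fun i => hθ i.succ, Fin.sum_univ_succ,
      Finset.mul_sum, add_comm]
    congr 1
    · rw [List.ofFn_succ, List.prod_cons, map_list_prod, List.map_ofFn]
      simp only [Fin.not_lt_zero, if_false, Fin.succ_ne_zero, if_true, Fin.val_zero, pow_zero,
        one_smul]
      congr 3
      funext i
      exact omegaTwist_gen (hθ i.succ) α
    · refine Finset.sum_congr rfl fun j _ => ?_
      rw [List.ofFn_succ, List.prod_cons]
      simp only [Fin.succ_lt_succ_iff, Fin.succ_pos, if_true, Fin.succ_inj, Fin.val_succ, pow_succ,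
        mul_neg_one, neg_smul, mul_smul_comm, neg_mul, smul_neg]

theorem prod_ofFn_smul {B : Type*} [Ring B] [Algebra ℂ B] {n : ℕ} (c : Fin n → ℂ)
    (f : Fin n → B) :
    (List.ofFn fun i => c i • f i).prod = (∏ i, c i) • (List.ofFn f).prod := by
  induction n with
  | zero => simp
  | succ n ih =>
    rw [List.ofFn_succ, List.ofFn_succ, List.prod_cons, List.prod_cons,
      ih (fun i => c i.succ) fun i => f i.succ, Fin.prod_univ_succ, smul_mul_smul_comm]

/-- The element θ_j(x), of degree g_j + α, is moved left to the coefficient a past the earlier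
generators, which explains ε(g_i, g_j + α) for those and the bare twist ε(g_i, α) for the later
ones. -/
theorem contr_monomial {n : ℕ} {α : Γ} {x : complI ε 𝒜} (hx : (x : A) ∈ 𝒜 α) (a : A)
    (g : Fin (n + 1) → Γ) (θ : Fin (n + 1) → Dual ε 𝒜) (hθ : ∀ i, (θ i).1 ∈ DualHom ε 𝒜 (g i)) :
    H.contr ε x (monomial ε 𝒜 a θ)
      = ∑ j : Fin (n + 1), ((-1 : ℂ) ^ (j : ℕ) * ∏ i : Fin n, if i.castSucc < j
          then ε.val (g (j.succAbove i)) (g j + α) else ε.val (g (j.succAbove i)) α) •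
        monomial ε 𝒜 (a * (θ j).1 x) fun i => θ (j.succAbove i) := by
  rw [monomial_eq, H.contr_mul hx, H.contr_inc, zero_mul, add_zero, omegaSign_inc,
    H.contr_prod hx g θ hθ, Finset.mul_sum]
  refine Finset.sum_congr rfl fun j _ => ?_
  have e := prod_ofFn_move j (fun i => if i < j then omegaGen ε 𝒜 (θ i)
        else if i = j then omegaInc ε 𝒜 ((θ i).1 x)
        else ε.val (g i) α • omegaGen ε 𝒜 (θ i)) (fun i => ε.val (g (j.succAbove i)) (g j + α))
    fun i hi => by
      simp only [Fin.succAbove_lt_iff_castSucc_lt, hi, if_true, lt_irrefl, if_false]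
      rw [omegaGen_mul_inc ((hθ j).2.1 α x hx) (hθ _), add_comm]
  have e2 : ∀ i : Fin n, (if j.succAbove i < j then omegaGen ε 𝒜 (θ (j.succAbove i))
        else if j.succAbove i = j then omegaInc ε 𝒜 ((θ (j.succAbove i)).1 x)
        else ε.val (g (j.succAbove i)) α • omegaGen ε 𝒜 (θ (j.succAbove i)))
      = (if i.castSucc < j then (1 : ℂ) else ε.val (g (j.succAbove i)) α) •
        omegaGen ε 𝒜 (θ (j.succAbove i)) := fun i => by
    rw [if_neg (Fin.succAbove_ne j i)]
    simp only [Fin.succAbove_lt_iff_castSucc_lt]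
    split_ifs
    · rw [one_smul]
    · rfl
  simp only [e2] at e
  rw [e, prod_ofFn_smul]
  simp only [lt_irrefl, if_false, if_true, mul_smul_comm, smul_smul, monomial_eq, map_mul,
    mul_assoc]
  congr 2
  rw [← Finset.prod_mul_distrib]
  refine Finset.prod_congr rfl fun i _ => ?_
  split_ifs <;> simp

/-- Links the recursive definition with the closed formula. The index j of the generator hit by x_0
is the position of the value 0 in the permutation. As the values of the θ_i are central, θ_j(x_0)
can be brought to the front of the product, and only an identity of scalars is left. -/
theorem evalOmega_monomial {n : ℕ} (a : A) (g : Fin n → Γ) (θ : Fin n → Dual ε 𝒜)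
    (hθ : ∀ i, (θ i).1 ∈ DualHom ε 𝒜 (g i)) (d : Fin n → Γ) (x : Fin n → complI ε 𝒜)
    (hx : ∀ i, (x i : A) ∈ 𝒜 (d i)) :
    H.evalOmega ε n (monomial ε 𝒜 a θ) x =
      a * ∑ s : Equiv.Perm (Fin n),
        (((Equiv.Perm.sign s : ℤ) : ℂ) * invFactor ε d s *
            ∏ i, ∏ j, if i < j then ε.val (g j) (d (s i)) else 1) •
          (List.ofFn fun i => (θ i).1 (x (s i))).prod := by
  induction n generalizing a with
  | zero =>
    rw [H.evalOmega_zero, monomial_zero, omegaProj_inc]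
    simp [invFactor]
  | succ n ih =>
    rw [H.evalOmega_succ, H.contr_monomial (hx 0) a g θ hθ, map_sum, sum_apply,
      sum_perm_succ, Finset.mul_sum]
    refine Finset.sum_congr rfl fun j _ => ?_
    rw [map_smul, smul_apply, ih _ (fun i => g (j.succAbove i)) _
      (fun i => hθ _) (fun i => d i.succ) (Fin.tail x) (fun i => hx i.succ), mul_assoc,
      Finset.mul_sum, Finset.mul_sum, Finset.mul_sum, Finset.smul_sum]
    refine Finset.sum_congr rfl fun t _ => ?_
    have e := prod_ofFn_move j (fun i => (θ i).1 (x (permCons j t i)))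
      (fun i => ε.val (d (t i).succ + g (j.succAbove i)) (d 0 + g j)) fun i _ => by
        rw [permCons_self, permCons_succAbove]
        exact center_comm ((hθ _).1 _) ((hθ _).2.1 _ _ (hx _)) ((hθ _).2.1 _ _ (hx _))
    simp only [permCons_self, permCons_succAbove] at e
    rw [e, sign_mul_invFactor_permCons, smul_smul, mul_smul_comm, mul_smul_comm, mul_smul_comm,
      smul_smul, Fin.prod_univ_succAbove _ j]
    simp only [Fin.prod_univ_succAbove _ j, permCons_self, permCons_succAbove, lt_irrefl, if_false,
      one_mul, Finset.prod_mul_distrib, Fin.succAbove_lt_succAbove_iff,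
      Fin.succAbove_lt_iff_castSucc_lt, Fin.lt_succAbove_iff_le_castSucc]
    congr 1
    -- Both sides are products over the positions other than j and agree factor by factor. For a
    -- position before j, the surplus factors on the right cancel in pairs ε(a, b) ε(b, a) = 1.
    have key : ((-1 : ℂ) ^ (j : ℕ) * ∏ i : Fin n, if i.castSucc < j
          then ε.val (g (j.succAbove i)) (g j + d 0) else ε.val (g (j.succAbove i)) (d 0))
        = (∏ i : Fin n, if i.castSucc < j then -ε.val (d 0) (d (t i).succ) else 1) *
          (∏ i : Fin n, if j ≤ i.castSucc then ε.val (g (j.succAbove i)) (d 0) else 1) *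
          (∏ i : Fin n, if i.castSucc < j then ε.val (g j) (d (t i).succ) else 1) *
          ∏ i : Fin n, if i.castSucc < j
            then ε.val (d (t i).succ + g (j.succAbove i)) (d 0 + g j) else 1 := by
      rw [← prod_neg_one_lt, ← Finset.prod_mul_distrib, ← Finset.prod_mul_distrib,
        ← Finset.prod_mul_distrib, ← Finset.prod_mul_distrib]
      refine Finset.prod_congr rfl fun i _ => ?_
      by_cases h : i.castSucc < j
      · simp only [h, if_true, not_le.2 h, if_false, ε.val_add_left, ε.val_add_right]
        have h1 := ε.val_mul_swap (d 0) (d (t i).succ)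
        have h2 := ε.val_mul_swap (g j) (d (t i).succ)
        linear_combination ε.val (g (j.succAbove i)) (g j) * ε.val (g (j.succAbove i)) (d 0) *
          (ε.val (g j) (d (t i).succ) * ε.val (d (t i).succ) (g j) * h1 + h2)
      · simp only [h, if_false, not_lt.1 h, if_true, one_mul, mul_one]
    rw [key]
    ring

/-- Contracting m times an element of exterior degree n ≠ m either gives zero on the way or ends in
positive degree, where `omegaProj` vanishes. -/
theorem evalOmega_of_ne {m n : ℕ} {k : Γ} {u : Omega ε 𝒜} (hu : u ∈ OmegaHom ε 𝒜 n k)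
    (hmn : m ≠ n) : H.evalOmega ε m u = 0 := by
  induction m generalizing n k u with
  | zero =>
    obtain ⟨n, rfl⟩ := Nat.exists_eq_succ_of_ne_zero hmn.symm
    ext x
    exact omegaProj_of_mem hu
  | succ m ih =>
    have : H.evalOmega ε m ∘ₗ (H.contr ε).flip u = 0 := complI_ext ε 𝒜 fun α x hx => by
      cases n with
      | zero =>
        rw [LinearMap.comp_apply, LinearMap.flip_apply, H.contr_zero_mem hu, map_zero]
        rfl
      | succ n => exact ih (H.contr_mem hu hx) fun h => hmn (congrArg _ h)
    ext x
    exact congrArg (fun f => f (x 0) (Fin.tail x)) this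

end IsFineDivision

/-- The clause `other` of `IsEvaluation` allows entries that are not homogeneous; such monomials
still lie in the sum of the components of exterior degree n. -/
theorem monomial_mem_iSup {n : ℕ} (a : A) (θ : Fin n → Dual ε 𝒜) :
    monomial ε 𝒜 a θ ∈ ⨆ k, OmegaHom ε 𝒜 n k := by
  induction n with
  | zero =>
    rw [monomial_zero]
    induction a using DirectSum.Decomposition.inductionOn 𝒜 with
    | zero => rw [map_zero]; exact zero_mem _
    | homogeneous m => exact Submodule.mem_iSup_of_mem _ (omegaInc_mem m.2)
    | add a b ha hb => rw [map_add]; exact add_mem ha hb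
  | succ n ih =>
    rw [monomial_succ]
    induction θ (Fin.last n) using dual_induction with
    | h0 => rw [map_zero, mul_zero]; exact zero_mem _
    | hadd θ η h1 h2 => rw [map_add, mul_add]; exact add_mem h1 h2
    | hom γ η hη =>
      have h := ih fun i => θ i.castSucc
      generalize monomial ε 𝒜 a (fun i => θ i.castSucc) = w at h ⊢
      induction h using Submodule.iSup_induction' with
      | mem i x hx => exact Submodule.mem_iSup_of_mem _ (mul_omegaGen_mem hx hη)
      | zero => rw [zero_mul]; exact zero_mem _
      | add x y _ _ hx hy => rw [add_mul]; exact add_mem hx hy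

/-- Multilinear maps on `complI` which agree on homogeneous elements are equal. -/
theorem multilinear_ext {n : ℕ} {f g : MultilinearMap ℂ (fun _ : Fin n => complI ε 𝒜) A}
    (h : ∀ (d : Fin n → Γ) (x : Fin n → complI ε 𝒜), (∀ i, (x i : A) ∈ 𝒜 (d i)) → f x = g x) :
    f = g := by
  induction n with
  | zero => ext x; exact h ![] x fun i => i.elim0
  | succ n ih =>
    have : f.curryLeft = g.curryLeft := complI_ext ε 𝒜 fun α x hx => ih fun d y hy => by
      rw [MultilinearMap.curryLeft_apply, MultilinearMap.curryLeft_apply]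
      refine h (Fin.cons α d) _ fun i => ?_
      induction i using Fin.cases with
      | zero => exact hx
      | succ i => exact hy i
    rw [← MultilinearMap.uncurry_curryLeft f, this, MultilinearMap.uncurry_curryLeft]

namespace IsFineDivision

variable (H : IsFineDivision 𝒜)

theorem isEvaluation : IsEvaluation ε 𝒜 (H.evalOmega ε) where
  same _ a g θ hθ d x hx := H.evalOmega_monomial a g θ hθ d x hx
  other m n a θ hmn := by
    have : (⨆ k, OmegaHom ε 𝒜 n k) ≤ LinearMap.ker (H.evalOmega ε m) :=
      iSup_le fun k u hu => H.evalOmega_of_ne hu hmn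
    exact this (monomial_mem_iSup a θ)

theorem eq_evalOmega
    {ev : ∀ n : ℕ, Omega ε 𝒜 →ₗ[ℂ] MultilinearMap ℂ (fun _ : Fin n => complI ε 𝒜) A}
    (h : IsEvaluation ε 𝒜 ev) : ev = H.evalOmega ε := by
  funext m
  refine omega_lin_ext fun n k => ?_
  change OmegaHom ε 𝒜 n k ≤ LinearMap.eqLocus (ev m) (H.evalOmega ε m)
  refine Submodule.span_le.2 ?_
  rintro _ ⟨α, a, g, θ, ha, hθ, rfl, rfl⟩
  change ev m _ = H.evalOmega ε m _
  by_cases hmn : m = n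
  · subst hmn
    refine multilinear_ext fun d x hx => ?_
    rw [h.same _ a g θ hθ d x hx, H.isEvaluation.same _ a g θ hθ d x hx]
  · rw [h.other m n a θ hmn, H.isEvaluation.other m n a θ hmn]

/-- The length n is kept as a variable so that later inductions on n may lower either p or q. -/
theorem prod_fin_split {M : Type*} [CommMonoid M] {p q n : ℕ} (h : p + q = n) (f : Fin n → M) :
    ∏ i, f i = (∏ i : Fin p, f (Fin.cast h (Fin.castAdd q i))) *
      ∏ j : Fin q, f (Fin.cast h (Fin.natAdd p j)) := by
  subst h
  exact Fin.prod_univ_add f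

theorem sum_fin_split {M : Type*} [AddCommMonoid M] {p q n : ℕ} (h : p + q = n) (f : Fin n → M) :
    ∑ i, f i = (∑ i : Fin p, f (Fin.cast h (Fin.castAdd q i))) +
      ∑ j : Fin q, f (Fin.cast h (Fin.natAdd p j)) := by
  subst h
  exact Fin.sum_univ_add f

end IsFineDivision

end Evaluation

end EpsGraded

end

/-! ### The product formula. -/

noncomputable section

namespace EpsGraded

section Product

set_option linter.unusedSectionVars false

variable {Γ : Type*} [AddCommGroup Γ] [DecidableEq Γ] {A : Type*} [Ring A] [Algebra ℂ A]
variable {ε : CommFactor Γ} {𝒜 : Γ → Submodule ℂ A} [GradedAlgebra 𝒜]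

/-! ### The evaluation of a product -/

variable (ε) in
/-- The product of the signs which appear when an argument of degree `δ` is moved to the left of
the arguments of degrees `e_i`, `i < m`. -/
def moveSign {n : ℕ} (m : Fin (n + 1)) (e : Fin n → Γ) (δ : Γ) : ℂ :=
  ∏ i : Fin n, if i.castSucc < m then -ε.val (e i) δ else 1

variable (ε) in
theorem moveSign_mul {n : ℕ} (m : Fin (n + 1)) (e : Fin n → Γ) (δ : Γ) :
    (∏ i : Fin n, if i.castSucc < m then -ε.val δ (e i) else 1) * moveSign ε m e δ = 1 := by
  rw [moveSign, ← Finset.prod_mul_distrib]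
  refine Finset.prod_eq_one fun i _ => ?_
  split_ifs
  · rw [neg_mul_neg, ε.val_mul_swap]
  · rw [one_mul]

theorem cast_castAdd_succAbove {p q n : ℕ} (h : p + q = n) (h' : p + 1 + q = n + 1)
    (i : Fin (p + 1)) (j : Fin p) :
    Fin.cast h' (Fin.castAdd q (i.succAbove j))
      = (Fin.cast h' (Fin.castAdd q i)).succAbove (Fin.cast h (Fin.castAdd q j)) := by
  ext
  simp only [Fin.succAbove, Fin.lt_def]
  split_ifs <;> simp_all <;> omega

theorem cast_natAdd_succAbove {p q n : ℕ} (h : p + q = n) (h' : p + 1 + q = n + 1)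
    (i : Fin (p + 1)) (j : Fin q) :
    Fin.cast h' (Fin.natAdd (p + 1) j)
      = (Fin.cast h' (Fin.castAdd q i)).succAbove (Fin.cast h (Fin.natAdd p j)) := by
  ext
  simp only [Fin.succAbove, Fin.lt_def]
  split_ifs <;> simp_all <;> omega

theorem cast_natAdd_succAbove' {p q n : ℕ} (h : p + q = n) (h' : p + (q + 1) = n + 1)
    (i : Fin (q + 1)) (j : Fin q) :
    Fin.cast h' (Fin.natAdd p (i.succAbove j))
      = (Fin.cast h' (Fin.natAdd p i)).succAbove (Fin.cast h (Fin.natAdd p j)) := by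
  ext
  simp only [Fin.succAbove, Fin.lt_def]
  split_ifs <;> simp_all <;> omega

theorem cast_castAdd_succAbove' {p q n : ℕ} (h : p + q = n) (h' : p + (q + 1) = n + 1)
    (i : Fin (q + 1)) (j : Fin p) :
    Fin.cast h' (Fin.castAdd (q + 1) j)
      = (Fin.cast h' (Fin.natAdd p i)).succAbove (Fin.cast h (Fin.castAdd q j)) := by
  ext
  simp only [Fin.succAbove, Fin.lt_def]
  split_ifs <;> simp_all <;> omega

namespace IsFineDivision

variable (H : IsFineDivision 𝒜)

variable (ε) in
/-- The summand of index `s` in the formula for the product of a `p`-form and a `q`-form of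
degree `l`. -/
def mulTerm {p q n : ℕ} (h : p + q = n) (l : Γ) (u v : Omega ε 𝒜) (d : Fin n → Γ)
    (x : Fin n → complI ε 𝒜) (s : Equiv.Perm (Fin n)) : A :=
  (((Equiv.Perm.sign s : ℤ) : ℂ) * invFactor ε d s *
      ∏ i : Fin p, ε.val l (d (s (Fin.cast h (Fin.castAdd q i))))) •
    (H.evalOmega ε p u (fun i => x (s (Fin.cast h (Fin.castAdd q i)))) *
      H.evalOmega ε q v (fun j => x (s (Fin.cast h (Fin.natAdd p j)))))

/-- These permutations put the argument x_0 in the left block; they account for the term i_{x_0}(u)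
v of the Leibniz rule. The sign of bringing x_0 to the front of its block cancels the corresponding
inversions, and ε(l, d_0) is the twist of v. The result does not depend on the place i in the block.
-/
theorem mulTerm_left {p q n : ℕ} (h : p + q = n) (h' : p + 1 + q = n + 1) (l : Γ)
    (u v : Omega ε 𝒜) (d : Fin (n + 1) → Γ) (x : Fin (n + 1) → complI ε 𝒜)
    (hx : ∀ i, (x i : A) ∈ 𝒜 (d i)) (i : Fin (p + 1)) (t : Equiv.Perm (Fin n)) :
    H.mulTerm ε h' l u v d x (permCons (Fin.cast h' (Fin.castAdd q i)) t)
      = ε.val l (d 0) • H.mulTerm ε h l (H.contr ε (x 0) u) v (fun i => d i.succ) (Fin.tail x) t := by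
  have hp : ∀ j, permCons (Fin.cast h' (Fin.castAdd q i)) t
      (Fin.cast h' (Fin.castAdd q (i.succAbove j))) = (t (Fin.cast h (Fin.castAdd q j))).succ :=
    fun j => by rw [cast_castAdd_succAbove h, permCons_succAbove]
  have hq : ∀ j, permCons (Fin.cast h' (Fin.castAdd q i)) t
      (Fin.cast h' (Fin.natAdd (p + 1) j)) = (t (Fin.cast h (Fin.natAdd p j))).succ :=
    fun j => by rw [cast_natAdd_succAbove h, permCons_succAbove]
  have e1 := H.evalOmega_move i u
    (fun i' => d (permCons (Fin.cast h' (Fin.castAdd q i)) t (Fin.cast h' (Fin.castAdd q i'))))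
    (fun i' => x (permCons (Fin.cast h' (Fin.castAdd q i)) t (Fin.cast h' (Fin.castAdd q i'))))
    (fun i' => hx _)
  simp only [hp, permCons_self] at e1
  have e2 := moveSign_mul ε i (fun j => d (t (Fin.cast h (Fin.castAdd q j))).succ) (d 0)
  have e3 : (∏ j : Fin n, if j.castSucc < Fin.cast h' (Fin.castAdd q i)
        then -ε.val (d 0) (d (t j).succ) else 1)
      = ∏ j : Fin p, if j.castSucc < i
        then -ε.val (d 0) (d (t (Fin.cast h (Fin.castAdd q j))).succ) else 1 := by
    rw [prod_fin_split h]
    have : ∀ j : Fin q, ¬ (Fin.cast h (Fin.natAdd p j)).castSucc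
        < Fin.cast h' (Fin.castAdd q i) := fun j hj => by
      have := i.2
      simp only [Fin.lt_def, Fin.val_castSucc, Fin.val_cast, Fin.val_natAdd, Fin.val_castAdd] at hj
      omega
    simp only [this, if_false, Finset.prod_const_one, mul_one]
    rfl
  unfold mulTerm
  rw [e1, sign_mul_invFactor_permCons, e3, Fin.prod_univ_succAbove _ i]
  simp only [hp, hq, permCons_self, smul_mul_assoc, smul_smul]
  change (_ * moveSign ε i (fun j => d (t (Fin.cast h (Fin.castAdd q j))).succ) (d 0)) • _ = _
  congr 1
  linear_combination (((t.sign : ℤ) : ℂ) * invFactor ε (fun i => d i.succ) t * ε.val l (d 0) *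
    ∏ j : Fin p, ε.val l (d (t (Fin.cast h (Fin.castAdd q j))).succ)) * e2

/-- Here x_0 lies in the right block and corresponds to u i_{x_0}(v). Crossing the whole left block
costs (-1)^p and factors ε(d_0, ·); the latter are absorbed by replacing l with l + d_0, the degree
of i_{x_0}(v). -/
theorem mulTerm_right {p q n : ℕ} (h : p + q = n) (h' : p + (q + 1) = n + 1) (l : Γ)
    (u v : Omega ε 𝒜) (d : Fin (n + 1) → Γ) (x : Fin (n + 1) → complI ε 𝒜)
    (hx : ∀ i, (x i : A) ∈ 𝒜 (d i)) (i : Fin (q + 1)) (t : Equiv.Perm (Fin n)) :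
    H.mulTerm ε h' l u v d x (permCons (Fin.cast h' (Fin.natAdd p i)) t)
      = (-1 : ℂ) ^ p • H.mulTerm ε h (l + d 0) u (H.contr ε (x 0) v) (fun i => d i.succ)
          (Fin.tail x) t := by
  have hp : ∀ j, permCons (Fin.cast h' (Fin.natAdd p i)) t
      (Fin.cast h' (Fin.castAdd (q + 1) j)) = (t (Fin.cast h (Fin.castAdd q j))).succ :=
    fun j => by rw [cast_castAdd_succAbove' h h' i, permCons_succAbove]
  have hq : ∀ j, permCons (Fin.cast h' (Fin.natAdd p i)) t
      (Fin.cast h' (Fin.natAdd p (i.succAbove j))) = (t (Fin.cast h (Fin.natAdd p j))).succ :=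
    fun j => by rw [cast_natAdd_succAbove' h, permCons_succAbove]
  have e1 := H.evalOmega_move i v
    (fun i' => d (permCons (Fin.cast h' (Fin.natAdd p i)) t (Fin.cast h' (Fin.natAdd p i'))))
    (fun i' => x (permCons (Fin.cast h' (Fin.natAdd p i)) t (Fin.cast h' (Fin.natAdd p i'))))
    (fun i' => hx _)
  simp only [hq, permCons_self] at e1
  have e2 := moveSign_mul ε i (fun j => d (t (Fin.cast h (Fin.natAdd p j))).succ) (d 0)
  have e3 : (∏ j : Fin n, if j.castSucc < Fin.cast h' (Fin.natAdd p i)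
        then -ε.val (d 0) (d (t j).succ) else 1)
      = (-1) ^ p * (∏ j : Fin p, ε.val (d 0) (d (t (Fin.cast h (Fin.castAdd q j))).succ)) *
        ∏ j : Fin q, if j.castSucc < i
          then -ε.val (d 0) (d (t (Fin.cast h (Fin.natAdd p j))).succ) else 1 := by
    rw [prod_fin_split h]
    have h1 : ∀ j : Fin p, (Fin.cast h (Fin.castAdd q j)).castSucc
        < Fin.cast h' (Fin.natAdd p i) := fun j => by
      have := j.2
      simp only [Fin.lt_def, Fin.val_castSucc, Fin.val_cast, Fin.val_natAdd, Fin.val_castAdd]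
      omega
    have h2 : ∀ j : Fin q, (Fin.cast h (Fin.natAdd p j)).castSucc
        < Fin.cast h' (Fin.natAdd p i) ↔ j.castSucc < i := fun j => by
      simp only [Fin.lt_def, Fin.val_castSucc, Fin.val_cast, Fin.val_natAdd]
      omega
    simp only [h1, h2, if_true]
    rw [Finset.prod_neg, Finset.card_univ, Fintype.card_fin]
  unfold mulTerm
  rw [e1, sign_mul_invFactor_permCons, e3]
  simp only [hp, mul_smul_comm, smul_smul, ε.val_add_left,
    Finset.prod_mul_distrib]
  change (_ * moveSign ε i (fun j => d (t (Fin.cast h (Fin.natAdd p j))).succ) (d 0)) • _ = _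
  congr 1
  linear_combination ((-1) ^ p * ((t.sign : ℤ) : ℂ) * invFactor ε (fun i => d i.succ) t *
    (∏ j : Fin p, ε.val l (d (t (Fin.cast h (Fin.castAdd q j))).succ)) *
    ∏ j : Fin p, ε.val (d 0) (d (t (Fin.cast h (Fin.castAdd q j))).succ)) * e2

/-- Induction on the number of arguments through the Leibniz rule for the first contraction. The p
places of x_0 in the left block give equal terms, and so do the q places in the right block; this
turns (p - 1)! q! and p! (q - 1)! into p! q!. -/
theorem evalOmega_mul {n p q : ℕ} (h : p + q = n) {k l : Γ} {u v : Omega ε 𝒜}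
    (hu : u ∈ OmegaHom ε 𝒜 p k) (hv : v ∈ OmegaHom ε 𝒜 q l) (d : Fin n → Γ)
    (x : Fin n → complI ε 𝒜) (hx : ∀ i, (x i : A) ∈ 𝒜 (d i)) :
    H.evalOmega ε n (u * v) x = (1 / ((p.factorial : ℂ) * (q.factorial : ℂ))) •
      ∑ s : Equiv.Perm (Fin n), H.mulTerm ε h l u v d x s := by
  induction n generalizing p q k l u v with
  | zero =>
    obtain ⟨rfl, rfl⟩ := Nat.add_eq_zero_iff.1 h
    simp [mulTerm, H.evalOmega_zero, invFactor]
  | succ n ih =>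
    have hL : ∑ i : Fin p, ∑ t, H.mulTerm ε h l u v d x (permCons (Fin.cast h (Fin.castAdd q i)) t)
        = ((p.factorial : ℂ) * (q.factorial : ℂ)) • ε.val l (d 0) •
          H.evalOmega ε n (H.contr ε (x 0) u * v) (Fin.tail x) := by
      cases p with
      | zero => simp [H.contr_zero_mem hu]
      | succ p =>
        have h1 : p + q = n := by omega
        rw [ih h1 (H.contr_mem hu (hx 0)) hv (fun i => d i.succ) (Fin.tail x) fun i => hx i.succ]
        simp only [H.mulTerm_left h1 h l u v d x hx]
        rw [Finset.sum_const, Finset.card_univ, Fintype.card_fin, ← Nat.cast_smul_eq_nsmul ℂ,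
          ← Finset.smul_sum, smul_smul, smul_smul, smul_smul]
        congr 1
        have := p.factorial_ne_zero
        have := q.factorial_ne_zero
        rw [Nat.factorial_succ]
        push_cast
        field_simp
    have hR : ∑ i : Fin q, ∑ t, H.mulTerm ε h l u v d x (permCons (Fin.cast h (Fin.natAdd p i)) t)
        = ((p.factorial : ℂ) * (q.factorial : ℂ)) • (-1 : ℂ) ^ p •
          H.evalOmega ε n (u * H.contr ε (x 0) v) (Fin.tail x) := by
      cases q with
      | zero => simp [H.contr_zero_mem hv]
      | succ q =>
        have h1 : p + q = n := by omega
        rw [ih h1 hu (H.contr_mem hv (hx 0)) (fun i => d i.succ) (Fin.tail x) fun i => hx i.succ]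
        simp only [H.mulTerm_right h1 h l u v d x hx]
        rw [Finset.sum_const, Finset.card_univ, Fintype.card_fin, ← Nat.cast_smul_eq_nsmul ℂ,
          ← Finset.smul_sum, smul_smul, smul_smul, smul_smul]
        congr 1
        have := p.factorial_ne_zero
        have := q.factorial_ne_zero
        rw [Nat.factorial_succ]
        push_cast
        field_simp
    rw [H.evalOmega_succ, H.contr_mul (hx 0), omegaSign_of_mem hu, omegaTwist_of_mem hv,
      smul_mul_assoc, mul_smul_comm, map_add, map_smul, map_smul, add_apply, smul_apply, smul_apply,
      sum_perm_succ, sum_fin_split h, hL, hR, ← smul_add, smul_smul, one_div_mul_cancel, one_smul,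
      add_comm]
    exact mul_ne_zero (Nat.cast_ne_zero.2 p.factorial_ne_zero)
      (Nat.cast_ne_zero.2 q.factorial_ne_zero)

end IsFineDivision

end Product

end EpsGraded

end

/-! ### Evaluations are exactly the ε-alternating Z-linear forms on I. -/

noncomputable section

namespace EpsGraded

section FormsOnComplement

set_option linter.unusedSectionVars false

variable {Γ : Type*} [AddCommGroup Γ] [DecidableEq Γ] {A : Type*} [Ring A] [Algebra ℂ A]
variable {ε : CommFactor Γ} {𝒜 : Γ → Submodule ℂ A} [GradedAlgebra 𝒜]

/-! ### Forms on the complement of the `ε`-center -/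

variable (ε 𝒜) in
/-- The conditions defining `Form`, for multilinear maps on `complI`. -/
structure IsFormI (n : ℕ) (k : Γ) (ω : MultilinearMap ℂ (fun _ : Fin n => complI ε 𝒜) A) :
    Prop where
  deg : ∀ (d : Fin n → Γ) (x : Fin n → complI ε 𝒜), (∀ i, (x i : A) ∈ 𝒜 (d i)) →
    ω x ∈ 𝒜 (k + ∑ i, d i)
  lin : ∀ (d : Fin n → Γ) (x : Fin n → complI ε 𝒜), (∀ i, (x i : A) ∈ 𝒜 (d i)) →
    ∀ (β : Γ) (z : A), z ∈ center ε 𝒜 → z ∈ 𝒜 β → ∀ i : Fin n, (i : ℕ) + 1 = n →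
      ∀ y : complI ε 𝒜, (y : A) = x i * z → ω (Function.update x i y) = ω x * z
  swap : ∀ (d : Fin n → Γ) (x : Fin n → complI ε 𝒜), (∀ i, (x i : A) ∈ 𝒜 (d i)) →
    ∀ i j : Fin n, (i : ℕ) + 1 = j → ω x = -(ε.val (d i) (d j) • ω (x ∘ Equiv.swap i j))

/-- The adjoint map is right Z-linear for the module structure X z = ε(|X|, |z|) z X of derivations,
so Z-linearity of forms can be transported between derivations and I. -/
theorem epsBracket_mul_center {α β : Γ} {x z : A} (hx : x ∈ 𝒜 α) (hz : z ∈ center ε 𝒜)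
    (hzβ : z ∈ 𝒜 β) :
    epsBracket ε 𝒜 (x * z) = ε.val α β • (LinearMap.mulLeft ℂ z ∘ₗ epsBracket ε 𝒜 x) := by
  refine lin_ext 𝒜 fun γ a ha => ?_
  rw [LinearMap.smul_apply, LinearMap.comp_apply, LinearMap.mulLeft_apply,
    epsBracket_of_mem ε (SetLike.GradedMul.mul_mem hx hzβ) ha, epsBracket_of_mem ε hx ha, mul_sub,
    mul_smul_comm, ← mul_assoc z a, ← mul_assoc z x, center_comm hz hzβ hx, center_comm hz hzβ ha,
    mul_assoc x z, center_comm hz hzβ ha, smul_mul_assoc, smul_mul_assoc, mul_assoc a z,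
    center_comm hz hzβ hx]
  simp only [mul_smul_comm, smul_sub, smul_smul, ← mul_assoc, ε.val_add_left]
  rw [mul_assoc x z, center_comm hz hzβ ha]
  simp only [mul_smul_comm, smul_smul, ← mul_assoc]
  have h := ε.val_mul_swap α β
  match_scalars
  · linear_combination (-ε.val β γ) * h
  · linear_combination (ε.val α γ * ε.val β γ) * h

theorem form_compLinearMap {n : ℕ} {k : Γ} {ω : MultilinearMap ℂ (fun _ : Fin n => Der ε 𝒜) A}
    (hω : ω ∈ Form ε 𝒜 n k) : IsFormI ε 𝒜 n k (ω.compLinearMap fun _ => adI ε 𝒜) where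
  deg d x hx := hω.1 d _ fun i => adI_mem (hx i)
  lin d x hx β z hz hzβ i hi y hy := by
    have := hω.2.1 d (fun i => adI ε 𝒜 (x i)) (fun i => adI_mem (hx i)) β z hz hzβ i hi
    rw [MultilinearMap.compLinearMap_apply, MultilinearMap.compLinearMap_apply, ← this]
    congr 1
    funext j
    by_cases h : j = i
    · subst h
      rw [Function.update_self, Function.update_self]
      refine Subtype.ext ?_
      change epsBracket ε 𝒜 (y : A) = _
      rw [hy, epsBracket_mul_center (hx j) hz hzβ]
      rfl
    · rw [Function.update_of_ne h, Function.update_of_ne h]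
  swap d x hx i j hij := hω.2.2 d (fun i => adI ε 𝒜 (x i)) (fun i => adI_mem (hx i)) i j hij

namespace IsFineDivision

variable (H : IsFineDivision 𝒜)

theorem mem_form {n : ℕ} {k : Γ} {ω : MultilinearMap ℂ (fun _ : Fin n => complI ε 𝒜) A}
    (hω : IsFormI ε 𝒜 n k ω) :
    (ω.compLinearMap fun _ => (H.adEquiv ε).symm.toLinearMap) ∈ Form ε 𝒜 n k := by
  refine ⟨fun d X hX => hω.deg d _ fun i => H.adEquiv_symm_mem (hX i),
    fun d X hX β z hz hzβ i hi => ?_,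
    fun d X hX i j hij => hω.swap d _ (fun i => H.adEquiv_symm_mem (hX i)) i j hij⟩
  have hx := fun i => H.adEquiv_symm_mem (hX i)
  have := hω.lin d (fun i => (H.adEquiv ε).symm (X i)) hx β z hz hzβ i hi
    ⟨_, H.complI_mul ((H.adEquiv ε).symm (X i)).2 hz⟩ rfl
  rw [MultilinearMap.compLinearMap_apply, MultilinearMap.compLinearMap_apply]
  refine Eq.trans ?_ this
  congr 1
  funext j
  by_cases h : j = i
  · subst h
    rw [Function.update_self, Function.update_self]
    change (H.adEquiv ε).symm _ = _
    rw [LinearEquiv.symm_apply_eq]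
    refine Subtype.ext ?_
    change _ = epsBracket ε 𝒜 (((H.adEquiv ε).symm (X j) : A) * z)
    rw [epsBracket_mul_center (hx j) hz hzβ]
    have : epsBracket ε 𝒜 ((H.adEquiv ε).symm (X j) : complI ε 𝒜) = (X j).1 :=
      congrArg Subtype.val ((H.adEquiv ε).apply_symm_apply (X j))
    rw [this]
  · rw [Function.update_of_ne h, Function.update_of_ne h]
    rfl

/-! ### Evaluations are forms -/

/-- Induction through the first contraction. Z-linearity comes from `contr_mul_center` once a single
argument is left, and antisymmetry in the first two arguments is the anticommutation of
contractions. -/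
theorem evalOmega_isFormI {n : ℕ} {k : Γ} {u : Omega ε 𝒜} (hu : u ∈ OmegaHom ε 𝒜 n k) :
    IsFormI ε 𝒜 n k (H.evalOmega ε n u) := by
  induction n generalizing k u with
  | zero =>
    refine ⟨fun d x hx => ?_, fun d x hx β z hz hzβ i => i.elim0, fun d x hx i => i.elim0⟩
    obtain ⟨a, ha, rfl⟩ := omegaHom_zero hu
    rw [H.evalOmega_zero, omegaProj_inc, Fin.sum_univ_zero, add_zero]
    exact ha
  | succ n ih =>
    refine ⟨fun d x hx => ?_, fun d x hx β z hz hzβ i hi y hy => ?_, fun d x hx i j hij => ?_⟩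
    · rw [H.evalOmega_succ, Fin.sum_univ_succ, ← add_assoc]
      exact (ih (H.contr_mem hu (hx 0))).deg _ _ fun i => hx i.succ
    · induction i using Fin.cases with
      | zero =>
        obtain rfl : n = 0 := by simpa using hi.symm
        rw [H.evalOmega_succ, Function.update_self, H.contr_mul_center (hx 0) hz hzβ hy,
          H.evalOmega_zero, map_mul, omegaProj_inc, H.evalOmega_succ, H.evalOmega_zero]
      | succ i =>
        rw [H.evalOmega_succ, Function.update_of_ne (Fin.succ_ne_zero i).symm, Fin.tail_update_succ,
          H.evalOmega_succ]
        exact (ih (H.contr_mem hu (hx 0))).lin _ _ (fun i => hx i.succ) β z hz hzβ i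
          (by simpa using hi) y hy
    · induction j using Fin.cases with
      | zero => simp at hij
      | succ j =>
      induction i using Fin.cases with
      | zero =>
        cases n with
        | zero => exact j.elim0
        | succ n =>
        obtain rfl : j = 0 := by
          ext
          simpa using hij.symm
        rw [H.evalOmega_succ, H.evalOmega_succ, H.evalOmega_succ, H.evalOmega_succ]
        have h1 : (x ∘ Equiv.swap (0 : Fin (n + 2)) (Fin.succ 0)) 0 = x 1 := by simp
        have h2 : Fin.tail (x ∘ Equiv.swap (0 : Fin (n + 2)) (Fin.succ 0)) 0 = x 0 := by
          simp [Fin.tail]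
        have h3 : Fin.tail (Fin.tail (x ∘ Equiv.swap (0 : Fin (n + 2)) (Fin.succ 0)))
            = Fin.tail (Fin.tail x) := by
          funext i
          simp only [Fin.tail, Function.comp_apply]
          rw [Equiv.swap_apply_of_ne_of_ne (Fin.succ_ne_zero _)
            fun h => Fin.succ_ne_zero i (Fin.succ_injective _ h)]
        rw [h1, h2, h3]
        have h4 : Fin.tail x 0 = x 1 := rfl
        rw [h4, H.contr_contr (hx 1) (hx 0), map_neg, map_smul]
        rfl
      | succ i =>
        have h1 : (x ∘ Equiv.swap i.succ j.succ) 0 = x 0 := by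
          rw [Function.comp_apply, Equiv.swap_apply_of_ne_of_ne (Fin.succ_ne_zero _).symm
            (Fin.succ_ne_zero _).symm]
        have h2 : Fin.tail (x ∘ Equiv.swap i.succ j.succ) = Fin.tail x ∘ Equiv.swap i j := by
          funext a
          simp only [Fin.tail, Function.comp_apply, (Fin.succ_injective n).swap_apply]
        rw [H.evalOmega_succ, H.evalOmega_succ, h1, h2]
        exact (ih (H.contr_mem hu (hx 0))).swap (fun i => d i.succ) _ (fun i => hx i.succ) i j
          (by simpa using hij)

theorem eq_zero_of_evalOmega {n : ℕ} {k : Γ} {u : Omega ε 𝒜} (hu : u ∈ OmegaHom ε 𝒜 n k)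
    (h : H.evalOmega ε n u = 0) : u = 0 := by
  induction n generalizing k u with
  | zero =>
    obtain ⟨a, ha, rfl⟩ := omegaHom_zero hu
    have := congrArg (fun f => f ![]) h
    simp only [H.evalOmega_zero, omegaProj_inc] at this
    rw [this]
    exact map_zero _
  | succ n ih =>
    refine H.eq_zero_of_contr hu fun α x hx => ih (H.contr_mem hu hx) ?_
    ext y
    rw [← H.evalOmega_cons, h]
    rfl

theorem evalOmega_injOn {n : ℕ} {k : Γ} {u v : Omega ε 𝒜} (hu : u ∈ OmegaHom ε 𝒜 n k)
    (hv : v ∈ OmegaHom ε 𝒜 n k) (h : H.evalOmega ε n u = H.evalOmega ε n v) : u = v :=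
  sub_eq_zero.1 (H.eq_zero_of_evalOmega (sub_mem hu hv) (by rw [map_sub, h, sub_self]))

theorem evalOmega_mul_center {n : ℕ} {β : Γ} {z : A} (hz : z ∈ 𝒜 β) (u : Omega ε 𝒜)
    (d : Fin n → Γ) (x : Fin n → complI ε 𝒜) (hx : ∀ i, (x i : A) ∈ 𝒜 (d i)) :
    H.evalOmega ε n (u * omegaInc ε 𝒜 z) x
      = (∏ i, ε.val β (d i)) • (H.evalOmega ε n u x * z) := by
  induction n generalizing u with
  | zero => simp [H.evalOmega_zero, omegaProj_inc]
  | succ n ih =>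
    rw [H.evalOmega_succ, H.contr_mul (hx 0), H.contr_inc, mul_zero, zero_add, omegaTwist_inc hz,
      mul_smul_comm, map_smul, smul_apply, ih _ (fun i => d i.succ) (Fin.tail x) fun i => hx i.succ,
      smul_smul, Fin.prod_univ_succ, H.evalOmega_succ]

end IsFineDivision

theorem IsFormI.curryLeft {n : ℕ} {k α : Γ}
    {ω : MultilinearMap ℂ (fun _ : Fin (n + 1) => complI ε 𝒜) A} (hω : IsFormI ε 𝒜 (n + 1) k ω)
    {x : complI ε 𝒜} (hx : (x : A) ∈ 𝒜 α) : IsFormI ε 𝒜 n (k + α) (ω.curryLeft x) := by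
  have hc : ∀ {d : Fin n → Γ} {y : Fin n → complI ε 𝒜}, (∀ i, (y i : A) ∈ 𝒜 (d i)) →
      ∀ i : Fin (n + 1), (Fin.cons (α := fun _ => complI ε 𝒜) x y i : A)
        ∈ 𝒜 (Fin.cons (α := fun _ => Γ) α d i) := fun hy i => by
    induction i using Fin.cases with
    | zero => exact hx
    | succ i => exact hy i
  refine ⟨fun d y hy => ?_, fun d y hy β z hz hzβ i hi y' hy' => ?_, fun d y hy i j hij => ?_⟩
  · have := hω.deg _ _ (hc hy)
    rw [Fin.sum_univ_succ, Fin.cons_zero, ← add_assoc] at this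
    simpa using this
  · rw [MultilinearMap.curryLeft_apply, MultilinearMap.curryLeft_apply, Fin.cons_update]
    exact hω.lin _ _ (hc hy) β z hz hzβ i.succ (by simpa using hi) y' (by simpa using hy')
  · have := hω.swap _ _ (hc hy) i.succ j.succ (by simpa using hij)
    rw [MultilinearMap.curryLeft_apply, MultilinearMap.curryLeft_apply, this, Fin.cons_succ,
      Fin.cons_succ]
    congr 3
    funext a
    induction a using Fin.cases with
    | zero =>
      rw [Function.comp_apply, Equiv.swap_apply_of_ne_of_ne (Fin.succ_ne_zero _).symm
            (Fin.succ_ne_zero _).symm]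
      rfl
    | succ a =>
      rw [Function.comp_apply, (Fin.succ_injective n).swap_apply]
      rfl

theorem IsFormI.swap_cons {n : ℕ} {k α β : Γ}
    {ω : MultilinearMap ℂ (fun _ : Fin (n + 2) => complI ε 𝒜) A} (hω : IsFormI ε 𝒜 (n + 2) k ω)
    {x y : complI ε 𝒜} (hx : (x : A) ∈ 𝒜 α) (hy : (y : A) ∈ 𝒜 β) {d : Fin n → Γ}
    {r : Fin n → complI ε 𝒜} (hr : ∀ i, (r i : A) ∈ 𝒜 (d i)) :
    ω (Fin.cons x (Fin.cons y r : Fin (n + 1) → complI ε 𝒜))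
      = -(ε.val α β • ω (Fin.cons y (Fin.cons x r : Fin (n + 1) → complI ε 𝒜))) := by
  have := hω.swap (Fin.cons α (Fin.cons β d : Fin (n + 1) → Γ))
    (Fin.cons x (Fin.cons y r : Fin (n + 1) → complI ε 𝒜)) (fun i => by
      induction i using Fin.cases with
      | zero => exact hx
      | succ i =>
        induction i using Fin.cases with
        | zero => exact hy
        | succ i => exact hr i) 0 1 rfl
  rw [this]
  congr 3
  funext a
  rw [Function.comp_apply]
  induction a using Fin.cases with
  | zero => simp
  | succ a =>
    induction a using Fin.cases with
    | zero => simp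
    | succ a =>
      rw [Equiv.swap_apply_of_ne_of_ne (Fin.succ_ne_zero _) (by simp [Fin.ext_iff])]
      rfl

/-- Linearity over the `ε`-center in the first argument. -/
theorem IsFormI.first_lin {n : ℕ} {k α β : Γ}
    {ω : MultilinearMap ℂ (fun _ : Fin (n + 1) => complI ε 𝒜) A} (hω : IsFormI ε 𝒜 (n + 1) k ω)
    {x y : complI ε 𝒜} (hx : (x : A) ∈ 𝒜 α) {z : A} (hz : z ∈ center ε 𝒜) (hzβ : z ∈ 𝒜 β)
    (hy : (y : A) = x * z) {d : Fin n → Γ} {r : Fin n → complI ε 𝒜}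
    (hr : ∀ i, (r i : A) ∈ 𝒜 (d i)) :
    ω (Fin.cons y r) = (∏ i, ε.val β (d i)) • (ω (Fin.cons x r) * z) := by
  have hym : (y : A) ∈ 𝒜 (α + β) := hy ▸ SetLike.GradedMul.mul_mem hx hzβ
  induction n generalizing k with
  | zero =>
    have := hω.lin (fun _ => α) (Fin.cons x r) (fun i => by rwa [Fin.fin_one_eq_zero i]) β z hz hzβ
      0 rfl y hy
    rw [Fin.update_cons_zero] at this
    rw [this]
    simp
  | succ n ih =>
    obtain ⟨r0, r, rfl⟩ : ∃ r0 r', r = Fin.cons r0 r' := ⟨r 0, Fin.tail r, (Fin.cons_self_tail r).symm⟩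
    have h0 : (r0 : A) ∈ 𝒜 (d 0) := hr 0
    have hr' : ∀ i, (r i : A) ∈ 𝒜 (d i.succ) := fun i => hr i.succ
    -- The first two arguments are exchanged, the induction hypothesis is used with r0 fixed in
    -- front, and they are exchanged back.
    have h1 := ih (hω.curryLeft h0) hr'
    rw [MultilinearMap.curryLeft_apply, MultilinearMap.curryLeft_apply] at h1
    rw [hω.swap_cons hym h0 hr', h1, hω.swap_cons hx h0 hr', Fin.prod_univ_succ, neg_mul, smul_neg,
      smul_mul_assoc, smul_smul, smul_smul, ε.val_add_left]
    congr 2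
    ring

namespace IsFineDivision

variable (H : IsFineDivision 𝒜)

/-- Surjectivity, by induction on n. Each partial form ω(x, ·) is the evaluation of some w(x),
chosen on the basis and extended linearly. Injectivity of evaluation carries Z-linearity in x and
antisymmetry from ω over to w, and these are the hypotheses under which `integ` produces an element
with contractions w(x). -/
theorem exists_evalOmega {n : ℕ} {k : Γ} {ω : MultilinearMap ℂ (fun _ : Fin n => complI ε 𝒜) A}
    (hω : IsFormI ε 𝒜 n k ω) : ∃ u ∈ OmegaHom ε 𝒜 n k, H.evalOmega ε n u = ω := by
  induction n generalizing k with
  | zero =>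
    refine ⟨omegaInc ε 𝒜 (ω ![]), omegaInc_mem ?_, ?_⟩
    · have := hω.deg ![] ![] fun i => i.elim0
      rwa [Fin.sum_univ_zero, add_zero] at this
    · ext x
      rw [H.evalOmega_zero, omegaProj_inc, Subsingleton.elim x ![]]
  | succ n ih =>
    choose F hF1 hF2 using fun α => ih (hω.curryLeft (basisI_mem (ε := ε) (𝒜 := 𝒜) α))
    obtain ⟨w, hw⟩ := H.exists_linearMap F
    have hwm : ∀ {α} {x : complI ε 𝒜}, (x : A) ∈ 𝒜 α → w x ∈ OmegaHom ε 𝒜 n (k + α) := by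
      intro α x hx
      obtain rfl | ⟨hα, c, rfl⟩ := H.complI_cases x hx
      · rw [map_zero]; exact zero_mem _
      · rw [map_smul, hw α hα]; exact Submodule.smul_mem _ c (hF1 α)
    have hwe : ∀ x, H.evalOmega ε n (w x) = ω.curryLeft x := fun x => by
      have : H.evalOmega ε n ∘ₗ w = ω.curryLeft := H.complI_ext_basis fun α hα => by
        rw [LinearMap.comp_apply, hw α hα, hF2]
      exact congrArg (fun f => f x) this
    have hz : ∀ {α γ : Γ} {x y : complI ε 𝒜} {z : A}, (x : A) ∈ 𝒜 α → z ∈ center ε 𝒜 →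
        z ∈ 𝒜 γ → (y : A) = x * z → w y = w x * omegaInc ε 𝒜 z := by
      intro α γ x y z hx hz hzγ hy
      have hym : (y : A) ∈ 𝒜 (α + γ) := hy ▸ SetLike.GradedMul.mul_mem hx hzγ
      refine H.evalOmega_injOn (hwm hym) (by
        rw [← add_assoc]; exact mul_omegaInc_mem (hwm hx) hzγ) ?_
      refine multilinear_ext fun d r hr => ?_
      rw [H.evalOmega_mul_center hzγ _ d r hr, hwe, hwe, MultilinearMap.curryLeft_apply,
        MultilinearMap.curryLeft_apply, hω.first_lin hx hz hzγ hy hr]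
    have hanti : ∀ {α β : Γ} {x y : complI ε 𝒜}, (x : A) ∈ 𝒜 α → (y : A) ∈ 𝒜 β →
        H.contr ε y (w x) = -(ε.val α β • H.contr ε x (w y)) := by
      intro α β x y hx hy
      cases n with
      | zero => rw [H.contr_zero_mem (hwm hx), H.contr_zero_mem (hwm hy), smul_zero, neg_zero]
      | succ n =>
        refine H.evalOmega_injOn (H.contr_mem (hwm hx) hy) (neg_mem (Submodule.smul_mem _ _ (by
          have := H.contr_mem (hwm hy) hx
          rwa [add_right_comm] at this))) ?_
        refine multilinear_ext fun d r hr => ?_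
        rw [map_neg, map_smul, neg_apply, smul_apply, ← H.evalOmega_cons, ← H.evalOmega_cons, hwe,
          hwe, MultilinearMap.curryLeft_apply, MultilinearMap.curryLeft_apply,
          hω.swap_cons hx hy hr]
    refine ⟨H.integ ε n w, H.integ_mem hwm, ?_⟩
    ext x
    rw [H.evalOmega_succ, H.contr_integ hwm hz hanti, hwe, MultilinearMap.curryLeft_apply,
      Fin.cons_self_tail]

end IsFineDivision

end FormsOnComplement

end EpsGraded

end

/-! ### The push-forward as an isomorphism of bigraded algebras. -/

noncomputable section

namespace EpsGraded

section PushForward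

set_option linter.unusedSectionVars false

variable {Γ : Type*} [AddCommGroup Γ] [DecidableEq Γ] {A : Type*} [Ring A] [Algebra ℂ A]
variable {ε : CommFactor Γ} {𝒜 : Γ → Submodule ℂ A} [GradedAlgebra 𝒜]

/-! ### The push-forward by the adjoint map -/

theorem formPart_lof {n : ℕ} {k : Γ} (ω : Form ε 𝒜 n k) :
    formPart ε 𝒜 n (DirectSum.lof ℂ (ℕ × Γ) (fun p => Form ε 𝒜 p.1 p.2) (n, k) ω) = ω.1 := by
  rw [formPart, DirectSum.toModule_lof, dif_pos rfl]
  rfl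

theorem formPart_lof_of_ne {m n : ℕ} {k : Γ} (ω : Form ε 𝒜 n k) (h : n ≠ m) :
    formPart ε 𝒜 m (DirectSum.lof ℂ (ℕ × Γ) (fun p => Form ε 𝒜 p.1 p.2) (n, k) ω) = 0 := by
  rw [formPart, DirectSum.toModule_lof, dif_neg h]
  rfl

/-- The homogeneous components of a form are determined by the components of its values. -/
theorem decompose_formPart {n : ℕ} (k : Γ) (f : Forms ε 𝒜) (d : Fin n → Γ) (X : Fin n → Der ε 𝒜)
    (hX : ∀ i, (X i : A →ₗ[ℂ] A) ∈ DerHom ε 𝒜 (d i)) :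
    (DirectSum.decompose 𝒜 (formPart ε 𝒜 n f X) (k + ∑ i, d i) : A) = (f (n, k)).1 X := by
  induction f using DirectSum.induction_on with
  | zero => simp
  | add f g hf hg =>
    rw [map_add, add_apply, DirectSum.decompose_add, DirectSum.add_apply, Submodule.coe_add, hf, hg]
    rfl
  | of p ω =>
    obtain ⟨m, l⟩ := p
    rw [← DirectSum.lof_eq_of ℂ]
    by_cases hm : m = n
    · subst hm
      rw [formPart_lof]
      by_cases hl : l = k
      · subst hl
        rw [DirectSum.decompose_of_mem_same _ (ω.2.1 d X hX), DirectSum.lof_apply]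
      · rw [DirectSum.decompose_of_mem_ne _ (ω.2.1 d X hX) (by simpa using hl), DirectSum.lof_eq_of,
          DirectSum.of_eq_of_ne _ _ _ (by simpa using Ne.symm hl)]
        rfl
    · rw [formPart_lof_of_ne _ hm, DirectSum.lof_eq_of,
          DirectSum.of_eq_of_ne _ _ _ (by simpa using fun h => absurd h.symm hm)]
      simp

namespace IsFineDivision

variable (H : IsFineDivision 𝒜)

include H in
theorem multilinear_der_ext {n : ℕ} {f g : MultilinearMap ℂ (fun _ : Fin n => Der ε 𝒜) A}
    (h : ∀ x : Fin n → complI ε 𝒜, f (fun i => adI ε 𝒜 (x i)) = g fun i => adI ε 𝒜 (x i)) :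
    f = g := by
  ext X
  have := h fun i => (H.adEquiv ε).symm (X i)
  have e : (fun i => adI ε 𝒜 ((H.adEquiv ε).symm (X i))) = X :=
    funext fun i => (H.adEquiv ε).apply_symm_apply (X i)
  rwa [e] at this

-- `formPart` adds up components of different Γ-degrees. On homogeneous arguments their values lie
-- in different degrees of A, so `decompose_formPart` recovers each of them.
include H in
theorem forms_ext {f g : Forms ε 𝒜} (h : ∀ n, formPart ε 𝒜 n f = formPart ε 𝒜 n g) : f = g := by
  refine DFinsupp.ext fun p => Subtype.ext (H.multilinear_der_ext fun x => ?_)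
  obtain ⟨n, k⟩ := p
  have : (f (n, k)).1.compLinearMap (fun _ => adI ε 𝒜)
      = (g (n, k)).1.compLinearMap (fun _ => adI ε 𝒜) :=
    multilinear_ext fun d x hx => by
      rw [MultilinearMap.compLinearMap_apply, MultilinearMap.compLinearMap_apply,
        ← decompose_formPart k f d _ fun i => adI_mem (hx i), h,
        decompose_formPart k g d _ fun i => adI_mem (hx i)]
  exact congrArg (fun F => F x) this

variable (ε) in
/-- The `n`-form on `ε`-derivations defined by the part of exterior degree `n`. -/
def toForm (n : ℕ) : Omega ε 𝒜 →ₗ[ℂ] MultilinearMap ℂ (fun _ : Fin n => Der ε 𝒜) A :=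
  MultilinearMap.compLinearMapₗ (fun _ => (H.adEquiv ε).symm.toLinearMap) ∘ₗ H.evalOmega ε n

theorem toForm_adI {n : ℕ} (u : Omega ε 𝒜) (x : Fin n → complI ε 𝒜) :
    H.toForm ε n u (fun i => adI ε 𝒜 (x i)) = H.evalOmega ε n u x := by
  change H.evalOmega ε n u (fun i => (H.adEquiv ε).symm (H.adEquiv ε (x i))) = _
  simp only [LinearEquiv.symm_apply_apply]

theorem toForm_mem {n : ℕ} {k : Γ} {u : Omega ε 𝒜} (hu : u ∈ OmegaHom ε 𝒜 n k) :
    H.toForm ε n u ∈ Form ε 𝒜 n k := H.mem_form (H.evalOmega_isFormI hu)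

theorem toForm_restrict_bijective (n : ℕ) (k : Γ) :
    Function.Bijective ((H.toForm ε n).restrict (p := OmegaHom ε 𝒜 n k) (q := Form ε 𝒜 n k)
      fun _ hu => H.toForm_mem hu) := by
  refine ⟨(injective_iff_map_eq_zero _).2 fun u hu => Subtype.ext ?_, fun ω => ?_⟩
  · refine H.eq_zero_of_evalOmega u.2 ?_
    ext x
    rw [← H.toForm_adI, show H.toForm ε n u = 0 from congrArg Subtype.val hu]
    rfl
  · obtain ⟨u, hu, h⟩ := H.exists_evalOmega (form_compLinearMap ω.2)
    refine ⟨⟨u, hu⟩, Subtype.ext (H.multilinear_der_ext fun x => ?_)⟩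
    change H.toForm ε n u _ = _
    rw [H.toForm_adI, h]
    rfl

variable (ε) in
/-- Evaluation as an isomorphism from the elements of bidegree `(n, k)` onto `Ω^{n,k}`. -/
def formEquiv (n : ℕ) (k : Γ) : OmegaHom ε 𝒜 n k ≃ₗ[ℂ] Form ε 𝒜 n k :=
  LinearEquiv.ofBijective _ (H.toForm_restrict_bijective n k)

theorem formPart_formEquiv (n : ℕ) (f : ⨁ p : ℕ × Γ, OmegaHom ε 𝒜 p.1 p.2) :
    formPart ε 𝒜 n (DFinsupp.mapRange.linearEquiv (fun p : ℕ × Γ => H.formEquiv ε p.1 p.2) f)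
      = H.toForm ε n (DirectSum.coeLinearMap (fun p : ℕ × Γ => OmegaHom ε 𝒜 p.1 p.2) f) := by
  have key : formPart ε 𝒜 n ∘ₗ
      (DFinsupp.mapRange.linearEquiv fun p : ℕ × Γ => H.formEquiv ε p.1 p.2).toLinearMap
      = H.toForm ε n ∘ₗ DirectSum.coeLinearMap (fun p : ℕ × Γ => OmegaHom ε 𝒜 p.1 p.2) := by
    refine DirectSum.linearMap_ext ℂ fun p => LinearMap.ext fun u => ?_
    obtain ⟨m, l⟩ := p
    have e : DFinsupp.mapRange.linearMap (fun p : ℕ × Γ => (H.formEquiv ε p.1 p.2).toLinearMap)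
        (DirectSum.lof ℂ (ℕ × Γ) (fun p => OmegaHom ε 𝒜 p.1 p.2) (m, l) u)
        = DirectSum.lof ℂ (ℕ × Γ) (fun p => Form ε 𝒜 p.1 p.2) (m, l) (H.formEquiv ε m l u) :=
      DirectSum.lmap_lof (fun p : ℕ × Γ => (H.formEquiv ε p.1 p.2).toLinearMap) (m, l) u
    simp only [LinearMap.comp_apply]
    rw [DirectSum.coeLinearMap_lof]
    refine (congrArg (formPart ε 𝒜 n) e).trans ?_
    by_cases hm : m = n
    · subst hm
      rw [formPart_lof]
      rfl
    · rw [formPart_lof_of_ne _ hm]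
      refine (H.multilinear_der_ext fun x => ?_)
      rw [H.toForm_adI, H.evalOmega_of_ne u.2 (Ne.symm hm)]
      rfl
  exact congrArg (fun F => F f) key

-- Independence of the bigraded components of T is pulled back from `Forms`, which is a direct sum
-- by construction: a family with sum zero has zero evaluations, hence zero image there, and
-- `formEquiv` is injective on each component.
include H in
theorem coeLinearMap_bijective :
    Function.Bijective (DirectSum.coeLinearMap (fun p : ℕ × Γ => OmegaHom ε 𝒜 p.1 p.2)) := by
  refine ⟨(injective_iff_map_eq_zero _).2 fun f hf => ?_, LinearMap.range_eq_top.1 ?_⟩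
  · rw [← LinearEquiv.map_eq_zero_iff
      (DFinsupp.mapRange.linearEquiv (fun p : ℕ × Γ => H.formEquiv ε p.1 p.2))]
    refine H.forms_ext fun n => ?_
    rw [H.formPart_formEquiv, hf, map_zero, map_zero]
  · rw [DirectSum.range_coeLinearMap, eq_top_iff]
    exact fun u _ => omega_span u

variable (ε) in
/-- The push-forward by the adjoint map. -/
def adPush : Omega ε 𝒜 ≃ₗ[ℂ] Forms ε 𝒜 :=
  (LinearEquiv.ofBijective _ H.coeLinearMap_bijective).symm ≪≫ₗ
    DFinsupp.mapRange.linearEquiv fun p : ℕ × Γ => H.formEquiv ε p.1 p.2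

theorem formPart_adPush (n : ℕ) (u : Omega ε 𝒜) :
    formPart ε 𝒜 n (H.adPush ε u) = H.toForm ε n u := by
  rw [adPush, LinearEquiv.trans_apply, H.formPart_formEquiv]
  exact congrArg _ ((LinearEquiv.ofBijective _ H.coeLinearMap_bijective).apply_symm_apply u)

theorem isAdPush : IsAdPush ε 𝒜 (H.evalOmega ε) (H.adPush ε) := fun u n x => by
  rw [H.formPart_adPush, H.toForm_adI]

theorem eq_adPush {ψ : Omega ε 𝒜 → Forms ε 𝒜} (hψ : IsAdPush ε 𝒜 (H.evalOmega ε) ψ) :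
    ψ = H.adPush ε := by
  funext u
  refine H.forms_ext fun n => H.multilinear_der_ext fun x => ?_
  rw [hψ, H.isAdPush]

theorem adPush_of_mem {n : ℕ} {k : Γ} {u : Omega ε 𝒜} (hu : u ∈ OmegaHom ε 𝒜 n k) :
    H.adPush ε u = DirectSum.lof ℂ (ℕ × Γ) (fun p => Form ε 𝒜 p.1 p.2) (n, k)
      (H.formEquiv ε n k ⟨u, hu⟩) := by
  refine H.forms_ext fun m => ?_
  rw [H.formPart_adPush]
  by_cases hm : n = m
  · subst hm
    rw [formPart_lof]
    rfl
  · rw [formPart_lof_of_ne _ hm]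
    refine (H.multilinear_der_ext fun x => ?_)
    rw [H.toForm_adI, H.evalOmega_of_ne hu (Ne.symm hm)]
    rfl

theorem map_adPush (n : ℕ) (k : Γ) :
    (OmegaHom ε 𝒜 n k).map (H.adPush ε : Omega ε 𝒜 →ₗ[ℂ] Forms ε 𝒜)
      = LinearMap.range (DirectSum.lof ℂ (ℕ × Γ) (fun p => Form ε 𝒜 p.1 p.2) (n, k)) := by
  ext f
  constructor
  · rintro ⟨u, hu, rfl⟩
    exact ⟨_, (H.adPush_of_mem hu).symm⟩
  · rintro ⟨ω, rfl⟩
    refine ⟨(H.formEquiv ε n k).symm ω, ((H.formEquiv ε n k).symm ω).2, ?_⟩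
    rw [LinearEquiv.coe_coe, H.adPush_of_mem ((H.formEquiv ε n k).symm ω).2, Subtype.coe_eta,
      LinearEquiv.apply_symm_apply]

theorem formPart_adPush_one (X : Fin 0 → Der ε 𝒜) : formPart ε 𝒜 0 (H.adPush ε 1) X = 1 := by
  rw [H.formPart_adPush]
  change H.evalOmega ε 0 1 (fun i => (H.adEquiv ε).symm (X i)) = 1
  rw [H.evalOmega_zero, map_one]

theorem isFormProduct_adPush {p q : ℕ} {k l : Γ} {u v : Omega ε 𝒜} (hu : u ∈ OmegaHom ε 𝒜 p k)
    (hv : v ∈ OmegaHom ε 𝒜 q l) :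
    IsFormProduct ε 𝒜 l (formPart ε 𝒜 p (H.adPush ε u)) (formPart ε 𝒜 q (H.adPush ε v))
      (formPart ε 𝒜 (p + q) (H.adPush ε (u * v))) := by
  intro d X hX
  rw [H.formPart_adPush, H.formPart_adPush, H.formPart_adPush]
  exact H.evalOmega_mul rfl hu hv d _ fun i => H.adEquiv_symm_mem (hX i)

end IsFineDivision

end PushForward

end EpsGraded

end

/-! ### Connections and one-forms of degree zero. -/

noncomputable section

namespace EpsGraded

section OneForms

set_option linter.unusedSectionVars false

variable {Γ : Type*} [AddCommGroup Γ] [DecidableEq Γ] {A : Type*} [Ring A] [Algebra ℂ A]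
variable {ε : CommFactor Γ} {𝒜 : Γ → Submodule ℂ A} [GradedAlgebra 𝒜]

/-! ### Connections -/

theorem epsFlip_of_mem_right {β : Γ} (a : A) {b : A} (hb : b ∈ 𝒜 β) :
    epsFlip ε 𝒜 a b = b * twist ε 𝒜 β a := by
  have h := epsBracket_of_mem_right ε a hb
  rw [epsBracket, LinearMap.sub_apply, LinearMap.sub_apply, LinearMap.mul_apply'] at h
  exact sub_right_injective h

theorem twist_twist (β γ : Γ) (a : A) :
    twist ε 𝒜 β (twist ε 𝒜 γ a) = twist ε 𝒜 (γ + β) a := by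
  have : twistLin ε 𝒜 β ∘ₗ twistLin ε 𝒜 γ = twistLin ε 𝒜 (γ + β) := lin_ext 𝒜 fun α a ha => by
    rw [LinearMap.comp_apply, twistLin_of_mem ε ha, twistLin_of_mem ε ha, map_smul,
      twistLin_of_mem ε ha, ε.val_add_right, smul_smul]
  exact congrArg (fun f => f a) this

/-- The `ε`-bracket with a central element in the second place vanishes. -/
theorem epsBracket_center_right {β : Γ} {z : A} (hz : z ∈ center ε 𝒜) (hzβ : z ∈ 𝒜 β) (a : A) :
    epsBracket ε 𝒜 a z = 0 := by
  have : (epsBracket ε 𝒜).flip z = 0 := lin_ext 𝒜 fun α a ha => by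
    rw [LinearMap.flip_apply, epsBracket_of_mem ε ha hzβ, center_comm hz hzβ ha, smul_smul,
      ε.val_mul_swap, one_smul, sub_self, LinearMap.zero_apply]
  exact congrArg (fun f => f a) this

variable (ε) in
/-- The product `ω a` of a one-form and an element of the algebra, as a linear map in `a`. -/
def oneFormMul (ω : MultilinearMap ℂ (fun _ : Fin 1 => Der ε 𝒜) A) :
    A →ₗ[ℂ] MultilinearMap ℂ (fun _ : Fin 1 => Der ε 𝒜) A where
  -- For ω of degree 0 the value ω(X) has degree |X|, so `epsFlip` yields ε(|a|, |X|) ω(X) a while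
  -- being linear in a and X.
  toFun a := (epsFlip ε 𝒜 a).compMultilinearMap ω
  map_add' a b := by ext X; simp
  map_smul' c a := by ext X; simp

theorem oneFormMul_apply {ω : MultilinearMap ℂ (fun _ : Fin 1 => Der ε 𝒜) A}
    (hω : ω ∈ Form ε 𝒜 1 0) (a : A) {γ : Γ} {X : Fin 1 → Der ε 𝒜} (hX : (X 0).1 ∈ DerHom ε 𝒜 γ) :
    oneFormMul ε ω a X = ω X * twist ε 𝒜 γ a := by
  have h : ω X ∈ 𝒜 γ := by
    have := hω.1 (fun _ => γ) X fun i => by rwa [Fin.fin_one_eq_zero i]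
    simpa using this
  exact epsFlip_of_mem_right a h

theorem mem_form_one {k : Γ} {ω : MultilinearMap ℂ (fun _ : Fin 1 => Der ε 𝒜) A}
    (h1 : ∀ γ (X : Fin 1 → Der ε 𝒜), (X 0).1 ∈ DerHom ε 𝒜 γ → ω X ∈ 𝒜 (k + γ))
    (h2 : ∀ γ (X Y : Fin 1 → Der ε 𝒜), (X 0).1 ∈ DerHom ε 𝒜 γ → ∀ β, ∀ z ∈ center ε 𝒜, z ∈ 𝒜 β →
      (Y 0).1 = ε.val γ β • (LinearMap.mulLeft ℂ z ∘ₗ (X 0).1) → ω Y = ω X * z) :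
    ω ∈ Form ε 𝒜 1 k := by
  refine ⟨fun d X hX => ?_, fun d X hX β z hz hzβ i _ => ?_, fun d X hX i j hij => ?_⟩
  · rw [Fin.sum_univ_one]
    exact h1 _ X (hX 0)
  · obtain rfl := Fin.fin_one_eq_zero i
    refine h2 (d 0) X _ (hX 0) β z hz hzβ ?_
    rw [Function.update_self]
  · omega

theorem oneFormMul_mem {ω : MultilinearMap ℂ (fun _ : Fin 1 => Der ε 𝒜) A}
    (hω : ω ∈ Form ε 𝒜 1 0) {k : Γ} {a : A} (ha : a ∈ 𝒜 k) : oneFormMul ε ω a ∈ Form ε 𝒜 1 k := by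
  refine mem_form_one (fun γ X hX => ?_) fun γ X Y hX β z hz hzβ hY => ?_
  · rw [oneFormMul_apply hω a hX, twist_of_mem ε ha, mul_smul_comm]
    have := hω.1 (fun _ => γ) X fun i => by rwa [Fin.fin_one_eq_zero i]
    rw [Fin.sum_univ_one, zero_add] at this
    rw [add_comm]
    exact Submodule.smul_mem _ _ (SetLike.GradedMul.mul_mem this ha)
  · have hYm : (Y 0).1 ∈ DerHom ε 𝒜 (γ + β) := hY ▸ centerMul_mem hX hz hzβ
    have h := hω.2.1 (fun _ => γ) X (fun i => by rwa [Fin.fin_one_eq_zero i]) β z hz hzβ 0 rfl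
    have e : Function.update X 0
        ⟨ε.val γ β • (LinearMap.mulLeft ℂ z ∘ₗ (X 0).1),
          DerHom_le_Der ε 𝒜 _ (centerMul_mem hX hz hzβ)⟩ = Y := by
      funext i
      obtain rfl := Fin.fin_one_eq_zero i
      rw [Function.update_self]
      exact Subtype.ext hY.symm
    rw [e] at h
    rw [oneFormMul_apply hω a hX, oneFormMul_apply hω a hYm, h, twist_of_mem ε ha,
      twist_of_mem ε ha, mul_smul_comm, mul_smul_comm, smul_mul_assoc, mul_assoc, mul_assoc,
      center_comm hz hzβ ha, mul_smul_comm, smul_smul, ε.val_add_right, mul_assoc, ε.val_mul_swap,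
      mul_one]

namespace IsFineDivision

variable (H : IsFineDivision 𝒜)

variable (ε) in
/-- The differential of the elements of the algebra: `da(X) = ε(|a|, |X|) X(a)`. -/
def diffZero : A →ₗ[ℂ] MultilinearMap ℂ (fun _ : Fin 1 => Der ε 𝒜) A where
  -- With X = ad_x one has ε(|a|, |x|) [x, a] = -[a, x], and the right side is bilinear without
  -- mention of degrees.
  toFun a := MultilinearMap.ofSubsingleton ℂ (Der ε 𝒜) A (0 : Fin 1)
    (-(epsBracket ε 𝒜 a ∘ₗ (complI ε 𝒜).subtype ∘ₗ (H.adEquiv ε).symm.toLinearMap))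
  map_add' a b := by ext X; simp; abel
  map_smul' c a := by ext X; simp

theorem diffZero_apply (a : A) (X : Fin 1 → Der ε 𝒜) :
    H.diffZero ε a X = -epsBracket ε 𝒜 a ((H.adEquiv ε).symm (X 0)) := rfl

theorem diffZero_mem_connections : H.diffZero ε ∈ Connections ε 𝒜 := by
  refine ⟨fun k a ha => mem_form_one (fun γ X hX => ?_) fun γ X Y hX β z hz hzβ hY => ?_,
    fun a β b hb γ X hX => ?_⟩
  · rw [H.diffZero_apply, add_comm]
    exact neg_mem ((ad_mem_DerHom ha).1 _ _ (H.adEquiv_symm_mem hX))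
  · have hx := H.adEquiv_symm_mem hX
    have e : (H.adEquiv ε).symm (Y 0)
        = ⟨_, H.complI_mul ((H.adEquiv ε).symm (X 0)).2 hz⟩ := by
      rw [LinearEquiv.symm_apply_eq]
      refine Subtype.ext (hY.trans ?_)
      change _ = epsBracket ε 𝒜 (((H.adEquiv ε).symm (X 0) : A) * z)
      rw [epsBracket_mul_center hx hz hzβ]
      congr 2
      exact (congrArg Subtype.val ((H.adEquiv ε).apply_symm_apply (X 0))).symm
    have : ∀ a, epsBracket ε 𝒜 a (((H.adEquiv ε).symm (X 0) : A) * z)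
        = epsBracket ε 𝒜 a ((H.adEquiv ε).symm (X 0)) * z := fun a => by
      have h0 := epsBracket_center_right hz hzβ (twist ε 𝒜 γ a)
      rw [epsBracket_of_mem_right ε _ hzβ, sub_eq_zero] at h0
      have h1 := epsBracket_of_mem_right ε a (SetLike.GradedMul.mul_mem hx hzβ)
      rw [h1, epsBracket_of_mem_right ε a hx, sub_mul, mul_assoc _ (twist ε 𝒜 γ a), h0, mul_assoc,
        mul_assoc, twist_twist]
    rw [H.diffZero_apply, H.diffZero_apply, e, this, neg_mul]
  · have hx := H.adEquiv_symm_mem hX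
    have e : epsBracket ε 𝒜 ((H.adEquiv ε).symm (X 0)) = (X 0).1 :=
      congrArg Subtype.val ((H.adEquiv ε).apply_symm_apply (X 0))
    rw [H.diffZero_apply, H.diffZero_apply, ← e, epsBracket_of_mem_right ε _ hx,
      epsBracket_of_mem_right ε _ hx, epsBracket_of_mem ε hx hb, map_mul, twist_of_mem ε hb]
    have h := ε.val_mul_swap β γ
    simp only [neg_mul, sub_mul, mul_sub, smul_sub, mul_smul_comm, smul_smul, h, mul_assoc,
      one_smul, smul_neg]
    abel

theorem connections_add_mem {N : A →ₗ[ℂ] MultilinearMap ℂ (fun _ : Fin 1 => Der ε 𝒜) A}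
    (hN : N ∈ Connections ε 𝒜) {ω : MultilinearMap ℂ (fun _ : Fin 1 => Der ε 𝒜) A}
    (hω : ω ∈ Form ε 𝒜 1 0) : N + oneFormMul ε ω ∈ Connections ε 𝒜 := by
  refine ⟨fun k a ha => add_mem (hN.1 k a ha) (oneFormMul_mem hω ha), fun a β b hb γ X hX => ?_⟩
  rw [LinearMap.add_apply, add_apply, hN.2 a β b hb γ X hX, oneFormMul_apply hω _ hX,
    LinearMap.add_apply, add_apply, oneFormMul_apply hω _ hX, map_mul, twist_of_mem ε hb, add_mul,
    smul_add, mul_smul_comm, mul_smul_comm, mul_assoc]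
  abel

theorem connections_sub_mem {N N' : A →ₗ[ℂ] MultilinearMap ℂ (fun _ : Fin 1 => Der ε 𝒜) A}
    (hN : N ∈ Connections ε 𝒜) (hN' : N' ∈ Connections ε 𝒜) : N 1 - N' 1 ∈ Form ε 𝒜 1 0 :=
  sub_mem (hN.1 0 1 SetLike.GradedOne.one_mem) (hN'.1 0 1 SetLike.GradedOne.one_mem)

include H in
theorem one_form_ext {ω η : MultilinearMap ℂ (fun _ : Fin 1 => Der ε 𝒜) A}
    (h : ∀ γ (X : Fin 1 → Der ε 𝒜), (X 0).1 ∈ DerHom ε 𝒜 γ → ω X = η X) : ω = η := by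
  refine H.multilinear_der_ext fun x => ?_
  have : ω.compLinearMap (fun _ => adI ε 𝒜) = η.compLinearMap (fun _ => adI ε 𝒜) :=
    multilinear_ext fun d x hx => h _ _ (adI_mem (hx 0))
  exact congrArg (fun f => f x) this

-- In the difference of two connections the terms a db cancel, so it is right linear over A and is
-- left multiplication by its value at 1.
include H in
theorem connections_sub {N N' : A →ₗ[ℂ] MultilinearMap ℂ (fun _ : Fin 1 => Der ε 𝒜) A}
    (hN : N ∈ Connections ε 𝒜) (hN' : N' ∈ Connections ε 𝒜) :
    oneFormMul ε (N 1 - N' 1) = N - N' := by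
  refine lin_ext 𝒜 fun α a ha => H.one_form_ext fun γ X hX => ?_
  have h1 := hN.2 1 α a ha γ X hX
  have h2 := hN'.2 1 α a ha γ X hX
  rw [one_mul] at h1 h2
  rw [oneFormMul_apply (connections_sub_mem hN hN') _ hX, LinearMap.sub_apply, sub_apply, sub_apply,
    h1, h2, twist_of_mem ε ha, mul_smul_comm, sub_mul, smul_sub]
  abel

theorem oneFormMul_one {ω : MultilinearMap ℂ (fun _ : Fin 1 => Der ε 𝒜) A}
    (H : IsFineDivision 𝒜) (hω : ω ∈ Form ε 𝒜 1 0) : oneFormMul ε ω 1 = ω :=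
  H.one_form_ext fun γ X hX => by rw [oneFormMul_apply hω _ hX, map_one, mul_one]

theorem oneFormMul_add (ω η : MultilinearMap ℂ (fun _ : Fin 1 => Der ε 𝒜) A) :
    oneFormMul ε (ω + η) = oneFormMul ε ω + oneFormMul ε η := by
  ext a X
  exact map_add (epsFlip ε 𝒜 a) (ω X) (η X)

variable (ε) in
/-- The affine space of `ε`-connections. -/
@[reducible]
def connectionsTorsor : AddTorsor (Form ε 𝒜 1 0) (Connections ε 𝒜) where
  vadd ω N := ⟨N.1 + oneFormMul ε ω.1, connections_add_mem N.2 ω.2⟩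
  vsub N N' := ⟨N.1 1 - N'.1 1, connections_sub_mem N.2 N'.2⟩
  nonempty := ⟨⟨_, H.diffZero_mem_connections⟩⟩
  zero_vadd N := Subtype.ext (by
    change N.1 + oneFormMul ε 0 = N.1
    rw [show oneFormMul ε (𝒜 := 𝒜) 0 = 0 by ext a X; exact map_zero (epsFlip ε 𝒜 a), add_zero])
  add_vadd ω η N := Subtype.ext (by
    change N.1 + oneFormMul ε (ω.1 + η.1) = N.1 + oneFormMul ε η.1 + oneFormMul ε ω.1
    rw [oneFormMul_add]
    abel)
  vsub_vadd' N N' := Subtype.ext (by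
    change N'.1 + oneFormMul ε (N.1 1 - N'.1 1) = N.1
    rw [H.connections_sub N.2 N'.2]
    abel)
  vadd_vsub' ω N := Subtype.ext (by
    change (N.1 + oneFormMul ε ω.1) 1 - N.1 1 = ω.1
    rw [LinearMap.add_apply, H.oneFormMul_one ω.2, add_sub_cancel_left])

theorem connectionsTorsor_vadd (ω : Form ε 𝒜 1 0) (N : Connections ε 𝒜) {β : Γ} {a : A}
    (ha : a ∈ 𝒜 β) {γ : Γ} {X : Fin 1 → Der ε 𝒜} (hX : (X 0).1 ∈ DerHom ε 𝒜 γ) :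
    ((H.connectionsTorsor ε).toAddAction.toVAdd.vadd ω N).1 a X
      = N.1 a X + ε.val β γ • (ω.1 X * a) := by
  change (N.1 + oneFormMul ε ω.1) a X = _
  rw [LinearMap.add_apply, add_apply, oneFormMul_apply ω.2 a hX, twist_of_mem ε ha, mul_smul_comm]

/-! ### One-forms of degree zero -/

include H in
theorem dualHom_apply_eq_zero {β γ : Γ} {θ : complI ε 𝒜 →ₗ[ℂ] A} (hθ : θ ∈ DualHom ε 𝒜 γ)
    {x : complI ε 𝒜} (hx : (x : A) ∈ 𝒜 β) (h : β + γ ∉ agree ε 𝒜) : θ x = 0 := by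
  by_contra h0
  exact h (H.agree_of_mem_center (hθ.2.1 β x hx) h0 (hθ.1 x))

-- An element of degree -α of the dual vanishes at e_β unless β is in the coset of α. In that coset
-- e_β = e_α z with z central, so the value at e_β is fixed by the value at e_α.
include H in
theorem dualHom_eq_of_eq {α : Γ} (hα : α ∉ agree ε 𝒜) {θ η : complI ε 𝒜 →ₗ[ℂ] A}
    (hθ : θ ∈ DualHom ε 𝒜 (-α)) (hη : η ∈ DualHom ε 𝒜 (-α))
    (h : ∀ x : complI ε 𝒜, (x : A) ∈ 𝒜 α → θ x = η x) : θ = η := by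
  refine H.complI_ext_basis fun β hβ => ?_
  by_cases hβα : β + -α ∈ agree ε 𝒜
  · have hβs := (H.mem_nonAgree.1 hβ).1
    have hαs : α ∈ Supp 𝒜 := by
      have := H.supp_sub hβs hβα.1
      rwa [show β - (β + -α) = α by abel] at this
    have hz : homInv 𝒜 α * homBasis 𝒜 β ∈ 𝒜 (β + -α) := by
      rw [add_comm]
      exact SetLike.GradedMul.mul_mem (H.homInv_mem α) (homBasis_mem β)
    have hzc := H.mem_center_of_agree hβα hz
    have e : (basisI ε 𝒜 α : A) * (homInv 𝒜 α * homBasis 𝒜 β) = basisI ε 𝒜 β := by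
      rw [basisI_coe hα, basisI_coe (H.mem_nonAgree.1 hβ).2, ← mul_assoc, H.mul_homInv hαs, one_mul]
    have e' : basisI ε 𝒜 β = ⟨_, H.complI_mul (basisI ε 𝒜 α).2 hzc⟩ := Subtype.ext e.symm
    rw [e', hθ.2.2 _ _ hzc, hη.2.2 _ _ hzc, h _ (basisI_mem α)]
  · rw [H.dualHom_apply_eq_zero hθ (basisI_mem β) hβα,
      H.dualHom_apply_eq_zero hη (basisI_mem β) hβα]

include H in
theorem existsUnique_dual {α : Γ} (hα : α ∉ agree ε 𝒜) (f : 𝒜 α →ₗ[ℂ] ℂ) :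
    ∃! θ : Dual ε 𝒜, θ.1 ∈ DualHom ε 𝒜 (-α) ∧
      ∀ (x : complI ε 𝒜) (hx : x.1 ∈ 𝒜 α), θ.1 x = algebraMap ℂ _ (f ⟨x, hx⟩) := by
  -- The witness is f(e_α) θ^α, because θ^α(e_α) = 1.
  refine existsUnique_of_exists_of_unique
    ⟨f ⟨_, homBasis_mem α⟩ • H.dualBasis ε α, Submodule.smul_mem _ _ (H.dualBasis_mem α),
      fun x hx => ?_⟩
    fun θ η hθ hη => Subtype.ext (H.dualHom_eq_of_eq hα hθ.1 hη.1 fun x hx => by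
      rw [hθ.2 x hx, hη.2 x hx])
  obtain rfl | ⟨hα', c, rfl⟩ := H.complI_cases x hx
  · have : f ⟨((0 : complI ε 𝒜) : A), hx⟩ = 0 := map_zero f
    rw [map_zero, this, map_zero]
  · have : f ⟨((c • basisI ε 𝒜 α : complI ε 𝒜) : A), hx⟩ = c * f ⟨_, homBasis_mem α⟩ := by
      rw [← smul_eq_mul, ← map_smul]
      congr 1
      exact Subtype.ext (congrArg (c • ·) (basisI_coe hα))
    have hz : projZ ε 𝒜 (1 : A) = 1 := H.projZ_center (one_mem _)
    rw [this]
    change f ⟨_, homBasis_mem α⟩ • (H.dualBasis ε α).1 _ = _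
    rw [H.dualBasis_apply, Submodule.coe_smul, basisI_coe hα, mul_smul_comm,
      H.homInv_mul (H.mem_nonAgree.1 hα').1, map_smul, hz, smul_smul, mul_comm,
      Algebra.algebraMap_eq_smul_one]

/-- In bidegree (1, 0) a monomial a ⊗ θ with |a| = α has |θ| = -α. If α is in `agree` then θ = 0: a
nonzero value at e_β would put β - α, hence β, in `agree`. So only the degrees outside `agree`
remain. -/
theorem form_one_zero :
    Form ε 𝒜 1 0 = (Submodule.span ℂ {u | ∃ α ∉ agree ε 𝒜, ∃ a ∈ 𝒜 α, ∃ θ : Dual ε 𝒜,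
      θ.1 ∈ DualHom ε 𝒜 (-α) ∧ u = tmulZ ε 𝒜 a (extD ε 𝒜 θ)}).map
        (formPart ε 𝒜 1 ∘ₗ (H.adPush ε).toLinearMap) := by
  have e : formPart ε 𝒜 1 ∘ₗ (H.adPush ε).toLinearMap = H.toForm ε 1 :=
    LinearMap.ext fun u => H.formPart_adPush 1 u
  rw [e]
  apply le_antisymm
  · intro ω hω
    obtain ⟨⟨u, hu⟩, h⟩ := (H.formEquiv ε 1 0).surjective ⟨ω, hω⟩
    refine ⟨u, ?_, congrArg Subtype.val h⟩
    have : OmegaHom ε 𝒜 1 0 ≤ Submodule.span ℂ {u | ∃ α ∉ agree ε 𝒜, ∃ a ∈ 𝒜 α, ∃ θ : Dual ε 𝒜,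
        θ.1 ∈ DualHom ε 𝒜 (-α) ∧ u = tmulZ ε 𝒜 a (extD ε 𝒜 θ)} := by
      refine Submodule.span_le.2 ?_
      rintro _ ⟨α, a, g, θ, ha, hθ, hk, rfl⟩
      rw [Fin.sum_univ_one] at hk
      have hg : g 0 = -α := (neg_eq_of_add_eq_zero_right hk).symm
      have hm : monomial ε 𝒜 a θ = tmulZ ε 𝒜 a (extD ε 𝒜 (θ 0)) := by simp [monomial]
      have hθ0 := hθ 0
      rw [hg] at hθ0
      by_cases hα : α ∈ agree ε 𝒜
      · have : θ 0 = 0 := Subtype.ext (H.complI_ext_basis fun β hβ => by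
          refine (H.dualHom_apply_eq_zero hθ0 (basisI_mem β) fun h => ?_).trans rfl
          have := H.agree_add h hα
          rw [neg_add_cancel_right] at this
          exact (H.mem_nonAgree.1 hβ).2 this)
        rw [hm, this, tmulZ_eq, omegaExt_D, map_zero, mul_zero]
        exact zero_mem _
      · exact Submodule.subset_span ⟨α, hα, a, ha, θ 0, hθ0, hm⟩
    exact this hu
  · rintro _ ⟨u, hu, rfl⟩
    refine H.toForm_mem (Submodule.span_le.2 ?_ hu)
    rintro _ ⟨α, _, a, ha, θ, hθ, rfl⟩
    rw [tmulZ_eq, omegaExt_D]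
    have := mul_omegaGen_mem (omegaInc_mem (ε := ε) ha) hθ
    rwa [add_neg_cancel, zero_add] at this

end IsFineDivision

end OneForms

end EpsGraded

end

/-! ### Bracket identities and Lie derivatives. -/

noncomputable section

namespace EpsGraded

section LieDerivative

set_option linter.unusedSectionVars false

variable {Γ : Type*} [AddCommGroup Γ] [DecidableEq Γ] {A : Type*} [Ring A] [Algebra ℂ A]
variable {ε : CommFactor Γ} {𝒜 : Γ → Submodule ℂ A} [GradedAlgebra 𝒜]

/-! ### Properties of the `ε`-bracket -/

theorem epsBracket_swap {α β : Γ} {x y : A} (hx : x ∈ 𝒜 α) (hy : y ∈ 𝒜 β) :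
    epsBracket ε 𝒜 y x = -(ε.val β α • epsBracket ε 𝒜 x y) := by
  rw [epsBracket_of_mem ε hx hy, epsBracket_of_mem ε hy hx, smul_sub, smul_smul, ε.val_mul_swap,
    one_smul, neg_sub]

theorem epsBracket_mem {α β : Γ} {x y : A} (hx : x ∈ 𝒜 α) (hy : y ∈ 𝒜 β) :
    epsBracket ε 𝒜 x y ∈ 𝒜 (β + α) := (ad_mem_DerHom hx).1 β y hy

theorem epsBracket_mul_right_center {α β : Γ} {x z : A} (hx : x ∈ 𝒜 α) (hz : z ∈ center ε 𝒜)
    (hzβ : z ∈ 𝒜 β) (a : A) : epsBracket ε 𝒜 a (x * z) = epsBracket ε 𝒜 a x * z := by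
  have h0 := epsBracket_center_right hz hzβ (twist ε 𝒜 α a)
  rw [epsBracket_of_mem_right ε _ hzβ, sub_eq_zero] at h0
  rw [epsBracket_of_mem_right ε a (SetLike.GradedMul.mul_mem hx hzβ),
    epsBracket_of_mem_right ε a hx, sub_mul, mul_assoc _ (twist ε 𝒜 α a), h0, mul_assoc,
    mul_assoc, twist_twist]

/-- The Jacobi identity. -/
theorem epsBracket_jacobi {α β : Γ} {x y : A} (hx : x ∈ 𝒜 α) (hy : y ∈ 𝒜 β) (a : A) :
    epsBracket ε 𝒜 (epsBracket ε 𝒜 a y) x - ε.val β α • epsBracket ε 𝒜 (epsBracket ε 𝒜 a x) y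
      = epsBracket ε 𝒜 a (epsBracket ε 𝒜 y x) := by
  rw [epsBracket_of_mem_right ε _ hx, epsBracket_of_mem_right ε _ hy,
    epsBracket_of_mem_right ε _ hy, epsBracket_of_mem_right ε _ hx,
    epsBracket_of_mem_right ε a (epsBracket_mem hy hx), epsBracket_of_mem ε hy hx]
  simp only [map_sub, map_mul, twist_of_mem ε hx, twist_of_mem ε hy, twist_twist, add_comm β α,
    mul_sub, sub_mul, smul_sub, smul_mul_assoc, mul_smul_comm, smul_smul, ε.val_mul_swap, one_smul,
    mul_assoc]
  abel

/-- The Jacobi identity for adjoint maps. -/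
theorem epsBracket_bracket {α β : Γ} {x y : A} (hx : x ∈ 𝒜 α) (hy : y ∈ 𝒜 β) :
    epsBracket ε 𝒜 (epsBracket ε 𝒜 x y)
      = epsBracket ε 𝒜 x ∘ₗ epsBracket ε 𝒜 y
        - ε.val α β • (epsBracket ε 𝒜 y ∘ₗ epsBracket ε 𝒜 x) := by
  refine lin_ext 𝒜 fun γ a ha => ?_
  simp only [LinearMap.sub_apply, LinearMap.smul_apply, LinearMap.comp_apply]
  rw [epsBracket_of_mem ε (epsBracket_mem hx hy) ha, epsBracket_of_mem ε hx (epsBracket_mem hy ha),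
    epsBracket_of_mem ε hy (epsBracket_mem hx ha), epsBracket_of_mem ε hx hy,
    epsBracket_of_mem ε hx ha, epsBracket_of_mem ε hy ha]
  have h := ε.val_mul_swap α β
  simp only [mul_sub, sub_mul, smul_sub, smul_mul_assoc, mul_smul_comm, smul_smul, mul_assoc,
    ε.val_add_right, ε.val_add_left]
  match_scalars
  · ring
  · ring
  · linear_combination (ε.val β γ * ε.val α γ) * h
  · ring
  · linear_combination (-ε.val β γ) * h
  · ring

/-- If `ε` is proper, the complement of the `ε`-center is stable by the bracket. -/
theorem IsFineDivision.bracket_mem_complI (H : IsFineDivision 𝒜) (hε : ε.IsProper) :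
    ∀ x ∈ complI ε 𝒜, ∀ y ∈ complI ε 𝒜, epsBracket ε 𝒜 x y ∈ complI ε 𝒜 := by
  have key : ∀ {α β : Γ} {x y : complI ε 𝒜}, (x : A) ∈ 𝒜 α → (y : A) ∈ 𝒜 β →
      epsBracket ε 𝒜 x y ∈ complI ε 𝒜 := by
    intro α β x y hx hy
    by_cases h : β + α ∈ agree ε 𝒜
    · by_cases hx0 : (x : A) = 0
      · rw [hx0, map_zero]
        exact zero_mem _
      have hm := SetLike.GradedMul.mul_mem hx hy
      have hc := H.mem_center_of_agree h (add_comm α β ▸ hm)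
      -- As x y is central of degree α + β, (x y) x = ε(α + β, α) x (x y). Properness removes ε(α,
      -- α), and cancelling the invertible x gives y x = ε(β, α) x y, so the bracket vanishes
      -- whenever its degree falls in `agree`.
      have e := center_comm hc hm hx
      rw [mul_assoc, ← mul_smul_comm, (H.isUnit hx hx0).mul_right_inj, ε.val_add_left, hε, one_mul]
        at e
      rw [epsBracket_swap hy hx, epsBracket_of_mem ε hy hx, e, sub_self, smul_zero, neg_zero]
      exact zero_mem _
    · exact mem_complI h (epsBracket_mem hx hy)
  intro x hx y hy
  have h1 : ∀ {α} {x : complI ε 𝒜}, (x : A) ∈ 𝒜 α → ((complI ε 𝒜).mkQ ∘ₗ epsBracket ε 𝒜 x) ∘ₗ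
      (complI ε 𝒜).subtype = 0 := fun hx => complI_ext ε 𝒜 fun β y hy =>
    (Submodule.Quotient.mk_eq_zero _).2 (key hx hy)
  have h2 : ((epsBracket ε 𝒜).compr₂ (complI ε 𝒜).mkQ ∘ₗ (complI ε 𝒜).subtype).compl₂
      (complI ε 𝒜).subtype = 0 := complI_ext ε 𝒜 fun α x hx => h1 hx
  exact (Submodule.Quotient.mk_eq_zero _).1 (congrArg (fun f => f ⟨x, hx⟩ ⟨y, hy⟩) h2)

/-! ### The bracket of the complement of the `ε`-center -/

variable (hI : ∀ x ∈ complI ε 𝒜, ∀ y ∈ complI ε 𝒜, epsBracket ε 𝒜 x y ∈ complI ε 𝒜)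

/-- The bracket of `complI`. -/
def bracketI : complI ε 𝒜 →ₗ[ℂ] complI ε 𝒜 →ₗ[ℂ] complI ε 𝒜 :=
  LinearMap.mk₂ ℂ (fun x y => ⟨epsBracket ε 𝒜 x y, hI _ x.2 _ y.2⟩)
    (fun _ _ _ => Subtype.ext (by simp)) (fun _ _ _ => Subtype.ext (by simp))
    (fun _ _ _ => Subtype.ext (by simp)) (fun _ _ _ => Subtype.ext (by simp))

theorem bracketI_coe (x y : complI ε 𝒜) : (bracketI hI x y : A) = epsBracket ε 𝒜 x y := rfl

theorem bracketI_mem {α β : Γ} {x y : complI ε 𝒜} (hx : (x : A) ∈ 𝒜 α) (hy : (y : A) ∈ 𝒜 β) :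
    (bracketI hI x y : A) ∈ 𝒜 (β + α) := epsBracket_mem hx hy

theorem bracketI_swap {α β : Γ} {x y : complI ε 𝒜} (hx : (x : A) ∈ 𝒜 α) (hy : (y : A) ∈ 𝒜 β) :
    bracketI hI y x = -(ε.val β α • bracketI hI x y) := Subtype.ext (epsBracket_swap hx hy)

/-- The coadjoint map `θ ↦ θ ∘ ad_x`. -/
def coad (x : complI ε 𝒜) : (complI ε 𝒜 →ₗ[ℂ] A) →ₗ[ℂ] (complI ε 𝒜 →ₗ[ℂ] A) :=
  LinearMap.lcomp ℂ A (bracketI hI x)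

theorem coad_apply (x : complI ε 𝒜) (θ : complI ε 𝒜 →ₗ[ℂ] A) (y : complI ε 𝒜) :
    coad hI x θ y = θ (bracketI hI x y) := rfl

namespace IsFineDivision

variable (H : IsFineDivision 𝒜)

include H in
theorem coad_mem {α γ : Γ} {x : complI ε 𝒜} (hx : (x : A) ∈ 𝒜 α) {θ : complI ε 𝒜 →ₗ[ℂ] A}
    (hθ : θ ∈ DualHom ε 𝒜 γ) : coad hI x θ ∈ DualHom ε 𝒜 (γ + α) := by
  refine ⟨fun y => hθ.1 _, fun β y hy => ?_, fun y z hz h => ?_⟩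
  · have := hθ.2.1 _ _ (bracketI_mem hI hx hy)
    rwa [show β + (γ + α) = β + α + γ by abel]
  · rw [coad_apply, coad_apply]
    have key : ∀ z (hz : z ∈ center ε 𝒜), epsBracket ε 𝒜 x (y * z) = epsBracket ε 𝒜 x y * z := by
      intro z hz
      refine center_induction
        (p := fun z _ => epsBracket ε 𝒜 x (y * z) = epsBracket ε 𝒜 x y * z) (by simp)
        (fun z w _ _ h1 h2 => by rw [mul_add, map_add, h1, h2, mul_add]) (fun β z hz hzβ => ?_) hz
      · have : (epsBracket ε 𝒜 x) ∘ₗ LinearMap.mulRight ℂ z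
            = LinearMap.mulRight ℂ z ∘ₗ epsBracket ε 𝒜 x :=
          lin_ext 𝒜 fun δ a ha => epsBracket_mul_right_center ha hz hzβ x
        exact congrArg (fun f => f (y : A)) this
    have hm : (bracketI hI x y : A) * z ∈ complI ε 𝒜 := H.complI_mul (bracketI hI x y).2 hz
    rw [← hθ.2.2 _ z hz hm]
    exact congrArg θ (Subtype.ext (key z hz))

variable (ε) in
include H in
theorem coad_mem_Dual (x : complI ε 𝒜) (θ : complI ε 𝒜 →ₗ[ℂ] A) (hθ : θ ∈ Dual ε 𝒜)
    {α : Γ} (hx : (x : A) ∈ 𝒜 α) : coad hI x θ ∈ Dual ε 𝒜 := by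
  have : Dual ε 𝒜 ≤ (Dual ε 𝒜).comap (coad hI x) :=
    iSup_le fun γ θ hθ => DualHom_le_Dual ε 𝒜 _ (H.coad_mem hI hx hθ)
  exact this hθ

/-! ### Lie derivatives -/

-- The Lie derivative has exterior degree 0, so its Leibniz rule carries only the twist of the right
-- factor. On A it is -[a, x] = ε(|a|, |x|) [x, a]. On the dual only the coadjoint term -θ ∘ ad_x
-- occurs, since the values of θ are central and their brackets vanish. The separate θ' avoids a
-- membership proof in the statement.
include H in
theorem exists_lie {α : Γ} (x : complI ε 𝒜) (hx : (x : A) ∈ 𝒜 α) :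
    ∃ δ : Omega ε 𝒜 →ₗ[ℂ] Omega ε 𝒜, IsSkewDer (AlgHom.id ℂ _) (omegaTwist ε 𝒜 α) δ ∧
      (∀ a, δ (omegaInc ε 𝒜 a) = -omegaInc ε 𝒜 (epsBracket ε 𝒜 a x)) ∧
      ∀ θ θ' : Dual ε 𝒜, θ'.1 = coad hI x θ.1 → δ (omegaGen ε 𝒜 θ) = -omegaGen ε 𝒜 θ' := by
  let c : Dual ε 𝒜 →ₗ[ℂ] Dual ε 𝒜 :=
    (coad hI x).restrict fun θ hθ => H.coad_mem_Dual ε hI x θ hθ hx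
  have hc : ∀ {γ : Γ} {θ : Dual ε 𝒜}, θ.1 ∈ DualHom ε 𝒜 γ → (c θ).1 ∈ DualHom ε 𝒜 (γ + α) :=
    fun hθ => H.coad_mem hI hx hθ
  let δA : A →ₗ[ℂ] Omega ε 𝒜 := -((omegaInc ε 𝒜).toLinearMap ∘ₗ (epsBracket ε 𝒜).flip x)
  have hδA : ∀ a, δA a = -omegaInc ε 𝒜 (epsBracket ε 𝒜 a x) := fun _ => rfl
  let δD : Dual ε 𝒜 →ₗ[ℂ] Omega ε 𝒜 := -(omegaGen ε 𝒜 ∘ₗ c)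
  have hδD : ∀ θ, δD θ = -omegaGen ε 𝒜 (c θ) := fun _ => rfl
  suffices h : ∃ δ : Omega ε 𝒜 →ₗ[ℂ] Omega ε 𝒜,
      IsSkewDer (AlgHom.id ℂ _) (omegaTwist ε 𝒜 α) δ ∧
      (∀ a, δ (omegaInc ε 𝒜 a) = δA a) ∧ ∀ θ, δ (omegaGen ε 𝒜 θ) = δD θ by
    obtain ⟨δ, h1, h2, h3⟩ := h
    refine ⟨δ, h1, h2, fun θ θ' h => (h3 θ).trans ?_⟩
    rw [hδD, show c θ = θ' from Subtype.ext h.symm]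
  refine exists_skewDer δA δD (fun a b => ?_) (fun {γ θ} hθ {β a} ha => ?_)
    (fun {β z} hz hzβ {γ θ} hθ => ?_) (fun {γ θ} hθ {δ η} hη => ?_)
  · have ht : omegaTwist ε 𝒜 α (omegaInc ε 𝒜 b) = omegaInc ε 𝒜 (twist ε 𝒜 α b) :=
      omegaLift_inc _ b
    rw [AlgHom.id_apply, ht, hδA, hδA, hδA, mul_neg, neg_mul, ← map_mul, ← map_mul, ← neg_add,
      ← map_add, epsBracket_of_mem_right ε _ hx, epsBracket_of_mem_right ε _ hx,
      epsBracket_of_mem_right ε _ hx, map_mul, mul_sub, sub_mul]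
    simp only [mul_assoc, sub_add_sub_cancel]
  · rw [AlgHom.id_apply, AlgHom.id_apply, hδA, hδD, omegaTwist_inc ha, omegaTwist_gen hθ, mul_neg,
      neg_mul, mul_neg, neg_mul, mul_smul_comm, mul_smul_comm,
      omegaGen_mul_inc (epsBracket_mem ha hx) hθ, omegaGen_mul_inc ha (hc hθ), ε.val_add_left,
      ε.val_add_right, smul_smul]
    have h := ε.val_mul_swap β α
    match_scalars
    · ring
    · linear_combination (-ε.val γ β) * h
  · have : epsBracket ε 𝒜 z x = 0 := hz x
    rw [AlgHom.id_apply, hδA, hδD, hδD, this, map_zero, neg_zero, zero_mul, add_zero, mul_neg,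
      omegaInc_mul_gen hz hzβ (hc hθ)]
    rfl
  · rw [AlgHom.id_apply, AlgHom.id_apply, hδD, hδD, omegaTwist_gen hη, omegaTwist_gen hθ, mul_neg,
      neg_mul, mul_neg, neg_mul, mul_smul_comm, mul_smul_comm, omegaGen_anticomm hθ (hc hη),
      omegaGen_anticomm (hc hθ) hη, ε.val_add_left, ε.val_add_right]
    have h := ε.val_mul_swap α δ
    match_scalars
    · ring
    · linear_combination (ε.val γ δ) * h

variable (ε) in
/-- The Lie derivatives of `Omega` along elements of `complI`. -/
def lie : complI ε 𝒜 →ₗ[ℂ] Omega ε 𝒜 →ₗ[ℂ] Omega ε 𝒜 :=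
  (H.exists_linearMap fun α => (H.exists_lie hI (basisI ε 𝒜 α) (basisI_mem α)).choose).choose

theorem lie_basis {α : Γ} (hα : α ∈ H.nonAgree ε) :
    H.lie ε hI (basisI ε 𝒜 α) = (H.exists_lie hI (basisI ε 𝒜 α) (basisI_mem α)).choose :=
  (H.exists_linearMap fun α =>
    (H.exists_lie hI (basisI ε 𝒜 α) (basisI_mem α)).choose).choose_spec α hα

theorem lie_mul {α : Γ} {x : complI ε 𝒜} (hx : (x : A) ∈ 𝒜 α) (u v : Omega ε 𝒜) :
    H.lie ε hI x (u * v) = u * H.lie ε hI x v + H.lie ε hI x u * omegaTwist ε 𝒜 α v := by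
  obtain rfl | ⟨hα, c, rfl⟩ := H.complI_cases x hx
  · simp
  · have := (H.exists_lie hI (basisI ε 𝒜 α) (basisI_mem α)).choose_spec.1 u v
    rw [← H.lie_basis hI hα] at this
    rw [map_smul, LinearMap.smul_apply, this, smul_add, LinearMap.smul_apply, LinearMap.smul_apply,
      mul_smul_comm, smul_mul_assoc]
    rfl

theorem lie_inc (x : complI ε 𝒜) (a : A) :
    H.lie ε hI x (omegaInc ε 𝒜 a) = -omegaInc ε 𝒜 (epsBracket ε 𝒜 a x) := by
  have : (H.lie ε hI).flip (omegaInc ε 𝒜 a)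
      = -((omegaInc ε 𝒜).toLinearMap ∘ₗ epsBracket ε 𝒜 a ∘ₗ (complI ε 𝒜).subtype) :=
    H.complI_ext_basis fun α hα => by
      rw [LinearMap.flip_apply, H.lie_basis hI hα]
      exact (H.exists_lie hI (basisI ε 𝒜 α) (basisI_mem α)).choose_spec.2.1 a
  exact congrArg (fun f => f x) this

theorem lie_gen {α : Γ} {x : complI ε 𝒜} (hx : (x : A) ∈ 𝒜 α) {θ θ' : Dual ε 𝒜}
    (h : θ'.1 = coad hI x θ.1) :
    H.lie ε hI x (omegaGen ε 𝒜 θ) = -omegaGen ε 𝒜 θ' := by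
  obtain rfl | ⟨hα, c, rfl⟩ := H.complI_cases x hx
  · have : θ' = 0 := Subtype.ext (by
      rw [h]
      ext y
      rw [coad_apply, map_zero, LinearMap.zero_apply, map_zero]
      rfl)
    rw [this, map_zero, map_zero, LinearMap.zero_apply, neg_zero]
  · have e : θ' = c • ⟨_, H.coad_mem_Dual ε hI (basisI ε 𝒜 α) θ.1 θ.2 (basisI_mem α)⟩ :=
      Subtype.ext (by
        rw [h]
        ext y
        rw [coad_apply, map_smul, LinearMap.smul_apply, map_smul]
        rfl)
    rw [map_smul, LinearMap.smul_apply, H.lie_basis hI hα,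
      (H.exists_lie hI (basisI ε 𝒜 α) (basisI_mem α)).choose_spec.2.2 θ
        ⟨_, H.coad_mem_Dual ε hI (basisI ε 𝒜 α) θ.1 θ.2 (basisI_mem α)⟩ rfl, e, map_smul, smul_neg]

variable (ε) in
/-- The coadjoint map on the dual. -/
def coadD {α : Γ} {x : complI ε 𝒜} (hx : (x : A) ∈ 𝒜 α) (θ : Dual ε 𝒜) : Dual ε 𝒜 :=
  ⟨coad hI x θ.1, H.coad_mem_Dual ε hI x θ.1 θ.2 hx⟩

theorem lie_mem {n : ℕ} {k α : Γ} {u : Omega ε 𝒜} (hu : u ∈ OmegaHom ε 𝒜 n k)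
    {x : complI ε 𝒜} (hx : (x : A) ∈ 𝒜 α) : H.lie ε hI x u ∈ OmegaHom ε 𝒜 n (k + α) := by
  refine omegaHom_le (fun n k => (OmegaHom ε 𝒜 n (k + α)).comap (H.lie ε hI x))
    (fun k a ha => ?_) (fun n k u hu' hu γ θ hθ => ?_) n k hu
  · rw [Submodule.mem_comap, H.lie_inc]
    have := epsBracket_mem (ε := ε) ha hx
    rw [add_comm] at this
    exact neg_mem (omegaInc_mem this)
  · rw [Submodule.mem_comap] at hu ⊢
    rw [H.lie_mul hI hx, H.lie_gen hI hx (θ' := H.coadD ε hI hx θ) rfl, omegaTwist_gen hθ,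
      mul_smul_comm, mul_neg]
    refine add_mem (neg_mem ?_) (Submodule.smul_mem _ _ ?_)
    · have := mul_omegaGen_mem hu' (θ := H.coadD ε hI hx θ) (H.coad_mem hI hx hθ)
      rwa [← add_assoc] at this
    · have := mul_omegaGen_mem hu hθ
      rwa [add_right_comm] at this

theorem lie_sign {α : Γ} {x : complI ε 𝒜} (hx : (x : A) ∈ 𝒜 α) (u : Omega ε 𝒜) :
    H.lie ε hI x (omegaSign ε 𝒜 u) = omegaSign ε 𝒜 (H.lie ε hI x u) := by
  have : H.lie ε hI x ∘ₗ (omegaSign ε 𝒜).toLinearMap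
      = (omegaSign ε 𝒜).toLinearMap ∘ₗ H.lie ε hI x := omega_lin_ext fun n k u hu => by
    change H.lie ε hI x (omegaSign ε 𝒜 u) = omegaSign ε 𝒜 (H.lie ε hI x u)
    rw [omegaSign_of_mem hu, map_smul, omegaSign_of_mem (H.lie_mem hI hu hx)]
  exact congrArg (fun f => f u) this

theorem lie_twist {α : Γ} {x : complI ε 𝒜} (hx : (x : A) ∈ 𝒜 α) (β : Γ) (u : Omega ε 𝒜) :
    H.lie ε hI x (omegaTwist ε 𝒜 β u) = ε.val β α • omegaTwist ε 𝒜 β (H.lie ε hI x u) := by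
  have : H.lie ε hI x ∘ₗ (omegaTwist ε 𝒜 β).toLinearMap
      = ε.val β α • ((omegaTwist ε 𝒜 β).toLinearMap ∘ₗ H.lie ε hI x) :=
    omega_lin_ext fun n k u hu => by
      change H.lie ε hI x (omegaTwist ε 𝒜 β u) = ε.val β α • omegaTwist ε 𝒜 β (H.lie ε hI x u)
      rw [omegaTwist_of_mem hu, map_smul, omegaTwist_of_mem (H.lie_mem hI hu hx), smul_smul,
        ε.val_add_left]
      congr 1
      linear_combination -ε.val k β * ε.val_mul_swap α β
  exact congrArg (fun f => f u) this

/-- The commutator of a Lie derivative and a contraction. -/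
theorem lie_contr {α β : Γ} {x y : complI ε 𝒜} (hx : (x : A) ∈ 𝒜 α) (hy : (y : A) ∈ 𝒜 β)
    (u : Omega ε 𝒜) :
    H.lie ε hI x (H.contr ε y u) = ε.val β α • H.contr ε y (H.lie ε hI x u)
      - H.contr ε (bracketI hI y x) u := by
  have hb := bracketI_mem hI hy hx
  have h : H.lie ε hI x ∘ₗ H.contr ε y - ε.val β α • (H.contr ε y ∘ₗ H.lie ε hI x)
      + H.contr ε (bracketI hI y x) = 0 := by
    refine IsSkewDer.eq_zero (s := omegaSign ε 𝒜)
      (t := omegaTwist ε 𝒜 (α + β)) (fun u v => ?_) (fun γ a _ => ?_) (fun γ θ _ => ?_)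
    · simp only [LinearMap.add_apply, LinearMap.sub_apply, LinearMap.smul_apply,
        LinearMap.comp_apply, H.contr_mul hy, H.lie_mul hI hx, H.contr_mul hb, map_add,
        H.lie_sign hI hx, H.lie_twist hI hx, H.contr_twist hy, omegaTwist_add,
        omegaTwist_comm β α, smul_add, mul_add, add_mul, mul_sub, sub_mul,
        mul_smul_comm, smul_mul_assoc, smul_smul, ε.val_mul_swap, one_smul]
      abel
    · simp [H.contr_inc, H.lie_inc]
    · have e : (coad hI x θ.1) y = -(ε.val α β • θ.1 (bracketI hI y x)) := by
        rw [coad_apply, bracketI_swap hI hy hx, map_neg, map_smul]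
      -- The term L_x(θ(y)) drops out because θ(y) is central.
      have hz : epsBracket ε 𝒜 (θ.1 y) x = 0 := by
        have : (Dual ε 𝒜) ≤ (Subalgebra.toSubmodule (center ε 𝒜)).comap (LinearMap.applyₗ y) :=
          iSup_le fun γ θ hθ => hθ.1 y
        exact this θ.2 x
      simp only [LinearMap.add_apply, LinearMap.sub_apply, LinearMap.smul_apply,
        LinearMap.comp_apply, H.contr_gen, H.lie_gen hI hx (θ' := H.coadD ε hI hx θ) rfl, H.lie_inc,
        map_neg, hz, map_zero, coadD, e, map_smul, neg_neg, smul_smul, ε.val_mul_swap, one_smul,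
        neg_zero, zero_sub, neg_add_cancel]
  have := congrArg (fun f => f u) h
  simp only [LinearMap.add_apply, LinearMap.sub_apply, LinearMap.smul_apply,
        LinearMap.comp_apply, LinearMap.zero_apply] at this
  rw [eq_sub_iff_add_eq, ← sub_eq_zero, ← this]
  abel

/-- The commutator of two Lie derivatives. -/
theorem lie_lie {α β : Γ} {x y : complI ε 𝒜} (hx : (x : A) ∈ 𝒜 α) (hy : (y : A) ∈ 𝒜 β)
    (u : Omega ε 𝒜) :
    H.lie ε hI x (H.lie ε hI y u) = ε.val β α • H.lie ε hI y (H.lie ε hI x u)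
      - H.lie ε hI (bracketI hI y x) u := by
  have hb := bracketI_mem hI hy hx
  have h : H.lie ε hI x ∘ₗ H.lie ε hI y - ε.val β α • (H.lie ε hI y ∘ₗ H.lie ε hI x)
      + H.lie ε hI (bracketI hI y x) = 0 := by
    refine IsSkewDer.eq_zero (s := AlgHom.id ℂ _)
      (t := omegaTwist ε 𝒜 (α + β)) (fun u v => ?_) (fun γ a _ => ?_) (fun γ θ _ => ?_)
    · simp only [LinearMap.add_apply, LinearMap.sub_apply, LinearMap.smul_apply,
        LinearMap.comp_apply, H.lie_mul hI hy, H.lie_mul hI hx, H.lie_mul hI hb, map_add,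
        H.lie_twist hI hx, H.lie_twist hI hy, omegaTwist_add, AlgHom.id_apply,
        omegaTwist_comm β α, smul_add, mul_add, add_mul, mul_sub, sub_mul,
        mul_smul_comm, smul_mul_assoc, smul_smul, ε.val_mul_swap, one_smul]
      abel
    · simp only [LinearMap.add_apply, LinearMap.sub_apply, LinearMap.smul_apply,
        LinearMap.comp_apply, H.lie_inc, map_neg, neg_neg, bracketI_coe]
      -- On A the identity is the Jacobi identity; on the generators from the dual, below, it is the
      -- formula for ad of a bracket.
      rw [← epsBracket_jacobi hx hy, map_sub, map_smul]
      abel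
    · have e : (H.coadD ε hI hx (H.coadD ε hI hy θ)) = H.coadD ε hI hb θ + ε.val β α •
          (H.coadD ε hI hy (H.coadD ε hI hx θ)) := by
        refine Subtype.ext (LinearMap.ext fun w => ?_)
        change θ.1 (bracketI hI y (bracketI hI x w)) = θ.1 (bracketI hI (bracketI hI y x) w)
          + ε.val β α • θ.1 (bracketI hI x (bracketI hI y w))
        rw [← map_smul, ← map_add]
        refine congrArg θ.1 (Subtype.ext ?_)
        exact eq_add_of_sub_eq (congrArg (fun f => f (w : A)) (epsBracket_bracket hy hx)).symm
      simp only [LinearMap.add_apply, LinearMap.sub_apply, LinearMap.smul_apply,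
        LinearMap.comp_apply, H.lie_gen hI hx (θ' := H.coadD ε hI hx _) rfl,
        H.lie_gen hI hy (θ' := H.coadD ε hI hy _) rfl,
        H.lie_gen hI hb (θ' := H.coadD ε hI hb _) rfl, map_neg, neg_neg]
      rw [e, map_add, map_smul]
      abel
  have := congrArg (fun f => f u) h
  simp only [LinearMap.add_apply, LinearMap.sub_apply, LinearMap.smul_apply,
        LinearMap.comp_apply, LinearMap.zero_apply] at this
  rw [eq_sub_iff_add_eq, ← sub_eq_zero, ← this]
  abel

/-- Lie derivatives along multiples by elements of the `ε`-center. -/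
theorem lie_mul_center {α β : Γ} {x y : complI ε 𝒜} {z : A} (hx : (x : A) ∈ 𝒜 α)
    (hz : z ∈ center ε 𝒜) (hzβ : z ∈ 𝒜 β) (h : (y : A) = x * z) (u : Omega ε 𝒜) :
    H.lie ε hI y u = H.lie ε hI x u * omegaInc ε 𝒜 z := by
  have hy : (y : A) ∈ 𝒜 (α + β) := h ▸ SetLike.GradedMul.mul_mem hx hzβ
  have h : H.lie ε hI y - LinearMap.mulRight ℂ (omegaInc ε 𝒜 z) ∘ₗ H.lie ε hI x = 0 := by
    refine IsSkewDer.eq_zero (s := AlgHom.id ℂ _) (t := omegaTwist ε 𝒜 (α + β)) (fun u v => ?_)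
      (fun γ a _ => ?_) (fun γ θ hθ => ?_)
    · simp only [LinearMap.sub_apply, LinearMap.comp_apply, LinearMap.mulRight_apply,
        H.lie_mul hI hx, H.lie_mul hI hy, add_mul, mul_assoc, mul_sub, sub_mul, AlgHom.id_apply,
        mul_omegaInc_center hz hzβ (omegaTwist ε 𝒜 α v)]
      rw [add_comm α β, omegaTwist_add]
      abel
    · rw [LinearMap.sub_apply, LinearMap.comp_apply, LinearMap.mulRight_apply, H.lie_inc, H.lie_inc,
        h, epsBracket_mul_right_center hx hz hzβ, map_mul, neg_mul, sub_self]
    · have hc : (H.coadD ε hI hx θ).1 ∈ DualHom ε 𝒜 (γ + α) := H.coad_mem hI hx hθ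
      have e : ε.val (γ + α) β • dualSmul hz hzβ hc = H.coadD ε hI hy θ := by
        refine Subtype.ext (complI_ext ε 𝒜 fun δ w hw => ?_)
        change ε.val (γ + α) β • (z * θ.1 (bracketI hI x w)) = θ.1 (bracketI hI y w)
        have hb := bracketI_mem hI hx hw
        have e1 : bracketI hI y w = ε.val β δ •
            ⟨_, H.complI_mul (bracketI hI x w).2 hz⟩ := Subtype.ext (by
          change epsBracket ε 𝒜 (y : A) w = ε.val β δ • (epsBracket ε 𝒜 x w * z)
          rw [h, epsBracket_mul_center hx hz hzβ, LinearMap.smul_apply, LinearMap.comp_apply,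
            LinearMap.mulLeft_apply, center_comm hz hzβ (epsBracket_mem hx hw), smul_smul,
            ε.val_add_right]
          congr 1
          linear_combination ε.val β δ * ε.val_mul_swap α β)
        rw [e1, map_smul, hθ.2.2 _ z hz, center_comm hz hzβ (hθ.2.1 _ _ hb), smul_smul,
          ε.val_add_right, ε.val_add_right, ε.val_add_left]
        congr 1
        linear_combination ε.val β δ * ε.val γ β * ε.val β γ * ε.val_mul_swap α β
          + ε.val β δ * ε.val_mul_swap γ β
      rw [LinearMap.sub_apply, LinearMap.comp_apply, LinearMap.mulRight_apply,
        H.lie_gen hI hx (θ' := H.coadD ε hI hx _) rfl, H.lie_gen hI hy (θ' := H.coadD ε hI hy _) rfl,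
        neg_mul, omegaGen_mul_inc hzβ hc, omegaInc_mul_gen hz hzβ hc, ← map_smul, e, sub_self]
  exact sub_eq_zero.1 (congrArg (fun f => f u) h)

/-- Lie derivatives of multiples by elements of the `ε`-center. -/
theorem lie_mul_inc_center {α β : Γ} {x : complI ε 𝒜} {z : A} (hx : (x : A) ∈ 𝒜 α)
    (hz : z ∈ center ε 𝒜) (hzβ : z ∈ 𝒜 β) (u : Omega ε 𝒜) :
    H.lie ε hI x (u * omegaInc ε 𝒜 z) = ε.val β α • (H.lie ε hI x u * omegaInc ε 𝒜 z) := by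
  have : epsBracket ε 𝒜 z x = 0 := hz x
  rw [H.lie_mul hI hx, H.lie_inc, this, map_zero, neg_zero, mul_zero, zero_add, omegaTwist_inc hzβ,
    mul_smul_comm]

end IsFineDivision

end LieDerivative

end EpsGraded

end

/-! ### The differential from Cartan's formula. -/

noncomputable section

namespace EpsGraded

section Differential

set_option linter.unusedSectionVars false

variable {Γ : Type*} [AddCommGroup Γ] [DecidableEq Γ] {A : Type*} [Ring A] [Algebra ℂ A]
variable {ε : CommFactor Γ} {𝒜 : Γ → Submodule ℂ A} [GradedAlgebra 𝒜]

/-! ### The differential -/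

variable (hI : ∀ x ∈ complI ε 𝒜, ∀ y ∈ complI ε 𝒜, epsBracket ε 𝒜 x y ∈ complI ε 𝒜)

namespace IsFineDivision

variable (H : IsFineDivision 𝒜)

variable (ε) in
/-- The linear map `w ↦ integ n w`. -/
def integLin (n : ℕ) : (complI ε 𝒜 →ₗ[ℂ] Omega ε 𝒜) →ₗ[ℂ] Omega ε 𝒜 where
  toFun w := H.integ ε n w
  map_add' w w' := by simp [integ, add_mul, Finset.sum_add_distrib]
  map_smul' c w := by
    simp only [integ, LinearMap.smul_apply, smul_mul_assoc, ← Finset.smul_sum, RingHom.id_apply]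
    rw [smul_comm]

variable (ε) in
/-- The restriction of the differential to the elements of exterior degree `n` is
`diffAux (n + 1)`; it is defined by Cartan's formula. -/
def diffAux : ℕ → Omega ε 𝒜 →ₗ[ℂ] Omega ε 𝒜
  -- The index is shifted by one: contractions of elements of exterior degree 0 vanish, and `diffAux
  -- 0` is the map applied to them.
  | 0 => 0
  | n + 1 => H.integLin ε n ∘ₗ
      ((H.lie ε hI).flip - (diffAux n).compRight ℂ ∘ₗ (H.contr ε).flip)

theorem diffAux_succ (n : ℕ) (u : Omega ε 𝒜) :
    H.diffAux ε hI (n + 1) u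
      = H.integ ε n ((H.lie ε hI).flip u - H.diffAux ε hI n ∘ₗ (H.contr ε).flip u) := rfl

theorem contr_mul_inc {α β : Γ} {x : complI ε 𝒜} (hx : (x : A) ∈ 𝒜 α) {z : A} (hz : z ∈ 𝒜 β)
    (u : Omega ε 𝒜) :
    H.contr ε x (u * omegaInc ε 𝒜 z) = ε.val β α • (H.contr ε x u * omegaInc ε 𝒜 z) := by
  rw [H.contr_mul hx, H.contr_inc, mul_zero, zero_add, omegaTwist_inc hz, mul_smul_comm]

theorem contr_lie {α β : Γ} {x y : complI ε 𝒜} (hx : (x : A) ∈ 𝒜 α) (hy : (y : A) ∈ 𝒜 β)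
    (u : Omega ε 𝒜) :
    H.contr ε y (H.lie ε hI x u) = ε.val α β • (H.lie ε hI x (H.contr ε y u)
      + H.contr ε (bracketI hI y x) u) := by
  rw [H.lie_contr hI hx hy, sub_add_cancel, smul_smul, ε.val_mul_swap, one_smul]

/-- The claims support one another in the induction. To integrate w(x) = L_x u - d(i_x u) by
`contr_integ`, its degree must be known, its Z-linearity in x uses the third claim one degree lower,
and its antisymmetry uses Cartan's formula one degree lower with the commutators of L and i. The
third claim then follows by comparing contractions. -/
theorem diffAux_spec (n : ℕ) :
    ∀ (k : Γ), ∀ u ∈ OmegaHom ε 𝒜 n k, H.diffAux ε hI (n + 1) u ∈ OmegaHom ε 𝒜 (n + 1) k ∧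
      (∀ x, H.contr ε x (H.diffAux ε hI (n + 1) u)
        = H.lie ε hI x u - H.diffAux ε hI n (H.contr ε x u)) ∧
      ∀ β, ∀ z ∈ center ε 𝒜, z ∈ 𝒜 β → H.diffAux ε hI (n + 1) (u * omegaInc ε 𝒜 z)
        = H.diffAux ε hI (n + 1) u * omegaInc ε 𝒜 z := by
  induction n with
  | zero =>
    have spec : ∀ (k : Γ), ∀ u ∈ OmegaHom ε 𝒜 0 k,
        H.diffAux ε hI 1 u ∈ OmegaHom ε 𝒜 1 k ∧
        ∀ x, H.contr ε x (H.diffAux ε hI 1 u) = H.lie ε hI x u := by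
      intro k u hu
      have e : H.diffAux ε hI 1 u = H.integ ε 0 ((H.lie ε hI).flip u) := by
        rw [H.diffAux_succ, diffAux, LinearMap.zero_comp, sub_zero]
      rw [e]
      refine ⟨H.integ_mem fun hx => H.lie_mem hI hu hx, H.contr_integ
        (fun hx => H.lie_mem hI hu hx) (fun hx hz hzγ h => H.lie_mul_center hI hx hz hzγ h u)
        fun {α β x y} hx hy => ?_⟩
      rw [LinearMap.flip_apply, LinearMap.flip_apply, H.contr_zero_mem (H.lie_mem hI hu hx),
        H.contr_zero_mem (H.lie_mem hI hu hy), smul_zero, neg_zero]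
    intro k u hu
    refine ⟨(spec k u hu).1, fun x => ?_, fun β z hz hzβ => ?_⟩
    · rw [(spec k u hu).2, diffAux, LinearMap.zero_apply, sub_zero]
    · have huz := mul_omegaInc_mem hu hzβ
      refine H.contr_ext (spec _ _ huz).1 (mul_omegaInc_mem (spec k u hu).1 hzβ) fun α x hx => ?_
      rw [(spec _ _ huz).2, H.contr_mul_inc hx hzβ, (spec k u hu).2,
        H.lie_mul_inc_center hI hx hz hzβ]
  | succ n ih =>
    have spec : ∀ (k : Γ), ∀ u ∈ OmegaHom ε 𝒜 (n + 1) k,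
        H.diffAux ε hI (n + 2) u ∈ OmegaHom ε 𝒜 (n + 2) k ∧
        ∀ x, H.contr ε x (H.diffAux ε hI (n + 2) u)
          = H.lie ε hI x u - H.diffAux ε hI (n + 1) (H.contr ε x u) := by
      intro k u hu
      rw [H.diffAux_succ]
      have hw : ∀ {α} {x : complI ε 𝒜}, (x : A) ∈ 𝒜 α → ((H.lie ε hI).flip u
          - H.diffAux ε hI (n + 1) ∘ₗ (H.contr ε).flip u) x ∈ OmegaHom ε 𝒜 (n + 1) (k + α) :=
        fun hx => sub_mem (H.lie_mem hI hu hx) (ih _ _ (H.contr_mem hu hx)).1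
      refine ⟨H.integ_mem hw, H.contr_integ hw (fun {α γ x y z} hx hz hzγ h => ?_)
        fun {α β x y} hx hy => ?_⟩
      · simp only [LinearMap.sub_apply, LinearMap.comp_apply, LinearMap.flip_apply]
        rw [H.lie_mul_center hI hx hz hzγ h, H.contr_mul_center hx hz hzγ h,
          (ih _ _ (H.contr_mem hu hx)).2.2 _ z hz hzγ, sub_mul]
      · simp only [LinearMap.sub_apply, LinearMap.comp_apply, LinearMap.flip_apply, map_sub]
        rw [(ih _ _ (H.contr_mem hu hx)).2.1, (ih _ _ (H.contr_mem hu hy)).2.1,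
          H.contr_contr hy hx, H.contr_lie hI hx hy, H.contr_lie hI hy hx, bracketI_swap hI hx hy]
        simp only [map_neg, map_smul, LinearMap.neg_apply, LinearMap.smul_apply, smul_sub, smul_add,
          smul_neg, smul_smul, ε.val_mul_swap, one_smul, sub_neg_eq_add]
        abel
    intro k u hu
    refine ⟨(spec k u hu).1, (spec k u hu).2, fun β z hz hzβ => ?_⟩
    have huz := mul_omegaInc_mem hu hzβ
    refine H.contr_ext (spec _ _ huz).1 (mul_omegaInc_mem (spec k u hu).1 hzβ) fun α x hx => ?_
    rw [(spec _ _ huz).2, H.contr_mul_inc hx hzβ, H.contr_mul_inc hx hzβ, (spec k u hu).2,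
      H.lie_mul_inc_center hI hx hz hzβ, map_smul, (ih _ _ (H.contr_mem hu hx)).2.2 _ z hz hzβ,
      sub_mul, smul_sub]

variable (ε) in
/-- The differential of `Omega`. -/
def diff : Omega ε 𝒜 →ₗ[ℂ] Omega ε 𝒜 :=
  (DirectSum.toModule ℂ (ℕ × Γ) (Omega ε 𝒜) fun p =>
    H.diffAux ε hI (p.1 + 1) ∘ₗ (OmegaHom ε 𝒜 p.1 p.2).subtype) ∘ₗ
  (LinearEquiv.ofBijective _ H.coeLinearMap_bijective).symm.toLinearMap

theorem diff_of_mem {n : ℕ} {k : Γ} {u : Omega ε 𝒜} (hu : u ∈ OmegaHom ε 𝒜 n k) :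
    H.diff ε hI u = H.diffAux ε hI (n + 1) u := by
  have e : (LinearEquiv.ofBijective _ H.coeLinearMap_bijective).symm u
      = DirectSum.lof ℂ (ℕ × Γ) (fun p => OmegaHom ε 𝒜 p.1 p.2) (n, k) ⟨u, hu⟩ := by
    rw [LinearEquiv.symm_apply_eq, LinearEquiv.ofBijective_apply, DirectSum.coeLinearMap_lof]
  rw [diff, LinearMap.comp_apply, LinearEquiv.coe_coe, e, DirectSum.toModule_lof]
  rfl

theorem diff_mem {n : ℕ} {k : Γ} {u : Omega ε 𝒜} (hu : u ∈ OmegaHom ε 𝒜 n k) :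
    H.diff ε hI u ∈ OmegaHom ε 𝒜 (n + 1) k := by
  rw [H.diff_of_mem hI hu]
  exact (H.diffAux_spec hI n k u hu).1

/-- Cartan's formula. -/
theorem contr_diff {α : Γ} {x : complI ε 𝒜} (hx : (x : A) ∈ 𝒜 α) (u : Omega ε 𝒜) :
    H.contr ε x (H.diff ε hI u) = H.lie ε hI x u - H.diff ε hI (H.contr ε x u) := by
  have : H.contr ε x ∘ₗ H.diff ε hI = H.lie ε hI x - H.diff ε hI ∘ₗ H.contr ε x :=
    omega_lin_ext fun n k u hu => by
      change H.contr ε x (H.diff ε hI u) = H.lie ε hI x u - H.diff ε hI (H.contr ε x u)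
      rw [H.diff_of_mem hI hu, (H.diffAux_spec hI n k u hu).2.1]
      cases n with
      | zero => rw [H.contr_zero_mem hu, map_zero, map_zero]
      | succ n => rw [H.diff_of_mem hI (H.contr_mem hu hx)]
  exact congrArg (fun f => f u) this

/-- Both sides have the same contractions: Cartan's formula and the commutators [L, i] and [L, L]
reduce the comparison to i_y u, of lower exterior degree. -/
theorem lie_diff_of_mem {n : ℕ} {k α : Γ} {x : complI ε 𝒜} (hx : (x : A) ∈ 𝒜 α) {u : Omega ε 𝒜}
    (hu : u ∈ OmegaHom ε 𝒜 n k) :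
    H.lie ε hI x (H.diff ε hI u) = H.diff ε hI (H.lie ε hI x u) := by
  induction n generalizing k u with
  | zero =>
    refine H.contr_ext (H.lie_mem hI (H.diff_mem hI hu) hx) (H.diff_mem hI (H.lie_mem hI hu hx))
      fun β y hy => ?_
    rw [H.contr_lie hI hx hy, H.contr_diff hI hy, H.contr_diff hI (bracketI_mem hI hy hx),
      H.contr_diff hI hy, H.contr_zero_mem hu, H.contr_zero_mem hu,
      H.contr_zero_mem (H.lie_mem hI hu hx), map_zero, sub_zero, sub_zero, sub_zero,
      H.lie_lie hI hx hy, sub_add_cancel, smul_smul, ε.val_mul_swap, one_smul]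
  | succ n ih =>
    refine H.contr_ext (H.lie_mem hI (H.diff_mem hI hu) hx) (H.diff_mem hI (H.lie_mem hI hu hx))
      fun β y hy => ?_
    rw [H.contr_lie hI hx hy, H.contr_diff hI hy, H.contr_diff hI (bracketI_mem hI hy hx),
      H.contr_diff hI hy, map_sub, ih (H.contr_mem hu hy), H.lie_lie hI hx hy,
      H.contr_lie hI hx hy, map_smul, map_add]
    simp only [smul_add, smul_sub, smul_smul, ε.val_mul_swap, one_smul]
    abel

/-- Two uses of Cartan's formula give i_x d d u = L_x d u - d L_x u + d d i_x u. The first two terms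
cancel and the last vanishes by induction on the exterior degree. -/
theorem diff_diff (u : Omega ε 𝒜) : H.diff ε hI (H.diff ε hI u) = 0 := by
  have key : ∀ n k, ∀ u ∈ OmegaHom ε 𝒜 n k, H.diff ε hI (H.diff ε hI u) = 0 := by
    intro n
    induction n with
    | zero =>
      intro k u hu
      refine H.eq_zero_of_contr (H.diff_mem hI (H.diff_mem hI hu)) fun α x hx => ?_
      rw [H.contr_diff hI hx, H.contr_diff hI hx, H.contr_zero_mem hu, map_zero, sub_zero,
        H.lie_diff_of_mem hI hx hu, sub_self]
    | succ n ih =>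
      intro k u hu
      refine H.eq_zero_of_contr (H.diff_mem hI (H.diff_mem hI hu)) fun α x hx => ?_
      rw [H.contr_diff hI hx, H.contr_diff hI hx, map_sub, ih _ _ (H.contr_mem hu hx), sub_zero,
        H.lie_diff_of_mem hI hx hu, sub_self]
  have : H.diff ε hI ∘ₗ H.diff ε hI = 0 := omega_lin_ext key
  exact congrArg (fun f => f u) this

theorem diff_sign {n : ℕ} {k : Γ} {u : Omega ε 𝒜} (hu : u ∈ OmegaHom ε 𝒜 n k) :
    omegaSign ε 𝒜 (H.diff ε hI u) = -H.diff ε hI (omegaSign ε 𝒜 u) := by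
  rw [omegaSign_of_mem (H.diff_mem hI hu), omegaSign_of_mem hu, map_smul, pow_succ, mul_neg_one,
    neg_smul]

/-- Contracting both sides and applying the Leibniz rules of i_x and L_x leaves the same identity
for the pairs (sign(u), i_x v) and (i_x u, twist(v)), of smaller total exterior degree. The sign is
written as `omegaSign` so that it commutes with contractions up to -1, whatever the degree. -/
theorem diff_mul_of_mem {N p q : ℕ} (hN : p + q = N) {k l : Γ} {u v : Omega ε 𝒜}
    (hu : u ∈ OmegaHom ε 𝒜 p k) (hv : v ∈ OmegaHom ε 𝒜 q l) :
    H.diff ε hI (u * v) = H.diff ε hI u * v + omegaSign ε 𝒜 u * H.diff ε hI v := by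
  induction N using Nat.strong_induction_on generalizing p q k l u v with
  | h N ih =>
    have hsu : omegaSign ε 𝒜 u ∈ OmegaHom ε 𝒜 p k := by
      rw [omegaSign_of_mem hu]; exact Submodule.smul_mem _ _ hu
    have hm := omegaHom_mul hu hv
    have hm1 := omegaHom_mul (H.diff_mem hI hu) hv
    rw [show p + 1 + q = p + q + 1 by omega] at hm1
    have hm2 := omegaHom_mul hsu (H.diff_mem hI hv)
    rw [show p + (q + 1) = p + q + 1 by omega] at hm2
    refine H.contr_ext (H.diff_mem hI hm) (add_mem hm1 hm2)
      fun α x hx => ?_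
    have htv : omegaTwist ε 𝒜 α v ∈ OmegaHom ε 𝒜 q l := by
      rw [omegaTwist_of_mem hv]; exact Submodule.smul_mem _ _ hv
    have htd : H.diff ε hI (omegaTwist ε 𝒜 α v) = omegaTwist ε 𝒜 α (H.diff ε hI v) := by
      rw [omegaTwist_of_mem hv, omegaTwist_of_mem (H.diff_mem hI hv), map_smul]
    have h1 : H.diff ε hI (omegaSign ε 𝒜 u * H.contr ε x v)
        = H.diff ε hI (omegaSign ε 𝒜 u) * H.contr ε x v + u * H.diff ε hI (H.contr ε x v) := by
      cases q with
      | zero => rw [H.contr_zero_mem hv]; simp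
      | succ q =>
        rw [ih (p + q) (by omega) rfl hsu (H.contr_mem hv hx), omegaSign_sign]
    have h2 : H.diff ε hI (H.contr ε x u * omegaTwist ε 𝒜 α v)
        = H.diff ε hI (H.contr ε x u) * omegaTwist ε 𝒜 α v
          + omegaSign ε 𝒜 (H.contr ε x u) * omegaTwist ε 𝒜 α (H.diff ε hI v) := by
      cases p with
      | zero => rw [H.contr_zero_mem hu]; simp
      | succ p =>
        rw [ih (p + q) (by omega) rfl (H.contr_mem hu hx) htv, htd]
    rw [H.contr_diff hI hx, H.contr_mul hx, map_add, map_add, h1, h2, H.contr_mul hx,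
      H.contr_mul hx, H.diff_sign hI hu, omegaSign_sign, H.contr_sign, H.contr_diff hI hx,
      H.contr_diff hI hx, H.lie_mul hI hx]
    simp only [mul_sub, sub_mul, neg_mul]
    abel

theorem diff_mul {p : ℕ} {k : Γ} {u : Omega ε 𝒜} (hu : u ∈ OmegaHom ε 𝒜 p k) (v : Omega ε 𝒜) :
    H.diff ε hI (u * v) = H.diff ε hI u * v + (-1 : ℂ) ^ p • (u * H.diff ε hI v) := by
  have : H.diff ε hI ∘ₗ LinearMap.mulLeft ℂ u = LinearMap.mulLeft ℂ (H.diff ε hI u)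
      + (-1 : ℂ) ^ p • (LinearMap.mulLeft ℂ u ∘ₗ H.diff ε hI) :=
    omega_lin_ext fun q l v hv => by
      change H.diff ε hI (u * v) = H.diff ε hI u * v + (-1 : ℂ) ^ p • (u * H.diff ε hI v)
      rw [H.diff_mul_of_mem hI rfl hu hv, omegaSign_of_mem hu, smul_mul_assoc]
  exact congrArg (fun f => f v) this

end IsFineDivision

end Differential

end EpsGraded

end

/-! ### The explicit formula for the differential. -/

noncomputable section

namespace EpsGraded

section DifferentialFormula

set_option linter.unusedSectionVars false

variable {Γ : Type*} [AddCommGroup Γ] [DecidableEq Γ] {A : Type*} [Ring A] [Algebra ℂ A]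
variable {ε : CommFactor Γ} {𝒜 : Γ → Submodule ℂ A} [GradedAlgebra 𝒜]

/-! ### The values of the differential -/

theorem prod_lt_eq {M : Type*} [CommMonoid M] {n : ℕ} (m : Fin (n + 1)) (f : Fin (n + 1) → M) :
    (∏ a, if a < m then f a else 1)
      = ∏ i : Fin n, if i.castSucc < m then f (m.succAbove i) else 1 := by
  rw [Fin.prod_univ_succAbove _ m, if_neg (lt_irrefl m), one_mul]
  simp only [Fin.succAbove_lt_iff_castSucc_lt]

theorem omitTwo_zero {V : Type*} {p : ℕ} (j : Fin (p + 1)) (b : V) (X : Fin (p + 2) → V) :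
    omitTwo 0 j.succ b X
      = (Fin.cons b fun i => Fin.tail X (j.succAbove i) : Fin (p + 1) → V) := by
  funext i
  induction i using Fin.cases with
  | zero => simp [omitTwo]
  | succ i =>
    rw [Fin.cons_succ, omitTwo, if_neg (by simp), if_neg (by simp)]
    simp only [Fin.tail, Fin.succAbove, Fin.lt_def, Fin.val_succ, Fin.val_castSucc,
      add_lt_add_iff_right]
    split_ifs <;> rfl

/-- When the first argument x_0 is not in the bracket, it stands directly behind b, and what follows
is the shorter list formed without x_0. This is the shape in which x_0 can be split off by an
exchange with b. -/
theorem omitTwo_succ {V : Type*} {p : ℕ} (m n : Fin (p + 2)) (b : V) (X : Fin (p + 3) → V) :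
    omitTwo m.succ n.succ b X = (Fin.cons b (Fin.cons (X 0)
      (Fin.tail (omitTwo m n b (Fin.tail X))) : Fin (p + 1) → V) : Fin (p + 2) → V) := by
  funext i
  induction i using Fin.cases with
  | zero => simp [omitTwo]
  | succ i =>
    rw [Fin.cons_succ]
    induction i using Fin.cases with
    | zero => simp [omitTwo]
    | succ i =>
      rw [Fin.cons_succ]
      simp only [omitTwo, Fin.tail, Fin.val_succ, Nat.add_eq_zero_iff, one_ne_zero, and_false,
        if_false, add_le_add_iff_right, add_lt_add_iff_right]
      split_ifs <;> rfl

theorem omitTwo_eq_cons {V : Type*} {p : ℕ} (m n : Fin (p + 2)) (b : V) (X : Fin (p + 2) → V) :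
    omitTwo m n b X = (Fin.cons b (Fin.tail (omitTwo m n b X)) : Fin (p + 1) → V) := by
  funext i
  induction i using Fin.cases with
  | zero => simp [omitTwo]
  | succ i => rfl

theorem omitTwo_mem {p : ℕ} (m n : Fin (p + 1)) {δ : Γ} {b : complI ε 𝒜} (hb : (b : A) ∈ 𝒜 δ)
    {d : Fin (p + 1) → Γ} {x : Fin (p + 1) → complI ε 𝒜} (hx : ∀ i, (x i : A) ∈ 𝒜 (d i))
    (i : Fin p) : ((omitTwo m n b x i : complI ε 𝒜) : A) ∈ 𝒜 (omitTwo m n δ d i) := by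
  unfold omitTwo
  split_ifs
  · exact hb
  all_goals exact hx _

variable (hI : ∀ x ∈ complI ε 𝒜, ∀ y ∈ complI ε 𝒜, epsBracket ε 𝒜 x y ∈ complI ε 𝒜)

namespace IsFineDivision

variable (H : IsFineDivision 𝒜)

/-- Each time L_x passes a contraction i_{y_j}, their commutator leaves a term with y_j replaced by
its bracket with x; after all passages L_x acts on the value in A. -/
theorem evalOmega_lie {n : ℕ} {k α : Γ} {x : complI ε 𝒜} (hx : (x : A) ∈ 𝒜 α) {u : Omega ε 𝒜}
    (hu : u ∈ OmegaHom ε 𝒜 n k) (d : Fin n → Γ) (y : Fin n → complI ε 𝒜)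
    (hy : ∀ i, (y i : A) ∈ 𝒜 (d i)) :
    H.evalOmega ε n (H.lie ε hI x u) y = ε.val k α • epsBracket ε 𝒜 x (H.evalOmega ε n u y)
      - ∑ j, (∏ i, if i < j then ε.val α (d i) else 1) •
        H.evalOmega ε n u (Function.update y j (bracketI hI x (y j))) := by
  induction n generalizing k u with
  | zero =>
    obtain ⟨a, ha, rfl⟩ := omegaHom_zero hu
    rw [H.lie_inc, map_neg, neg_apply, H.evalOmega_zero, omegaProj_inc, epsBracket_swap hx ha,
      neg_neg, H.evalOmega_zero, omegaProj_inc, Finset.univ_eq_empty, Finset.sum_empty, sub_zero]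
  | succ n ih =>
    have e1 : H.evalOmega ε n (H.contr ε (bracketI hI (y 0) x) u) (Fin.tail y)
        = -(ε.val (d 0) α • H.evalOmega ε (n + 1) u
          (Function.update y 0 (bracketI hI x (y 0)))) := by
      rw [bracketI_swap hI hx (hy 0), map_neg, map_smul, LinearMap.neg_apply,
        LinearMap.smul_apply, map_neg, map_smul, neg_apply, smul_apply, H.evalOmega_succ,
        Function.update_self, Fin.tail_update_zero]
    have e2 : ∀ j : Fin n, H.evalOmega ε n (H.contr ε (y 0) u)
        (Function.update (Fin.tail y) j (bracketI hI x (Fin.tail y j)))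
        = H.evalOmega ε (n + 1) u (Function.update y j.succ (bracketI hI x (y j.succ))) := fun j => by
      rw [H.evalOmega_succ, Function.update_of_ne (Fin.succ_ne_zero j).symm, Fin.tail_update_succ]
      rfl
    have e3 : ∀ j : Fin n, (∏ i, if i < j.succ then ε.val α (d i) else 1)
        = ε.val α (d 0) * ∏ i, if i < j then ε.val α (Fin.tail d i) else 1 := fun j => by
      rw [Fin.prod_univ_succ, if_pos (Fin.succ_pos j)]
      simp only [Fin.succ_lt_succ_iff]
      rfl
    have e4 : (∏ i : Fin (n + 1), if i < 0 then ε.val α (d i) else 1) = 1 :=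
      Finset.prod_eq_one fun i _ => if_neg (Fin.not_lt_zero i)
    rw [H.evalOmega_succ, H.contr_lie hI hx (hy 0), map_smul, map_add, smul_apply, add_apply,
      ih (H.contr_mem hu (hy 0)) (Fin.tail d) (Fin.tail y) (fun i => hy i.succ), e1,
      Fin.sum_univ_succ, e4, H.evalOmega_succ u y]
    have e5 : (∑ j : Fin n, (∏ i, if i < j.succ then ε.val α (d i) else 1) •
        H.evalOmega ε (n + 1) u (Function.update y j.succ (bracketI hI x (y j.succ))))
        = ε.val α (d 0) • ∑ j : Fin n, (∏ i, if i < j then ε.val α (Fin.tail d i) else 1) •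
          H.evalOmega ε n (H.contr ε (y 0) u)
            (Function.update (Fin.tail y) j (bracketI hI x (Fin.tail y j))) := by
      rw [Finset.smul_sum]
      exact Finset.sum_congr rfl fun j _ => by rw [e3, e2, mul_smul]
    rw [e5]
    simp only [smul_add, smul_sub, smul_neg, smul_smul, ε.val_add_left, ε.val_mul_swap, one_smul]
    rw [show ε.val α (d 0) * (ε.val k α * ε.val (d 0) α) = ε.val k α by
      linear_combination ε.val k α * ε.val_mul_swap α (d 0)]
    abel

/-- In the Lie derivative a bracket sits in the place of the argument it replaces, whereas `diffVal`
wants it in the first place. -/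
theorem evalOmega_update {n : ℕ} (j : Fin (n + 1)) (u : Omega ε 𝒜) (d : Fin (n + 1) → Γ)
    (y : Fin (n + 1) → complI ε 𝒜) (hy : ∀ i, (y i : A) ∈ 𝒜 (d i)) {δ : Γ} {b : complI ε 𝒜}
    (hb : (b : A) ∈ 𝒜 δ) :
    H.evalOmega ε (n + 1) u (Function.update y j b)
      = ((-1) ^ (j : ℕ) * ∏ a, if a < j then ε.val (d a) δ else 1) •
        H.evalOmega ε (n + 1) u (Fin.cons b fun i => y (j.succAbove i)) := by
  rw [H.evalOmega_move j u (Function.update d j δ) (Function.update y j b) fun i => ?_]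
  · rw [Function.update_self, Function.update_self, H.evalOmega_cons, prod_lt_eq, ← prod_neg_one_lt,
      ← Finset.prod_mul_distrib]
    congr 1
    · refine Finset.prod_congr rfl fun i _ => ?_
      rw [Function.update_of_ne (Fin.succAbove_ne j i)]
      split_ifs <;> simp
    · congr 1
      funext i
      rw [Function.update_of_ne (Fin.succAbove_ne j i)]
  · by_cases h : i = j
    · subst h
      rwa [Function.update_self, Function.update_self]
    · rw [Function.update_of_ne h, Function.update_of_ne h]
      exact hy i

/-- The Lie derivative, with the brackets moved to the first place. -/
theorem evalOmega_lie_cons {n : ℕ} {k α : Γ} {x : complI ε 𝒜} (hx : (x : A) ∈ 𝒜 α)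
    {u : Omega ε 𝒜} (hu : u ∈ OmegaHom ε 𝒜 (n + 1) k) (d : Fin (n + 1) → Γ)
    (y : Fin (n + 1) → complI ε 𝒜) (hy : ∀ i, (y i : A) ∈ 𝒜 (d i)) :
    H.evalOmega ε (n + 1) (H.lie ε hI x u) y
      = ε.val k α • epsBracket ε 𝒜 x (H.evalOmega ε (n + 1) u y)
      + ∑ j : Fin (n + 1), ((-1) ^ ((j : ℕ) + 1) * ∏ a, if a < j then ε.val (d a) (d j) else 1) •
        H.evalOmega ε (n + 1) u (Fin.cons (bracketI hI x (y j)) fun i => y (j.succAbove i)) := by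
  rw [H.evalOmega_lie hI hx hu d y hy, sub_eq_add_neg, ← Finset.sum_neg_distrib]
  congr 1
  refine Finset.sum_congr rfl fun j _ => ?_
  rw [H.evalOmega_update j u d y hy (bracketI_mem hI hx (hy j)), smul_smul, ← neg_smul]
  congr 1
  have : (∏ a, if a < j then ε.val (d a) (d j) else 1)
      = (∏ a, if a < j then ε.val α (d a) else 1) *
        ∏ a, if a < j then ε.val (d a) (d j + α) else 1 := by
    rw [← Finset.prod_mul_distrib]
    refine Finset.prod_congr rfl fun a _ => ?_
    split_ifs
    · rw [ε.val_add_right]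
      linear_combination -ε.val (d a) (d j) * ε.val_mul_swap α (d a)
    · rw [one_mul]
  rw [this, pow_succ]
  ring

/-- Cartan's formula at the first argument. The term L_{x_0} u supplies the action of x_0 and all
brackets that involve x_0; the term -d(i_{x_0} u) supplies, by induction, everything in which x_0
remains an argument of u. -/
theorem evalOmega_diff {p : ℕ} {k : Γ} {u : Omega ε 𝒜} (hu : u ∈ OmegaHom ε 𝒜 p k)
    (d : Fin (p + 1) → Γ) (x : Fin (p + 1) → complI ε 𝒜) (hx : ∀ i, (x i : A) ∈ 𝒜 (d i)) :
    H.evalOmega ε (p + 1) (H.diff ε hI u) x =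
      diffVal ε k (fun (y : complI ε 𝒜) a => epsBracket ε 𝒜 y a) (H.evalOmega ε p u) d x
        fun m n => bracketI hI (x m) (x n) := by
  induction p generalizing k u with
  | zero =>
    obtain ⟨a, ha, rfl⟩ := omegaHom_zero hu
    rw [H.evalOmega_succ, H.contr_diff hI (hx 0), H.contr_inc, map_zero, sub_zero, H.lie_inc,
      H.evalOmega_zero, map_neg, omegaProj_inc, diffVal, epsBracket_swap (hx 0) ha]
    simp [H.evalOmega_zero, omegaProj_inc]
  | succ p ih =>
    have hx' : ∀ i, (Fin.tail x i : A) ∈ 𝒜 (Fin.tail d i) := fun i => hx i.succ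
    have hz : ∀ {n : ℕ} (f : Fin (n + 1) → ℂ), (∏ a : Fin (n + 1), if a < 0 then f a else 1) = 1 :=
      fun f => Finset.prod_eq_one fun i _ => if_neg (Fin.not_lt_zero i)
    have hs : ∀ {n : ℕ} (m : Fin n) (f : Fin (n + 1) → ℂ),
        (∏ a : Fin (n + 1), if a < m.succ then f a else 1)
          = f 0 * ∏ a : Fin n, if a < m then f a.succ else 1 := fun m f => by
      rw [Fin.prod_univ_succ, if_pos (Fin.succ_pos m)]
      simp only [Fin.succ_lt_succ_iff]
    -- Four blocks are matched: the action terms with m = 0 and m > 0, and the bracket terms with m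
    -- = 0 and m > 0.
    have split : ∀ A0 A1 S0 S1 L0 L1 M0 M1 : A, A0 = L0 → S0 = L1 → A1 = -M0 → S1 = -M1 →
        L0 + L1 - (M0 + M1) = A0 + A1 + (S0 + S1) := by
      rintro _ _ _ _ L0 L1 M0 M1 rfl rfl rfl rfl
      abel
    rw [H.evalOmega_succ, H.contr_diff hI (hx 0), map_sub, sub_apply,
      H.evalOmega_lie_cons hI (hx 0) hu (Fin.tail d) (Fin.tail x) hx',
      ih (H.contr_mem hu (hx 0)) (Fin.tail d) (Fin.tail x) hx', diffVal, diffVal,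
      Fin.sum_univ_succ (n := p + 1), Fin.sum_univ_succ (n := p + 1)]
    refine split _ _ _ _ _ _ _ _ ?_ ?_ ?_ ?_
    · rw [hz]
      simp only [Fin.val_zero, pow_zero, one_mul, mul_one, Fin.zero_succAbove]
      rfl
    · rw [Fin.sum_univ_succ, if_neg (lt_irrefl _), zero_add]
      refine Finset.sum_congr rfl fun j _ => ?_
      rw [if_pos (Fin.succ_pos j), omitTwo_zero, hz, hs j fun a => ε.val (d a) (d j.succ)]
      congr 1
      rw [Fin.val_zero, zero_add, Fin.val_succ]
      have h := ε.val_mul_swap (d j.succ) (d 0)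
      change _ = (-1) ^ ((j : ℕ) + 1) *
        ∏ a, if a < j then ε.val (d a.succ) (d j.succ) else 1
      linear_combination ((-1) ^ ((j : ℕ) + 1) *
        ∏ a, if a < j then ε.val (d a.succ) (d j.succ) else 1) * h
    · rw [← Finset.sum_neg_distrib]
      refine Finset.sum_congr rfl fun m _ => ?_
      have e : (fun i => x (m.succ.succAbove i))
          = (Fin.cons (x 0) fun i => Fin.tail x (m.succAbove i) : Fin (p + 1) → complI ε 𝒜) := by
        funext i
        induction i using Fin.cases with
        | zero => rw [Fin.succ_succAbove_zero]; rfl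
        | succ i => rw [Fin.succ_succAbove_succ]; rfl
      rw [e, H.evalOmega_cons, ← neg_smul, hs m fun a => ε.val (d a) (d m.succ)]
      congr 1
      rw [Fin.val_succ, pow_succ, ε.val_add_left]
      change _ = -((-1) ^ (m : ℕ) * (ε.val k (d m.succ) * ε.val (d 0) (d m.succ) *
        ∏ a, if a < m then ε.val (d a.succ) (d m.succ) else 1))
      ring
    · rw [← Finset.sum_neg_distrib]
      refine Finset.sum_congr rfl fun m _ => ?_
      rw [Fin.sum_univ_succ, if_neg (Fin.not_lt_zero _), zero_add, ← Finset.sum_neg_distrib]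
      refine Finset.sum_congr rfl fun n _ => ?_
      by_cases hmn : m < n
      · rw [if_pos (Fin.succ_lt_succ_iff.2 hmn), if_pos hmn]
        obtain _ | p := p
        · omega
        have hb := bracketI_mem hI (hx m.succ) (hx n.succ)
        have hr : ∀ i, ((Fin.tail (omitTwo m n (bracketI hI (x m.succ) (x n.succ)) (Fin.tail x)) i :
            complI ε 𝒜) : A) ∈ 𝒜 (Fin.tail (omitTwo m n (d n.succ + d m.succ) (Fin.tail d)) i) :=
          fun i => omitTwo_mem m n hb hx' i.succ
        -- The bracket precedes x_0 in the argument list; exchanging them puts x_0 in front, where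
        -- it becomes a contraction. The scalars produced cancel two factors ε(d_0, ·) of the larger
        -- formula.
        rw [omitTwo_succ, (H.evalOmega_isFormI hu).swap_cons hb (hx 0) hr, ← omitTwo_eq_cons, H.evalOmega_cons, smul_neg,
          smul_smul, ← neg_smul, ← neg_smul, hs m fun a => ε.val (d a) (d m.succ),
          hs n fun a => ε.val (d a) (d n.succ)]
        congr 1
        have h1 := ε.val_mul_swap (d n.succ) (d 0)
        have h2 := ε.val_mul_swap (d m.succ) (d 0)
        rw [Fin.val_succ, Fin.val_succ, ε.val_add_left]
        change _ = -((-1) ^ ((m : ℕ) + n) * (ε.val (d n.succ) (d m.succ) *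
          (∏ a, if a < m then ε.val (d a.succ) (d m.succ) else 1) *
          ∏ a, if a < n then ε.val (d a.succ) (d n.succ) else 1))
        have hp : (-1 : ℂ) ^ ((m : ℕ) + 1 + (n + 1)) = (-1) ^ ((m : ℕ) + n) := by
          rw [show (m : ℕ) + 1 + (n + 1) = m + n + 2 by omega, pow_add]
          norm_num
        rw [hp]
        linear_combination (-((-1) ^ ((m : ℕ) + n) * (ε.val (d n.succ) (d m.succ) *
          (∏ a, if a < m then ε.val (d a.succ) (d m.succ) else 1) *
          ∏ a, if a < n then ε.val (d a.succ) (d n.succ) else 1))) *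
          (ε.val (d m.succ) (d 0) * ε.val (d 0) (d m.succ) * h1 + h2)
      · rw [if_neg (mt Fin.succ_lt_succ_iff.1 hmn), if_neg hmn, neg_zero]

theorem isOmegaDiff : IsOmegaDiff ε 𝒜 (H.evalOmega ε) hI (H.diff ε hI) := fun _ _ _ hu =>
  ⟨H.diff_mem hI hu, fun d x hx => H.evalOmega_diff hI hu d x hx⟩

theorem eq_diff {D : Omega ε 𝒜 →ₗ[ℂ] Omega ε 𝒜}
    (hD : IsOmegaDiff ε 𝒜 (H.evalOmega ε) hI D) : D = H.diff ε hI :=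
  omega_lin_ext fun p k u hu => H.evalOmega_injOn (hD p k u hu).1 (H.diff_mem hI hu)
    (multilinear_ext fun d x hx => by
      rw [(hD p k u hu).2 d x hx, (H.isOmegaDiff hI p k u hu).2 d x hx])

/-- Both differentials are given by `diffVal`. The derivation ad_x acts on A as [x, ·], and ad of a
bracket is the bracket of the ad's, so they agree at (ad_{x_0}, …, ad_{x_p}), and every argument
list has this form. -/
theorem isFormDiff_adPush {p : ℕ} {k : Γ} {u : Omega ε 𝒜} (hu : u ∈ OmegaHom ε 𝒜 p k) :
    IsFormDiff ε 𝒜 k (formPart ε 𝒜 p (H.adPush ε u))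
      (formPart ε 𝒜 (p + 1) (H.adPush ε (H.diff ε hI u))) := by
  intro d X hX
  obtain ⟨x, rfl⟩ : ∃ x : Fin (p + 1) → complI ε 𝒜, X = fun i => adI ε 𝒜 (x i) :=
    ⟨fun i => (H.adEquiv ε).symm (X i),
      funext fun i => ((H.adEquiv ε).apply_symm_apply (X i)).symm⟩
  have hx : ∀ i, (x i : A) ∈ 𝒜 (d i) := fun i => by
    have := H.adEquiv_symm_mem (hX i)
    change (((H.adEquiv ε).symm (H.adEquiv ε (x i)) : complI ε 𝒜) : A) ∈ _ at this
    rwa [LinearEquiv.symm_apply_apply] at this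
  rw [H.formPart_adPush, H.formPart_adPush, H.toForm_adI, H.evalOmega_diff hI hu d x hx, diffVal,
    diffVal]
  congr 1
  · refine Finset.sum_congr rfl fun m _ => ?_
    rw [H.toForm_adI]
    rfl
  · refine Finset.sum_congr rfl fun m _ => Finset.sum_congr rfl fun n _ => ?_
    split_ifs
    · congr 1
      rw [← H.toForm_adI]
      congr 1
      funext i
      unfold omitTwo
      split_ifs
      · exact Subtype.ext (epsBracket_bracket (hx m) (hx n))
      all_goals rfl
    · rfl

end IsFineDivision

end DifferentialFormula

end EpsGraded

end

/-! ### Fine gradings of matrix algebras are division gradings. -/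

noncomputable section

namespace EpsGraded

section MatrixAlgebra

variable {Γ : Type*} [AddCommGroup Γ] [DecidableEq Γ]

/-! ### Fine gradings of matrix algebras -/

/-- Simplicity in explicit form: a nonzero entry of a lets the scalar matrices be written as a sum
of products b a c. -/
theorem matrix_sum_single_mul {D : ℕ} (a : Matrix (Fin D) (Fin D) ℂ) (i j : Fin D) :
    ∑ k : Fin D, Matrix.single k i (1 : ℂ) * a * Matrix.single j k (1 : ℂ) = a i j • 1 := by
  simp only [Matrix.single_mul_mul_single, one_mul, mul_one]
  ext k l
  rw [Matrix.sum_apply, Matrix.smul_apply, Matrix.one_apply]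
  by_cases h : k = l
  · subst h
    rw [Finset.sum_eq_single k (fun m _ hm => Matrix.single_apply_of_ne _ _ _ _ _ (by simp [hm]))
      (by simp)]
    simp
  · rw [if_neg h, smul_zero]
    exact Finset.sum_eq_zero fun m _ => Matrix.single_apply_of_ne _ _ _ _ _ fun hm =>
      h (hm.1.symm.trans hm.2)

variable {D : ℕ} (𝒜 : Γ → Submodule ℂ (Matrix (Fin D) (Fin D) ℂ)) [GradedAlgebra 𝒜]

/-- Nonzero homogeneous elements generate the unit ideal. -/
theorem exists_mul_mul_ne_zero {α : Γ} {a : Matrix (Fin D) (Fin D) ℂ} (ha : a ∈ 𝒜 α)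
    (ha0 : a ≠ 0) : ∃ β γ : Γ, β + α + γ = 0 ∧ ∃ b ∈ 𝒜 β, ∃ c ∈ 𝒜 γ, b * a * c ≠ 0 := by
  by_contra! hcon
  let p : Matrix (Fin D) (Fin D) ℂ →ₗ[ℂ] Matrix (Fin D) (Fin D) ℂ := GradedAlgebra.proj 𝒜 0
  -- For homogeneous b and c the product vanishes by assumption or has nonzero degree. Bilinearity
  -- extends this to all b and c, in particular to the matrix units, which need not be homogeneous.
  -- The degree-zero part of a_{ij} · 1 would then vanish.
  have hp : ∀ b c, p (b * a * c) = 0 := by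
    have : ((LinearMap.mul ℂ (Matrix (Fin D) (Fin D) ℂ)) ∘ₗ
        LinearMap.mulRight ℂ a).compr₂ p = 0 :=
      lin_ext 𝒜 fun β b hb => lin_ext 𝒜 fun γ c hc => by
        change p (b * a * c) = 0
        have hm := SetLike.GradedMul.mul_mem (SetLike.GradedMul.mul_mem hb ha) hc
        by_cases h : β + α + γ = 0
        · rw [hcon β γ h b hb c hc, map_zero]
        · rw [GradedAlgebra.proj_apply, DirectSum.decompose_of_mem_ne 𝒜 hm h]
    exact fun b c => congrArg (fun f => f b c) this
  obtain ⟨i, j, hij⟩ : ∃ i j, a i j ≠ 0 := by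
    by_contra! h
    exact ha0 (Matrix.ext h)
  have h1 : p (a i j • 1) = 0 := by
    rw [← matrix_sum_single_mul, map_sum]
    exact Finset.sum_eq_zero fun k _ => hp _ _
  have h2 : p (a i j • 1) = a i j • 1 := by
    rw [map_smul, GradedAlgebra.proj_apply,
      DirectSum.decompose_of_mem_same 𝒜 (SetLike.GradedOne.one_mem (A := 𝒜))]
  rw [h2] at h1
  have := congrFun (congrFun h1 i) i
  rw [Matrix.smul_apply, Matrix.one_apply_eq, smul_eq_mul, mul_one] at this
  exact hij this

/-- A fine grading of a matrix algebra is a division grading. -/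
theorem isFineDivision_matrix (hfine : ∀ α, Module.finrank ℂ (𝒜 α) ≤ 1) : IsFineDivision 𝒜 := by
  have dim : ∀ α, ∀ a ∈ 𝒜 α, a ≠ 0 → ∀ b ∈ 𝒜 α, ∃ c : ℂ, b = c • a := by
    intro α a ha ha0 b hb
    obtain ⟨v, hv⟩ := finrank_le_one_iff.1 (hfine α)
    obtain ⟨r, hr⟩ := hv ⟨a, ha⟩
    obtain ⟨s, hs⟩ := hv ⟨b, hb⟩
    have hr' : r • (v : Matrix (Fin D) (Fin D) ℂ) = a := congrArg Subtype.val hr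
    have hs' : s • (v : Matrix (Fin D) (Fin D) ℂ) = b := congrArg Subtype.val hs
    have hr0 : r ≠ 0 := fun h => ha0 (by rw [← hr', h, zero_smul])
    exact ⟨s * r⁻¹, by rw [← hr', ← hs', smul_smul, inv_mul_cancel_right₀ hr0]⟩
  refine ⟨?_, dim, fun α a ha ha0 => ?_⟩
  · exact WellFoundedGT.finite_ne_bot_of_iSupIndep
      (DirectSum.Decomposition.isInternal 𝒜).submodule_iSupIndep
  · obtain ⟨β, γ, h, b, hb, c, hc, hne⟩ := exists_mul_mul_ne_zero 𝒜 ha ha0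
    have hm := SetLike.GradedMul.mul_mem (SetLike.GradedMul.mul_mem hb ha) hc
    rw [h] at hm
    have h1 : (1 : Matrix (Fin D) (Fin D) ℂ) ≠ 0 := fun h1 => hne (by
      rw [← one_mul (b * a * c), h1, zero_mul])
    obtain ⟨r, hr⟩ := dim 0 1 SetLike.GradedOne.one_mem h1 _ hm
    have hr0 : r ≠ 0 := fun h => hne (by rw [hr, h, zero_smul])
    -- The element b a c is nonzero of degree 0, hence a multiple r of 1. Thus b has a right inverse
    -- and c a left inverse. For square matrices one-sided inverses are two-sided, and reversing
    -- both products shows that r⁻¹ c b is inverse to a on either side.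
    have e1 : b * (r⁻¹ • (a * c)) = 1 := by
      rw [mul_smul_comm, ← mul_assoc, hr, smul_smul, inv_mul_cancel₀ hr0, one_smul]
    have e2 : (r⁻¹ • (b * a)) * c = 1 := by
      rw [smul_mul_assoc, hr, smul_smul, inv_mul_cancel₀ hr0, one_smul]
    have e3 := mul_eq_one_comm.1 e1
    have e4 := mul_eq_one_comm.1 e2
    refine ⟨r⁻¹ • (c * b), Submodule.smul_mem _ _ ?_, ?_, ?_⟩
    · have := SetLike.GradedMul.mul_mem hc hb
      rwa [show γ + β = -α by rw [eq_neg_iff_add_eq_zero, ← h]; abel] at this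
    · rw [← e3, smul_mul_assoc, mul_smul_comm, mul_assoc]
    · rw [← e4, smul_mul_assoc, mul_smul_comm, mul_assoc]

end MatrixAlgebra

end EpsGraded

end

/-! ### Assembly of the theorem. -/

open EpsGraded in
theorem mainTheorem9 {Γ : Type*} [AddCommGroup Γ] [DecidableEq Γ] (D : ℕ)
    (𝒜 : Γ → Submodule ℂ (Matrix (Fin D) (Fin D) ℂ)) [GradedAlgebra 𝒜]
    (hfine : ∀ α, Module.finrank ℂ (𝒜 α) ≤ 1) (ε : CommFactor Γ) :
    (∃! ev, IsEvaluation ε 𝒜 ev) ∧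
    ∀ ev, IsEvaluation ε 𝒜 ev →
      ∃ φ : Omega ε 𝒜 ≃ₗ[ℂ] Forms ε 𝒜,
        IsAdPush ε 𝒜 ev φ ∧
        (∀ ψ : Omega ε 𝒜 → Forms ε 𝒜, IsAdPush ε 𝒜 ev ψ → ψ = φ) ∧
        -- `φ` is an isomorphism of `ℤ × Γ`-graded algebras
        (∀ (n : ℕ) (k : Γ), (OmegaHom ε 𝒜 n k).map (φ : Omega ε 𝒜 →ₗ[ℂ] Forms ε 𝒜) =
          LinearMap.range (DirectSum.lof ℂ (ℕ × Γ) (fun p => Form ε 𝒜 p.1 p.2) (n, k))) ∧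
        (∀ X, formPart ε 𝒜 0 (φ 1) X = 1) ∧
        (∀ (p q : ℕ) (k l : Γ), ∀ u ∈ OmegaHom ε 𝒜 p k, ∀ v ∈ OmegaHom ε 𝒜 q l,
          u * v ∈ OmegaHom ε 𝒜 (p + q) (k + l) ∧
          IsFormProduct ε 𝒜 l (formPart ε 𝒜 p (φ u)) (formPart ε 𝒜 q (φ v))
            (formPart ε 𝒜 (p + q) (φ (u * v)))) ∧
        -- the `ε`-connections are an affine space modeled on `Ω^{1,0}`, via `∇ + ω : a ↦ ∇ a + ω a`
        (∃ tors : AddTorsor (Form ε 𝒜 1 0) (Connections ε 𝒜),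
          ∀ (ω : Form ε 𝒜 1 0) (N : Connections ε 𝒜) (β : Γ), ∀ a ∈ 𝒜 β,
            ∀ (γ : Γ) (X : Fin 1 → Der ε 𝒜), (X 0).1 ∈ DerHom ε 𝒜 γ →
              (tors.toAddAction.toVAdd.vadd ω N).1 a X = N.1 a X + ε.val β γ • (ω.1 X * a)) ∧
        -- `Ω^{1,0}` is the image of the sum over the `α` outside `agree` of the `A^α ⊗_Z (A^α)^*`,
        -- where `(A^α)^*` is the component of degree `-α` of the dual
        (∀ α ∉ agree ε 𝒜, ∀ f : 𝒜 α →ₗ[ℂ] ℂ, ∃! θ : Dual ε 𝒜, θ.1 ∈ DualHom ε 𝒜 (-α) ∧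
          ∀ (x : complI ε 𝒜) (hx : x.1 ∈ 𝒜 α), θ.1 x = algebraMap ℂ _ (f ⟨x, hx⟩)) ∧
        Form ε 𝒜 1 0 = (Submodule.span ℂ {u | ∃ α ∉ agree ε 𝒜, ∃ a ∈ 𝒜 α, ∃ θ : Dual ε 𝒜,
            θ.1 ∈ DualHom ε 𝒜 (-α) ∧ u = tmulZ ε 𝒜 a (extD ε 𝒜 θ)}).map
          (formPart ε 𝒜 1 ∘ₗ φ.toLinearMap) ∧
        -- if `ε` is proper, `φ` is an isomorphism of graded differential algebras
        (ε.IsProper →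
          ∃ hI : ∀ x ∈ complI ε 𝒜, ∀ y ∈ complI ε 𝒜, epsBracket ε 𝒜 x y ∈ complI ε 𝒜,
          ∃ d : Omega ε 𝒜 →ₗ[ℂ] Omega ε 𝒜,
            IsOmegaDiff ε 𝒜 ev hI d ∧
            (∀ d', IsOmegaDiff ε 𝒜 ev hI d' → d' = d) ∧
            (∀ u, d (d u) = 0) ∧
            (∀ (p : ℕ) (k : Γ), ∀ u ∈ OmegaHom ε 𝒜 p k, ∀ v,
              d (u * v) = d u * v + (-1 : ℂ) ^ p • (u * d v)) ∧
            ∀ (p : ℕ) (k : Γ), ∀ u ∈ OmegaHom ε 𝒜 p k,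
              IsFormDiff ε 𝒜 k (formPart ε 𝒜 p (φ u)) (formPart ε 𝒜 (p + 1) (φ (d u)))) := by
  have H := isFineDivision_matrix 𝒜 hfine
  refine ⟨⟨H.evalOmega ε, H.isEvaluation, fun _ h => H.eq_evalOmega h⟩, fun ev hev => ?_⟩
  obtain rfl := H.eq_evalOmega hev
  refine ⟨H.adPush ε, H.isAdPush, fun ψ hψ => H.eq_adPush hψ, H.map_adPush, H.formPart_adPush_one,
    fun p q k l u hu v hv => ⟨omegaHom_mul hu hv, H.isFormProduct_adPush hu hv⟩,
    ⟨H.connectionsTorsor ε, fun ω N β a ha γ X hX => H.connectionsTorsor_vadd ω N ha hX⟩,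
    fun α hα f => H.existsUnique_dual hα f, H.form_one_zero, fun hε => ?_⟩
  have hI := H.bracket_mem_complI hε
  exact ⟨hI, H.diff ε hI, H.isOmegaDiff hI, fun d' hd' => H.eq_diff hI hd', H.diff_diff hI,
    fun p k u hu v => H.diff_mul hI hu v, fun p k u hu => H.isFormDiff_adPush hI hu⟩
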